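/- Let $d\in\{2,3\}$, $k\ge 1$, and let $C_0>1$, $C_b\ge 0$, $c_b\ge 0$, $D$ be real constants. There is a constant $C\ge 0$, depending only on $d,k,C_0,C_b,c_b,D$, such that the following holds. **Setting.** Let $\Omega\subset\mathbb R^d$ be a bounded polygonal (polyhedral) domain with Lipschitz boundary and $\operatorname{diam}\Omega\le D$, and let $\partial\Omega=\Gamma_D\cup\Gamma_N$ be a disjoint decomposition with $\operatorname{meas}(\Gamma_D)>0$. Let $\mathcal T$ be a conforming simplicial triangulation of $\overline\Omega$ with $h_K\le C_0R_K$ for all $K\in\mathcal T$, where $h_S$ denotes the diameter of a simplex $S$ and $R_K$ the inradius of $K$. Let $\mathcal E$ be the set of its edges ($d=2$) or faces ($d=3$), called facets. Every facet is interior, or its relative interior lies in $\Gamma_D$ or in $\Gamma_N$; write $\mathcal E_I,\mathcal E_D,\mathcal E_N$ for the three sets and $\mathcal E_K$ for the facets of $K$. Let $\omega_K$ be the union of the elements that share at least one facet with $K$ (including $K$), and $\omega_e$ the union of the elements that contain the facet $e$. Let $\alpha$, $\mathbf a$, $b$ be constant on each element, with $\alpha\ge\delta$ a.e. for some $\delta>0$,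 $\mathbf a\in W^{1,\infty}(\Omega)^d$, $b\in L^\infty(\Omega)$, and let $\beta\ge 0$ be such that $$b-\tfrac12\operatorname{div}\mathbf a\ge\beta\ \text{ a.e. in }\Omega,\qquad \|b\|_{L^\infty(\Omega)}\le c_b\beta .$$ Let $\Gamma_D$ contain the inflow boundary $\{\mathbf a\cdot\mathbf n<0\}$ (i.e. all boundary facets on which $\mathbf a\cdot\mathbf n<0$). Assume the diffusion-dominated regime: $|\mathbf a/\alpha|\le C_b$ and $|b/\alpha|\le C_b$ a.e. in $\Omega$. Let $f\in L^2(\Omega)$ and $g_N\in L^2(\Gamma_N)$. With $H^1_D(\Omega)=\{v\in H^1(\Omega):v|_{\Gamma_D}=0\}$ and $B(u,v)=(\alpha\nabla u,\nabla v)+(\mathbf a\cdot\nabla u,v)+(bu,v)$, let $u\in H^1_D(\Omega)$ satisfy $$B(u,v)=(f,v)-(g_N,v)_{\Gamma_N}\qquad\forall v\in H^1_D(\Omega),$$ and let $u_{\mathcal T}\in V_{\mathcal T}=\{v\in C(\overline\Omega):v|_K\in P_k(K)\ \forall K\in\mathcal T,\ v|_{\Gamma_D}=0\}$ satisfy the same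 equation for all $v\in V_{\mathcal T}$. **Indicator.** Let $\bar f|_K$ be the $L^2(K)$-projection of $f$ onto $P_{k-1}(K)$, and $\bar g_N|_e$ the $L^2(e)$-projection of $g_N$ onto $P_{k-1}(e)$ for $e\in\mathcal E_N$. Put $\sigma_{\mathcal T}=-\alpha\nabla u_{\mathcal T}$, $\alpha_K=\alpha|_K$, $\alpha_e=\max_{K\subseteq\omega_e}\alpha_K$, and $$r_K=\bar f-\mathbf a\cdot\nabla u_{\mathcal T}-bu_{\mathcal T}-\operatorname{div}\sigma_{\mathcal T}\quad\text{on }K,$$ $$j_e=\begin{cases}(\sigma_{\mathcal T}|_{K_e^+}-\sigma_{\mathcal T}|_{K_e^-})\cdot\mathbf n_e,&e\in\mathcal E_I,\\ \sigma_{\mathcal T}\cdot\mathbf n-\bar g_N,&e\in\mathcal E_N,\\ 0,&e\in\mathcal E_D,\end{cases}$$ where $K_e^\pm$ are the two elements containing $e$ and $\mathbf n_e$ is the unit normal of $e$ that is outward for $K_e^+$. Define $$\eta_K^2=h_K^2\alpha_K^{-1}\|r_K\|_{L^2(K)}^2+\tfrac12\sum_{e\in\mathcal E_K}h_e\alpha_e^{-1}\|j_e\|_{L^2(e)}^2,$$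 $$\Theta_K^2=h_K^2\alpha_K^{-1}\|f-\bar f\|_{L^2(K)}^2+\sum_{e\in\mathcal E_K\cap\mathcal E_N}h_e\alpha_e^{-1}\|g_N-\bar g_N\|_{L^2(e)}^2,$$ and, for $S\subseteq\Omega$, $|||v|||_S=\big(\|\alpha^{1/2}\nabla v\|_{L^2(S)}^2+\beta\|v\|_{L^2(S)}^2\big)^{1/2}$. **Conclusion.** For every $K\in\mathcal T$, $$\eta_K\le C\Big(|||u_{\mathcal T}-u|||_{\omega_K}+\sum_{K'\subseteq\omega_K}\Theta_{K'}\Big).$$ In particular $C$ is independent of the mesh size and of $\alpha$ (hence of $\alpha_{\max}/\alpha_{\min}$). -/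

import Mathlib

open MeasureTheory Set Filter Topology
open scoped ENNReal ContDiff RealInnerProductSpace

noncomputable section

namespace CDR

/-- Euclidean space `ℝᵈ`. -/
abbrev E (d : ℕ) := EuclideanSpace ℝ (Fin d)

variable {d : ℕ}

/-! ### Lebesgue and surface measure, `L²` norms and projections -/

/-- The `(d-1)`-dimensional surface measure, normalized to be Lebesgue measure on hyperplanes. -/
def surf (d : ℕ) : Measure (E d) := μHE[d - 1]

/-- The `L²(μ)` norm of a scalar or vector valued function. -/
def l2norm {F : Type*} [NormedAddCommGroup F] (μ : Measure (E d)) (f : E d → F) : ℝ :=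
  Real.sqrt (∫ x, ‖f x‖ ^ 2 ∂μ)

/-- The subspace of `L²(μ)` of (classes of) polynomial functions of total degree at most `m`. -/
def polyL2 (μ : Measure (E d)) (m : ℕ) : Submodule ℝ (Lp ℝ 2 μ) where
  carrier := {g | ∃ p : MvPolynomial (Fin d) ℝ, p.totalDegree ≤ m ∧
    g =ᵐ[μ] fun x => MvPolynomial.eval (fun i => x i) p}
  zero_mem' := ⟨0, by simp, by
    filter_upwards [Lp.coeFn_zero ℝ 2 μ] with x hx
    rw [hx]
    simp⟩
  add_mem' := by
    rintro g h ⟨p, hp, hgp⟩ ⟨q, hq, hhq⟩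
    refine ⟨p + q, (MvPolynomial.totalDegree_add p q).trans (max_le hp hq), ?_⟩
    filter_upwards [Lp.coeFn_add g h, hgp, hhq] with x h1 h2 h3
    rw [h1, Pi.add_apply, h2, h3, map_add]
  smul_mem' := by
    rintro c g ⟨p, hp, hgp⟩
    refine ⟨c • p, (MvPolynomial.totalDegree_smul_le c p).trans hp, ?_⟩
    filter_upwards [Lp.coeFn_smul c g, hgp] with x h1 h2
    rw [h1, Pi.smul_apply, h2, MvPolynomial.smul_eval, smul_eq_mul]

instance polyL2_finiteDimensional (μ : Measure (E d)) (m : ℕ) :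
    FiniteDimensional ℝ (polyL2 μ m) := by
  classical
  let W : Submodule ℝ (MvPolynomial (Fin d) ℝ) :=
    { carrier := {p | p.totalDegree ≤ m ∧
        MemLp (fun x : E d => MvPolynomial.eval (fun i => x i) p) 2 μ}
      zero_mem' := ⟨by simp, by simp⟩
      add_mem' := by
        rintro p q ⟨hp, hp'⟩ ⟨hq, hq'⟩
        refine ⟨(MvPolynomial.totalDegree_add p q).trans (max_le hp hq), ?_⟩
        simp only [map_add]
        exact hp'.add hq'
      smul_mem' := by
        rintro c p ⟨hp, hp'⟩
        refine ⟨(MvPolynomial.totalDegree_smul_le c p).trans hp, ?_⟩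
        simpa [MvPolynomial.smul_eval] using hp'.const_mul c }
  have hW : W ≤ MvPolynomial.restrictTotalDegree (Fin d) ℝ m := by
    intro p hp
    exact (MvPolynomial.mem_restrictTotalDegree (Fin d) m p).2 hp.1
  have : FiniteDimensional ℝ W := Submodule.finiteDimensional_of_le hW
  let L : W →ₗ[ℝ] Lp ℝ 2 μ :=
    { toFun := fun p => p.2.2.toLp _
      map_add' := by
        intro p q
        rw [← MemLp.toLp_add]
        congr 1
        ext x
        simp
      map_smul' := by
        intro c p
        rw [RingHom.id_apply, ← MemLp.toLp_const_smul]
        congr 1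
        ext x
        simp [MvPolynomial.smul_eval] }
  refine Submodule.finiteDimensional_of_le (S₂ := LinearMap.range L) ?_
  rintro g ⟨p, hp, hgp⟩
  have hmem : MemLp (fun x : E d => MvPolynomial.eval (fun i => x i) p) 2 μ :=
    (memLp_congr_ae hgp).1 (Lp.memLp g)
  refine ⟨⟨p, hp, hmem⟩, ?_⟩
  apply Lp.ext
  exact (MemLp.coeFn_toLp hmem).trans hgp.symm

open Classical in
/-- The `L²(μ)`-orthogonal projection of `f` onto the polynomials of degree at most `m`
(for `f ∈ L²(μ)`; the value for other `f` is irrelevant). -/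
def l2Proj (μ : Measure (E d)) (m : ℕ) (f : E d → ℝ) : E d → ℝ :=
  if h : MemLp f 2 μ then ((polyL2 μ m).starProjection (h.toLp f) : Lp ℝ 2 μ) else 0

/-! ### Sobolev functions and traces -/

/-- `g` is the distributional gradient of `v` in `Ω`. -/
def IsWeakGradient (Ω : Set (E d)) (v : E d → ℝ) (g : E d → E d) : Prop :=
  LocallyIntegrableOn v Ω ∧ LocallyIntegrableOn g Ω ∧
  ∀ φ : E d → ℝ, ContDiff ℝ ∞ φ → HasCompactSupport φ → tsupport φ ⊆ Ω →
    ∫ x in Ω, v x • gradient φ x = -∫ x in Ω, φ x • g x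

/-- A function in `H¹(Ω)`, together with its weak gradient. -/
structure H1Function (Ω : Set (E d)) where
  toFun : E d → ℝ
  grad : E d → E d
  memLp : MemLp toFun 2 (volume.restrict Ω)
  memLp_grad : MemLp grad 2 (volume.restrict Ω)
  weak : IsWeakGradient Ω toFun grad

/-- `γ` is the trace of `v ∈ H¹(Ω)` on `∂Ω`: the trace operator is the continuous extension to
`H¹(Ω)`, with values in `L²(∂Ω)`, of the restriction `w ↦ w|_{∂Ω}` on `H¹(Ω) ∩ C(closure Ω)`. -/
def IsTrace {Ω : Set (E d)} (v : H1Function Ω) (γ : E d → ℝ) : Prop :=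
  MemLp γ 2 ((surf d).restrict (frontier Ω)) ∧
  ∃ w : ℕ → H1Function Ω, (∀ n, ContinuousOn (w n).toFun (closure Ω)) ∧
    Tendsto (fun n => eLpNorm ((w n).toFun - v.toFun) 2 (volume.restrict Ω)) atTop (𝓝 0) ∧
    Tendsto (fun n => eLpNorm ((w n).grad - v.grad) 2 (volume.restrict Ω)) atTop (𝓝 0) ∧
    Tendsto (fun n => eLpNorm ((w n).toFun - γ) 2 ((surf d).restrict (frontier Ω))) atTop (𝓝 0)

/-- `v ∈ H¹_D(Ω)` and `γ` is its trace. -/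
def IsTraceVanishing {Ω : Set (E d)} (ΓD : Set (E d)) (v : H1Function Ω) (γ : E d → ℝ) : Prop :=
  IsTrace v γ ∧ ∀ᵐ x ∂((surf d).restrict ΓD), γ x = 0

/-! ### The domain and its triangulations -/

/-- `Ω` is locally, in suitable Cartesian coordinates, the strict epigraph of a Lipschitz
function of the coordinates orthogonal to `n`. -/
def HasLipschitzBoundary (Ω : Set (E d)) : Prop :=
  ∀ x ∈ frontier Ω, ∃ n : E d, ‖n‖ = 1 ∧ ∃ (L : NNReal) (φ : E d → ℝ), LipschitzWith L φ ∧
    ∃ r > 0, ∀ y ∈ Metric.ball x r, (y ∈ Ω ↔ φ (y - ⟪n, y⟫ • n) < ⟪n, y⟫)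

/-- Bounded Lipschitz domain whose boundary is split into a Dirichlet part of positive surface
measure and a Neumann part. -/
structure IsDomainWithBoundary (Ω ΓD ΓN : Set (E d)) : Prop where
  isOpen : IsOpen Ω
  isConnected : IsConnected Ω
  isBounded : Bornology.IsBounded Ω
  lipschitz : HasLipschitzBoundary Ω
  union_eq : ΓD ∪ ΓN = frontier Ω
  disjoint : Disjoint ΓD ΓN
  dirichlet_pos : 0 < surf d ΓD

/-- A (conforming) triangulation of the closure of `Ω`: a finite simplicial complex all of whose
maximal simplices are `d`-dimensional. Simplices are given by their vertex sets. The existence of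
one expresses that `Ω` is polygonal (polyhedral). -/
structure Triangulation (Ω : Set (E d)) where
  complex : Geometry.SimplicialComplex ℝ (E d)
  finite : complex.faces.Finite
  pure : ∀ s ∈ complex.faces, ∃ t ∈ complex.faces, s ⊆ t ∧ t.card = d + 1
  space_eq : complex.space = closure Ω

/-- The closed simplex with vertex set `s`. -/
def body (s : Finset (E d)) : Set (E d) := convexHull ℝ (s : Set (E d))

/-- The diameter `h_S`. -/
def diam (s : Finset (E d)) : ℝ := Metric.diam (body s)

/-- The inradius `R_K`. -/
def inradius (K : Finset (E d)) : ℝ :=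
  sSup {r : ℝ | ∃ x, Metric.closedBall x r ⊆ body K}

/-- The barycenter. -/
def barycenter (s : Finset (E d)) : E d := s.centroid ℝ id

/-- The unit outward normal of the `d`-simplex `K` on its facet `e`: the normalized component
orthogonal to `e` of the vector from the barycenter of `K` to that of `e`. -/
def outwardNormal (K e : Finset (E d)) : E d :=
  let w := (vectorSpan ℝ (e : Set (E d)))ᗮ.starProjection (barycenter e - barycenter K)
  ‖w‖⁻¹ • w

namespace Triangulation

variable {Ω : Set (E d)} (T : Triangulation Ω)

open Classical in
/-- The elements (`d`-simplices). -/
def cells : Finset (Finset (E d)) := T.finite.toFinset.filter fun s => s.card = d + 1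

open Classical in
/-- The edges (`d = 2`) or faces (`d = 3`): the `(d-1)`-simplices. -/
def facets : Finset (Finset (E d)) := T.finite.toFinset.filter fun s => s.card = d

open Classical in
/-- The facets of the element `K`. -/
def facetsOf (K : Finset (E d)) : Finset (Finset (E d)) := T.facets.filter fun e => e ⊆ K

open Classical in
/-- The elements adjacent to the facet `e`; their union is `ω_e`. -/
def cellsAt (e : Finset (E d)) : Finset (Finset (E d)) := T.cells.filter fun K => e ⊆ K

open Classical in
/-- The elements sharing at least one facet with `K` (`K` among them); their union is `ω_K`. -/
def neighbors (K : Finset (E d)) : Finset (Finset (E d)) :=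
  T.cells.filter fun K' => ∃ e ∈ T.facets, e ⊆ K ∧ e ⊆ K'

/-- The patch `ω_K`. -/
def patch (K : Finset (E d)) : Set (E d) := ⋃ K' ∈ T.neighbors K, body K'

/-- `h_K ≤ C₀ R_K` for all elements. -/
def ShapeRegular (C₀ : ℝ) : Prop := ∀ K ∈ T.cells, diam K ≤ C₀ * inradius K

end Triangulation

/-- The relative interior of the simplex `e` lies in `S`. For facets `e` and `S = Ω, Γ_D, Γ_N` this
says that `e` is an interior, a Dirichlet or a Neumann facet. -/
def LiesIn (e : Finset (E d)) (S : Set (E d)) : Prop := intrinsicInterior ℝ (body e) ⊆ S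

/-- Every facet is an interior, a Dirichlet or a Neumann facet. -/
def Triangulation.Resolves {Ω : Set (E d)} (T : Triangulation Ω) (ΓD ΓN : Set (E d)) : Prop :=
  ∀ e ∈ T.facets, LiesIn e Ω ∨ LiesIn e ΓD ∨ LiesIn e ΓN

/-! ### Coefficients -/

/-- The constant value on `K` of a function that is constant in the interior of `K`. -/
def cellValue {F : Type*} (c : E d → F) (K : Finset (E d)) : F := c (barycenter K)

/-- `c` is constant in the interior of each element. -/
def IsCellwiseConstant {F : Type*} {Ω : Set (E d)} (T : Triangulation Ω) (c : E d → F) : Prop :=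
  ∀ K ∈ T.cells, ∀ x ∈ interior (body K), c x = cellValue c K

/-- The standing assumptions on the coefficients `α`, `a`, `b` and the constants `β`, `c_b`.
Here `Da i` is the weak gradient of the `i`-th component of `a`, so `div a = ∑ i, (Da i) i`. -/
structure IsAdmissible {Ω : Set (E d)} (T : Triangulation Ω) (ΓD : Set (E d))
    (α : E d → ℝ) (a : E d → E d) (b : E d → ℝ) (β cb : ℝ) (Da : Fin d → E d → E d) : Prop where
  alpha_pos : ∃ δ > 0, ∀ᵐ x ∂(volume.restrict Ω), δ ≤ α x
  alpha_const : IsCellwiseConstant T α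
  a_const : IsCellwiseConstant T a
  b_const : IsCellwiseConstant T b
  a_memLp : MemLp a ∞ (volume.restrict Ω)
  a_weak : ∀ i, IsWeakGradient Ω (fun x => a x i) (Da i)
  Da_memLp : ∀ i, MemLp (Da i) ∞ (volume.restrict Ω)
  b_memLp : MemLp b ∞ (volume.restrict Ω)
  beta_nonneg : 0 ≤ β
  coercive : ∀ᵐ x ∂(volume.restrict Ω), β ≤ b x - (1 / 2) * ∑ i, Da i x i
  b_bound : ∀ᵐ x ∂(volume.restrict Ω), |b x| ≤ cb * β
  inflow : ∀ e ∈ T.facets, ¬ LiesIn e Ω → ∀ K ∈ T.cellsAt e,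
    ⟪cellValue a K, outwardNormal K e⟫ < 0 → LiesIn e ΓD

/-- The diffusion-dominated regime. -/
def DiffusionDominated (Ω : Set (E d)) (α : E d → ℝ) (a : E d → E d) (b : E d → ℝ) (Cb : ℝ) :
    Prop :=
  ∀ᵐ x ∂(volume.restrict Ω), ‖a x‖ / α x ≤ Cb ∧ |b x| / α x ≤ Cb

/-! ### Weak formulation and finite element approximation -/

/-- `B(u,v)`, in terms of the functions `u`, `v` and their gradients `Du`, `Dv`. -/
def bilin (Ω : Set (E d)) (α : E d → ℝ) (a : E d → E d) (b : E d → ℝ)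
    (u : E d → ℝ) (Du : E d → E d) (v : E d → ℝ) (Dv : E d → E d) : ℝ :=
  (∫ x in Ω, α x * ⟪Du x, Dv x⟫) + (∫ x in Ω, ⟪a x, Du x⟫ * v x) + ∫ x in Ω, b x * u x * v x

/-- `u ∈ H¹_D(Ω)` and `B(u,v) = (f,v) - (g_N,v)_{Γ_N}` for all `v ∈ H¹_D(Ω)`. -/
def IsWeakSolution (Ω ΓD ΓN : Set (E d)) (α : E d → ℝ) (a : E d → E d) (b : E d → ℝ)
    (f gN : E d → ℝ) (u : H1Function Ω) : Prop :=
  (∃ γ, IsTraceVanishing ΓD u γ) ∧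
  ∀ (v : H1Function Ω) (γ : E d → ℝ), IsTraceVanishing ΓD v γ →
    bilin Ω α a b u.toFun u.grad v.toFun v.grad =
      (∫ x in Ω, f x * v.toFun x) - ∫ x in ΓN, gN x * γ x ∂(surf d)

/-- The space `V_T` of continuous functions that are polynomials of degree at most `k` on each
element and vanish on `Γ_D`. Its members are differentiable in the interior of the elements, and
their weak gradient is the classical one, `gradient v`, almost everywhere. -/
def IsFEFunction {Ω : Set (E d)} (T : Triangulation Ω) (ΓD : Set (E d)) (k : ℕ)
    (v : E d → ℝ) : Prop :=
  ContinuousOn v (closure Ω) ∧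
  (∀ K ∈ T.cells, ∃ p : MvPolynomial (Fin d) ℝ, p.totalDegree ≤ k ∧
    ∀ x ∈ body K, v x = MvPolynomial.eval (fun i => x i) p) ∧
  ∀ x ∈ ΓD, v x = 0

/-- `uT ∈ V_T` and `B(uT,v) = (f,v) - (g_N,v)_{Γ_N}` for all `v ∈ V_T`. -/
def IsFESolution {Ω : Set (E d)} (T : Triangulation Ω) (ΓD ΓN : Set (E d)) (k : ℕ)
    (α : E d → ℝ) (a : E d → E d) (b : E d → ℝ) (f gN uT : E d → ℝ) : Prop :=
  IsFEFunction T ΓD k uT ∧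
  ∀ v, IsFEFunction T ΓD k v →
    bilin Ω α a b uT (gradient uT) v (gradient v) =
      (∫ x in Ω, f x * v x) - ∫ x in ΓN, gN x * v x ∂(surf d)

/-- The energy norm over `S`, in terms of the function `w` and its gradient `Dw`. -/
def energyNorm (α : E d → ℝ) (β : ℝ) (S : Set (E d)) (w : E d → ℝ) (Dw : E d → E d) : ℝ :=
  Real.sqrt (l2norm (volume.restrict S) (fun x => Real.sqrt (α x) • Dw x) ^ 2 +
    β * l2norm (volume.restrict S) w ^ 2)

/-! ### The residual indicator and the data oscillation -/

/-- Lebesgue measure on the element `K`. -/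
def cellMeasure (K : Finset (E d)) : Measure (E d) := volume.restrict (body K)

/-- Surface measure on the facet `e`. -/
def facetMeasure (e : Finset (E d)) : Measure (E d) := (surf d).restrict (body e)

/-- The gradient on `K` (up to its boundary) of the restriction `v|_K`. -/
def cellGrad (v : E d → ℝ) (K : Finset (E d)) (x : E d) : E d := gradientWithin v (body K) x

/-- The numerical flux on `K` (up to its boundary), `σ_T|_K = -α_K ∇(uT|_K)`. -/
def flux (α uT : E d → ℝ) (K : Finset (E d)) (x : E d) : E d :=
  -(cellValue α K • cellGrad uT K x)

/-- The divergence on `K` of a vector field on `K`. -/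
def cellDiv (σ : E d → E d) (K : Finset (E d)) (x : E d) : ℝ :=
  ∑ i, fderivWithin ℝ σ (body K) x (EuclideanSpace.single i 1) i

/-- The element residual `r_K = f̄ - a·∇uT - b uT - div σ_T`, with `f̄ = Π_K^{k-1} f`. -/
def residual (k : ℕ) (α : E d → ℝ) (a : E d → E d) (b f uT : E d → ℝ)
    (K : Finset (E d)) (x : E d) : ℝ :=
  l2Proj (cellMeasure K) (k - 1) f x - ⟪cellValue a K, cellGrad uT K x⟫ -
    cellValue b K * uT x - cellDiv (flux α uT K) K x

open Classical in
/-- The flux jump `j_e`. On an interior facet shared by `K⁺` and `K⁻`, whose outward normals are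
`n_e` and `-n_e`, the jump `(σ_T|_{K⁺} - σ_T|_{K⁻})·n_e` is the sum over `K⁺`, `K⁻` of the normal
components of `σ_T` in the outward directions. On a Neumann facet the sum has one term. -/
def jump {Ω : Set (E d)} (T : Triangulation Ω) (ΓN : Set (E d)) (k : ℕ)
    (α gN uT : E d → ℝ) (e : Finset (E d)) (x : E d) : ℝ :=
  if LiesIn e Ω then
    ∑ K ∈ T.cellsAt e, ⟪flux α uT K x, outwardNormal K e⟫
  else if LiesIn e ΓN then
    ∑ K ∈ T.cellsAt e, ⟪flux α uT K x, outwardNormal K e⟫ - l2Proj (facetMeasure e) (k - 1) gN x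
  else 0

/-- `α_e`, the maximum of `α_K` over the elements adjacent to `e`. -/
def alphaFacet {Ω : Set (E d)} (T : Triangulation Ω) (α : E d → ℝ) (e : Finset (E d)) : ℝ :=
  sSup (cellValue α '' (T.cellsAt e : Set (Finset (E d))))

/-- The residual indicator `η_K` (all weights `γ_S` are `1` in the diffusion-dominated regime). -/
def eta {Ω : Set (E d)} (T : Triangulation Ω) (ΓN : Set (E d)) (k : ℕ)
    (α : E d → ℝ) (a : E d → E d) (b f gN uT : E d → ℝ) (K : Finset (E d)) : ℝ :=
  Real.sqrt (diam K ^ 2 * (cellValue α K)⁻¹ *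
      l2norm (cellMeasure K) (residual k α a b f uT K) ^ 2 +
    (1 / 2) * ∑ e ∈ T.facetsOf K, diam e * (alphaFacet T α e)⁻¹ *
      l2norm (facetMeasure e) (jump T ΓN k α gN uT e) ^ 2)

open Classical in
/-- The data oscillation `Θ_K`. -/
def osc {Ω : Set (E d)} (T : Triangulation Ω) (ΓN : Set (E d)) (k : ℕ)
    (α f gN : E d → ℝ) (K : Finset (E d)) : ℝ :=
  Real.sqrt (diam K ^ 2 * (cellValue α K)⁻¹ *
      l2norm (cellMeasure K) (fun x => f x - l2Proj (cellMeasure K) (k - 1) f x) ^ 2 +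
    ∑ e ∈ (T.facetsOf K).filter (fun e => LiesIn e ΓN), diam e * (alphaFacet T α e)⁻¹ *
      l2norm (facetMeasure e) (fun x => gN x - l2Proj (facetMeasure e) (k - 1) gN x) ^ 2)

end CDR

end

/-! The argument is Verfürth's bubble-function technique. Integrating by parts on each element turns
`B(u_T - u, V)` into the element residuals, the data errors and the flux jumps, all tested with `V`.
If `V` is a cutoff times the polynomial to be estimated, one of these terms dominates the square of
a local `L²` norm of that polynomial, while the remaining terms are controlled by the energy norm of
the error through the continuity of `B`.

The cutoffs are smooth and supported in small balls: inside `K` for the residual, around the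
barycenter of a facet for the jump. This replaces the usual passage to a reference simplex. Shape
regularity supplies balls of radius comparable to the local mesh size, and `inverse_estimate`, which
is finite dimensionality plus scaling, compares a polynomial on a ball with its `L²` norm on a
smaller concentric ball. The geometry enters through `IsSimplex.isFacetAt`: at distances from the
barycenter of `e` that are small but comparable to `h_e`, an adjacent element coincides with a
half-space. Hence the divergence theorem is needed on half-spaces only (`integral_halfSpace_div`,
`integral_parts_facet`), and a bubble cut off to the elements at `e` stays continuous and lies in
`H¹_D`, so it may be inserted into the equation for `u` (`sum_cellBilin_eq`).

Two observations keep the constant independent of `α`. First, `|a| ≤ C_b α` and `|b| ≤ (C_b α)^{1/2}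
(c_b β)^{1/2}` give every term of `B` on `K` the factor `√α_K` times the energy error
(`abs_cellBilin_le`); the power of `h` that the lower order terms lack is paid for by `h ≤ D`.
Second, `α_e` is a maximum, so `√α_K / √α_e ≤ 1` and `α_e^{-1/2} ≤ α_K^{-1/2}` for each element at
`e`, and no ratio of diffusion coefficients survives (`exists_jump_bound`). The residual is
estimated before the jump, since it reappears in the jump estimate. `exists_residual_bound` and
`exists_jump_bound`, summed over boundedly many facets and elements, give `exists_efficiency_bound`.
-/

noncomputable section

namespace CDR

section

/-! ### Polynomial functions and inverse estimates -/

/-- `f` is a polynomial function of total degree at most `m`. -/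
def IsPoly {n : ℕ} (m : ℕ) (f : E n → ℝ) : Prop :=
  ∃ p : MvPolynomial (Fin n) ℝ, p.totalDegree ≤ m ∧
    ∀ x, f x = MvPolynomial.eval (fun i => x i) p

/-- The drop in degree is ignored here and below: the inverse estimates only require one degree
bound common to all residuals and jumps. -/
theorem totalDegree_pderiv_le {σ : Type*} (i : σ) (p : MvPolynomial σ ℝ) :
    (MvPolynomial.pderiv i p).totalDegree ≤ p.totalDegree := by
  classical
  conv_lhs => rw [p.as_sum, map_sum]
  refine MvPolynomial.totalDegree_finsetSum_le fun s hs => ?_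
  rw [MvPolynomial.pderiv_monomial]
  refine (MvPolynomial.totalDegree_monomial_le _ _).trans ?_
  refine le_trans ?_ (MvPolynomial.le_totalDegree hs)
  change ((s - Finsupp.single i 1).sum fun _ e => e) ≤ s.sum fun _ e => e
  have h : s - Finsupp.single i 1 ≤ s := tsub_le_self
  exact Finsupp.degree_mono h

theorem hasFDerivAt_eval {n : ℕ} (p : MvPolynomial (Fin n) ℝ) (x : E n) :
    HasFDerivAt (fun x : E n => MvPolynomial.eval (fun i => x i) p)
      (∑ i, MvPolynomial.eval (fun i => x i) (MvPolynomial.pderiv i p) •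
        (EuclideanSpace.proj i : E n →L[ℝ] ℝ)) x := by
  classical
  induction p using MvPolynomial.induction_on with
  | C a => simpa using hasFDerivAt_const a x
  | add p q hp hq =>
    simp only [map_add, add_smul, Finset.sum_add_distrib]
    exact hp.add hq
  | mul_X p j hp =>
    have hj : HasFDerivAt (fun x : E n => x j) (EuclideanSpace.proj j : E n →L[ℝ] ℝ) x :=
      (EuclideanSpace.proj j : E n →L[ℝ] ℝ).hasFDerivAt
    have := hp.mul hj
    simp only [map_mul, MvPolynomial.eval_X]
    refine this.congr_fderiv ?_
    ext v
    simp only [Derivation.leibniz, MvPolynomial.pderiv_X, smul_eq_mul, map_add, map_mul,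
      MvPolynomial.eval_X, add_smul, Finset.sum_add_distrib, add_apply,
      smul_apply, sum_apply, Finset.smul_sum, mul_smul]
    congr 1
    rw [Finset.sum_eq_single j]
    · simp
    · intro b _ hb
      simp [hb.symm]
    · simp

theorem gradient_ofLp {n : ℕ} (f : E n → ℝ) (x : E n) (i : Fin n) :
    gradient f x i = fderiv ℝ f x (EuclideanSpace.single i 1) := by
  have : gradient f x i = ⟪gradient f x, EuclideanSpace.single i 1⟫ := by
    rw [EuclideanSpace.inner_single_right]
    simp
  rw [this, gradient, InnerProductSpace.toDual_symm_apply]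

namespace IsPoly

variable {n m : ℕ} {f g : E n → ℝ}

theorem mono {m' : ℕ} (h : IsPoly m f) (hm : m ≤ m') : IsPoly m' f := by
  obtain ⟨p, hp, h⟩ := h
  exact ⟨p, hp.trans hm, h⟩

theorem const (c : ℝ) : IsPoly m (fun _ : E n => c) := ⟨MvPolynomial.C c, by simp, by simp⟩

theorem add (hf : IsPoly m f) (hg : IsPoly m g) : IsPoly m (fun x => f x + g x) := by
  obtain ⟨p, hp, hf⟩ := hf
  obtain ⟨q, hq, hg⟩ := hg
  exact ⟨p + q, (MvPolynomial.totalDegree_add p q).trans (max_le hp hq), fun x => by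
    simp [hf, hg]⟩

theorem mul {m' : ℕ} (hf : IsPoly m f) (hg : IsPoly m' g) :
    IsPoly (m + m') (fun x => f x * g x) := by
  obtain ⟨p, hp, hf⟩ := hf
  obtain ⟨q, hq, hg⟩ := hg
  exact ⟨p * q, (MvPolynomial.totalDegree_mul p q).trans (add_le_add hp hq), fun x => by
    simp [hf, hg]⟩

theorem const_mul (c : ℝ) (hf : IsPoly m f) : IsPoly m (fun x => c * f x) := by
  simpa using (const (m := 0) c).mul hf

theorem sub (hf : IsPoly m f) (hg : IsPoly m g) : IsPoly m (fun x => f x - g x) := by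
  simpa [sub_eq_add_neg] using hf.add (hg.const_mul (-1))

theorem sum {ι : Type*} (s : Finset ι) {F : ι → E n → ℝ} (h : ∀ i ∈ s, IsPoly m (F i)) :
    IsPoly m (fun x => ∑ i ∈ s, F i x) := by
  classical
  induction s using Finset.induction_on with
  | empty => simpa using const 0
  | insert a s ha ih =>
    simp only [Finset.sum_insert ha]
    exact (h a (by simp)).add (ih fun i hi => h i (by simp [hi]))

theorem coord (i : Fin n) : IsPoly 1 (fun x : E n => x i) :=
  ⟨MvPolynomial.X i, by simp, by simp⟩

theorem pow (hf : IsPoly m f) (j : ℕ) : IsPoly (m * j) (fun x => f x ^ j) := by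
  induction j with
  | zero => simpa using const 1
  | succ j ih => simpa [pow_succ, mul_add] using ih.mul hf

theorem prod {ι : Type*} (s : Finset ι) {F : ι → E n → ℝ} {e : ι → ℕ}
    (h : ∀ i ∈ s, IsPoly (e i) (F i)) :
    IsPoly (∑ i ∈ s, e i) (fun x => ∏ i ∈ s, F i x) := by
  classical
  induction s using Finset.induction_on with
  | empty => simpa using const 1
  | insert a s ha ih =>
    simp only [Finset.prod_insert ha, Finset.sum_insert ha]
    exact (h a (by simp)).mul (ih fun i hi => h i (by simp [hi]))

/-- Composition with an affine map, given by its coordinates. -/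
theorem comp {n' : ℕ} (hf : IsPoly m f) {A : E n' → E n} (hA : ∀ i, IsPoly 1 (fun x => A x i)) :
    IsPoly m (fun x => f (A x)) := by
  obtain ⟨p, hp, hf⟩ := hf
  simp only [hf, MvPolynomial.eval_eq]
  refine sum _ fun s hs => IsPoly.const_mul _ ?_
  refine (prod _ (e := fun i => 1 * s i) fun i _ => (hA i).pow (s i)).mono ?_
  simp only [one_mul]
  refine le_trans (le_of_eq ?_) ((MvPolynomial.le_totalDegree hs).trans hp)
  rfl

theorem of_linear (l : E n →L[ℝ] ℝ) (c : ℝ) : IsPoly 1 (fun x => c + l x) := by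
  refine (const c).add ?_
  have : ∀ x, l x = ∑ i, l (EuclideanSpace.single i 1) * x i := by
    intro x
    conv_lhs => rw [← (EuclideanSpace.basisFun (Fin n) ℝ).sum_repr x]
    simp [mul_comm]
  rw [show (⇑l : E n → ℝ) = _ from funext this]
  exact sum _ fun i _ => (coord i).const_mul _

theorem comp_affine {n' : ℕ} (hf : IsPoly m f) (c : E n) (l : E n' →L[ℝ] E n) :
    IsPoly m (fun x => f (c + l x)) :=
  hf.comp fun i => by
    simpa using of_linear ((EuclideanSpace.proj i : E n →L[ℝ] ℝ).comp l) (c i)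

theorem contDiff (hf : IsPoly m f) : ContDiff ℝ ∞ f := by
  obtain ⟨p, -, hf⟩ := hf
  have : f = fun x => MvPolynomial.eval (fun i => x i) p := funext hf
  rw [this]
  simp only [MvPolynomial.eval_eq]
  fun_prop

theorem continuous (hf : IsPoly m f) : Continuous f := hf.contDiff.continuous

theorem gradient_apply (p : MvPolynomial (Fin n) ℝ) (hf : ∀ x, f x = MvPolynomial.eval (fun i => x i) p)
    (x : E n) (i : Fin n) :
    gradient f x i = MvPolynomial.eval (fun i => x i) (MvPolynomial.pderiv i p) := by
  have h : HasFDerivAt f _ x := (hasFDerivAt_eval p x).congr_of_eventuallyEq (.of_forall hf)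
  rw [gradient_ofLp, h.fderiv]
  simp

theorem gradient_coord (hf : IsPoly m f) (i : Fin n) : IsPoly m (fun x => gradient f x i) := by
  obtain ⟨p, hp, hf⟩ := hf
  exact ⟨_, (totalDegree_pderiv_le i p).trans hp, fun x => gradient_apply p hf x i⟩

theorem inner_gradient (hf : IsPoly m f) (v : E n) : IsPoly m (fun x => ⟪v, gradient f x⟫) := by
  simp only [PiLp.inner_apply, RCLike.inner_apply, conj_trivial, mul_comm]
  exact sum _ fun i _ => (hf.gradient_coord i).const_mul _

end IsPoly

theorem gradient_contDiff {n : ℕ} {f : E n → ℝ} (hf : ContDiff ℝ ∞ f) :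
    ContDiff ℝ ∞ (gradient f) := by
  unfold gradient
  exact (InnerProductSpace.toDual ℝ (E n)).symm.toContinuousLinearEquiv.contDiff.comp
    (hf.fderiv_right (by simp))

/-- The divergence of a vector field. -/
def div {n : ℕ} (F : E n → E n) (x : E n) : ℝ :=
  ∑ i, fderiv ℝ F x (EuclideanSpace.single i 1) i

theorem IsPoly.div_gradient {n m : ℕ} {f : E n → ℝ} (hf : IsPoly m f) :
    IsPoly m (div (gradient f)) := by
  unfold div
  refine IsPoly.sum _ fun i _ => ?_
  have hg := gradient_contDiff hf.contDiff
  have key : ∀ x, fderiv ℝ (gradient f) x (EuclideanSpace.single i 1) i =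
      gradient (fun x => gradient f x i) x i := by
    intro x
    have h1 : HasFDerivAt (fun x => gradient f x i)
        ((EuclideanSpace.proj i : E n →L[ℝ] ℝ).comp (fderiv ℝ (gradient f) x)) x :=
      (EuclideanSpace.proj i : E n →L[ℝ] ℝ).hasFDerivAt.comp x
        (hg.differentiable (by simp) x).hasFDerivAt
    rw [gradient_ofLp (fun x => gradient f x i), h1.fderiv]
    simp
  simp only [key]
  exact (hf.gradient_coord i).gradient_coord i

/-! ### Inverse estimates between concentric balls. -/

/-- A polynomial that vanishes almost everywhere on a ball is zero. -/
theorem eq_zero_of_ae_ball {n : ℕ} {ρ : ℝ} (hρ : 0 < ρ) (p : MvPolynomial (Fin n) ℝ)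
    (h : (fun x : E n => MvPolynomial.eval (fun i => x i) p)
      =ᵐ[volume.restrict (Metric.ball 0 ρ)] 0) : p = 0 := by
  have hc : Continuous fun x : E n => MvPolynomial.eval (fun i => x i) p :=
    IsPoly.continuous (m := p.totalDegree) ⟨p, le_rfl, fun _ => rfl⟩
  -- Continuity upgrades almost everywhere to everywhere on the ball. The ball contains a box, a
  -- product of infinite sets, on which a polynomial cannot vanish unless it is zero.
  have h0 := Measure.eqOn_open_of_ae_eq h Metric.isOpen_ball hc.continuousOn
    continuous_zero.continuousOn
  have hopen : IsOpen {y : Fin n → ℝ | WithLp.toLp 2 y ∈ Metric.ball (0 : E n) ρ} :=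
    Metric.isOpen_ball.preimage (PiLp.continuous_toLp 2 _)
  have hmem : (0 : Fin n → ℝ) ∈ {y : Fin n → ℝ | WithLp.toLp 2 y ∈ Metric.ball (0 : E n) ρ} := by
    simpa using hρ
  obtain ⟨ε, hε, hball⟩ := Metric.isOpen_iff.1 hopen 0 hmem
  refine MvPolynomial.funext_set (fun _ : Fin n => Set.Ioo (-ε) ε)
    (fun _ => Set.Ioo_infinite (by linarith)) fun y hy => ?_
  have hy' : y ∈ Metric.ball (0 : Fin n → ℝ) ε := by
    rw [mem_ball_zero_iff, pi_norm_lt_iff hε]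
    intro i
    rw [Real.norm_eq_abs, abs_lt]
    exact hy i (mem_univ i)
  simpa using h0 (hball hy')

theorem memLp_ball {n : ℕ} {f : E n → ℝ} (hf : Continuous f) (c : E n) (ρ : ℝ) :
    MemLp f 2 (volume.restrict (Metric.ball c ρ)) := by
  have h : MemLp f 2 (volume.restrict (Metric.closedBall c ρ)) := by
    have := (isCompact_closedBall c ρ)
    refine (memLp_two_iff_integrable_sq hf.aestronglyMeasurable).2 ?_
    exact (hf.pow 2).continuousOn.integrableOn_compact this
  exact h.mono_measure (Measure.restrict_mono Metric.ball_subset_closedBall le_rfl)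

/-- Finite dimensionality: a polynomial is determined by its class in `L²` of the small ball, so
evaluation of `D p` on the unit ball factors through a finite-dimensional subspace of `L²`. A linear
map on such a space is bounded, and `C` is the square of its norm. Identity and partial derivatives
are the operators `D` of interest. -/
theorem inverse_estimate_aux {n m : ℕ} {ρ : ℝ} (hρ : 0 < ρ)
    (D : MvPolynomial (Fin n) ℝ →ₗ[ℝ] MvPolynomial (Fin n) ℝ) :
    ∃ C : ℝ, 0 ≤ C ∧ ∀ p : MvPolynomial (Fin n) ℝ, p.totalDegree ≤ m →
      ∀ x ∈ Metric.closedBall (0 : E n) 1, (MvPolynomial.eval (fun i => x i) (D p)) ^ 2 ≤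
        C * ∫ y in Metric.ball (0 : E n) ρ, (MvPolynomial.eval (fun i => y i) p) ^ 2 := by
  let W := MvPolynomial.restrictTotalDegree (Fin n) ℝ m
  let μ : Measure (E n) := volume.restrict (Metric.ball 0 ρ)
  have hcont : ∀ p : MvPolynomial (Fin n) ℝ,
      Continuous fun x : E n => MvPolynomial.eval (fun i => x i) p := fun p =>
    IsPoly.continuous (m := p.totalDegree) ⟨p, le_rfl, fun _ => rfl⟩
  have hmem : ∀ p : MvPolynomial (Fin n) ℝ,
      MemLp (fun x : E n => MvPolynomial.eval (fun i => x i) p) 2 μ := fun p =>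
    memLp_ball (hcont p) 0 ρ
  let T : W →ₗ[ℝ] Lp ℝ 2 μ :=
    { toFun := fun p => (hmem p.1).toLp _
      map_add' := by
        intro p q
        rw [← MemLp.toLp_add]
        congr 1
        ext x
        simp
      map_smul' := by
        intro c p
        rw [RingHom.id_apply, ← MemLp.toLp_const_smul]
        congr 1
        ext x
        simp [MvPolynomial.smul_eval] }
  have hT : Function.Injective T := by
    rw [injective_iff_map_eq_zero]
    intro p hp
    have h1 : (fun x : E n => MvPolynomial.eval (fun i => x i) p.1) =ᵐ[μ] 0 := by
      have h2 := (hmem p.1).coeFn_toLp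
      have h3 : (hmem p.1).toLp _ = 0 := hp
      rw [h3] at h2
      exact h2.symm.trans (Lp.coeFn_zero ℝ 2 μ)
    exact Subtype.ext (eq_zero_of_ae_ball hρ p.1 h1)
  let Ev : W →ₗ[ℝ] C(Metric.closedBall (0 : E n) 1, ℝ) :=
    { toFun := fun p => ⟨fun x => MvPolynomial.eval (fun i => x.1 i) (D p.1),
        (hcont (D p.1)).comp continuous_subtype_val⟩
      map_add' := by
        intro p q
        ext x
        simp
      map_smul' := by
        intro c p
        ext x
        simp [MvPolynomial.smul_eval] }
  let eT := LinearEquiv.ofInjective T hT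
  have : FiniteDimensional ℝ (LinearMap.range T) := inferInstance
  let Φ := LinearMap.toContinuousLinearMap (Ev.comp eT.symm.toLinearMap)
  have : CompactSpace (Metric.closedBall (0 : E n) 1) :=
    isCompact_iff_compactSpace.1 (isCompact_closedBall 0 1)
  refine ⟨‖Φ‖ ^ 2, by positivity, fun p hp x hx => ?_⟩
  let p' : W := ⟨p, (MvPolynomial.mem_restrictTotalDegree (Fin n) m p).2 hp⟩
  have h1 : Φ (eT p') = Ev p' := by
    simp [Φ]
  have h2 : ‖Ev p' ⟨x, hx⟩‖ ≤ ‖Φ‖ * ‖eT p'‖ :=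
    ((Ev p').norm_coe_le_norm ⟨x, hx⟩).trans (h1 ▸ Φ.le_opNorm (eT p'))
  have h3 : ‖eT p'‖ ^ 2 = ∫ y in Metric.ball (0 : E n) ρ,
      (MvPolynomial.eval (fun i => y i) p) ^ 2 := by
    have h4 : ‖eT p'‖ = ‖(hmem p).toLp _‖ := rfl
    rw [h4, ← real_inner_self_eq_norm_sq, L2.inner_def]
    refine integral_congr_ae ?_
    filter_upwards [(hmem p).coeFn_toLp] with y hy
    rw [hy]
    simp [pow_two]
  rw [← h3, ← mul_pow, ← sq_abs]
  exact pow_le_pow_left₀ (abs_nonneg _) h2 2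

theorem inverse_estimate_unit (n m : ℕ) {ρ : ℝ} (hρ : 0 < ρ) :
    ∃ C : ℝ, 0 ≤ C ∧ ∀ f : E n → ℝ, IsPoly m f → ∀ x ∈ Metric.closedBall (0 : E n) 1,
      f x ^ 2 ≤ C * ∫ y in Metric.ball (0 : E n) ρ, f y ^ 2 ∧
      ‖gradient f x‖ ^ 2 ≤ C * ∫ y in Metric.ball (0 : E n) ρ, f y ^ 2 := by
  obtain ⟨C₀, hC₀, h₀⟩ := inverse_estimate_aux (n := n) (m := m) hρ LinearMap.id
  choose C₁ hC₁ h₁ using fun i : Fin n => inverse_estimate_aux (n := n) (m := m) hρ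
    (MvPolynomial.pderiv i).toLinearMap
  refine ⟨C₀ + ∑ i, C₁ i, add_nonneg hC₀ (Finset.sum_nonneg fun i _ => hC₁ i), ?_⟩
  rintro f ⟨p, hp, hf⟩ x hx
  have hI : 0 ≤ ∫ y in Metric.ball (0 : E n) ρ, (MvPolynomial.eval (fun i => y i) p) ^ 2 :=
    integral_nonneg fun y => sq_nonneg _
  have hs : 0 ≤ ∑ i, C₁ i := Finset.sum_nonneg fun i _ => hC₁ i
  have e : ∫ y in Metric.ball (0 : E n) ρ, f y ^ 2 =
      ∫ y in Metric.ball (0 : E n) ρ, (MvPolynomial.eval (fun i => y i) p) ^ 2 := by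
    simp only [hf]
  rw [e, add_mul]
  constructor
  · rw [hf]
    have := h₀ p hp x hx
    simp only [LinearMap.id_apply] at this
    nlinarith [mul_nonneg hs hI]
  · rw [EuclideanSpace.norm_sq_eq, Finset.sum_mul]
    have : ∑ i, ‖gradient f x i‖ ^ 2 ≤ ∑ i, C₁ i *
        ∫ y in Metric.ball (0 : E n) ρ, (MvPolynomial.eval (fun i => y i) p) ^ 2 := by
      refine Finset.sum_le_sum fun i _ => ?_
      rw [Real.norm_eq_abs, sq_abs, IsPoly.gradient_apply p hf]
      exact h₁ i p hp x hx
    nlinarith [mul_nonneg hC₀ hI]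

theorem gradient_comp_add_smul {n : ℕ} {f : E n → ℝ} (hf : Differentiable ℝ f) (c : E n) (R : ℝ)
    (y : E n) : gradient (fun y => f (c + R • y)) y = R • gradient f (c + R • y) := by
  have h1 : HasFDerivAt (fun y : E n => c + R • y) (R • ContinuousLinearMap.id ℝ (E n)) y :=
    ((hasFDerivAt_id y).const_smul R).const_add c
  have h2 := (hf (c + R • y)).hasFDerivAt.comp y h1
  have h3 : fderiv ℝ (fun y => f (c + R • y)) y = R • fderiv ℝ f (c + R • y) := by
    have := h2.fderiv
    rw [show (fun y => f (c + R • y)) = f ∘ fun y => c + R • y from rfl, this]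
    ext v
    simp
  rw [gradient, h3, gradient, map_smul]

theorem integral_ball_comp_add_smul {n : ℕ} (g : E n → ℝ) (c : E n) {R : ℝ} (hR : 0 < R) (θ : ℝ) :
    R ^ n * ∫ y in Metric.ball (0 : E n) θ, g (c + R • y) =
      ∫ y in Metric.ball c (R * θ), g y := by
  rw [← integral_indicator measurableSet_ball, ← integral_indicator measurableSet_ball,
    ← integral_add_left_eq_self (μ := volume) ((Metric.ball c (R * θ)).indicator g) c]
  have h1 := Measure.integral_comp_smul (volume : Measure (E n))
    (fun y => (Metric.ball c (R * θ)).indicator g (c + y)) R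
  have h2 : ∀ y : E n, (Metric.ball c (R * θ)).indicator g (c + R • y) =
      (Metric.ball (0 : E n) θ).indicator (fun y => g (c + R • y)) y := by
    intro y
    have : c + R • y ∈ Metric.ball c (R * θ) ↔ y ∈ Metric.ball (0 : E n) θ := by
      simp only [Metric.mem_ball, dist_self_add_left, norm_smul, Real.norm_eq_abs, abs_of_pos hR,
        dist_zero_right]
      exact mul_lt_mul_iff_right₀ hR
    by_cases hy : y ∈ Metric.ball (0 : E n) θ
    · rw [indicator_of_mem hy, indicator_of_mem (this.2 hy)]
    · rw [indicator_of_notMem hy, indicator_of_notMem (fun h => hy (this.1 h))]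
  simp only [h2] at h1
  rw [h1, finrank_euclideanSpace_fin, abs_of_pos (by positivity), smul_eq_mul, ← mul_assoc,
    mul_inv_cancel₀ (by positivity), one_mul]

/-- Scaled inverse estimates: the values and the gradient of a polynomial on a ball are controlled
by its `L²` norm on a smaller concentric ball. -/
theorem inverse_estimate (n m : ℕ) {θ : ℝ} (hθ : 0 < θ) :
    ∃ C : ℝ, 0 ≤ C ∧ ∀ f : E n → ℝ, IsPoly m f → ∀ (c : E n) (R : ℝ), 0 < R →
      ∀ x ∈ Metric.closedBall c R,
      R ^ n * f x ^ 2 ≤ C * ∫ y in Metric.ball c (R * θ), f y ^ 2 ∧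
      R ^ n * (R ^ 2 * ‖gradient f x‖ ^ 2) ≤ C * ∫ y in Metric.ball c (R * θ), f y ^ 2 := by
  obtain ⟨C, hC, h⟩ := inverse_estimate_unit n m hθ
  refine ⟨C, hC, fun f hf c R hR x hx => ?_⟩
  -- The pullback to the unit ball has the same degree. Its gradient carries a factor `R`, the
  -- source of `R ^ 2` in the claim, and the change of variables in the integral produces `R ^ n`.
  have hg : IsPoly m (fun y => f (c + R • y)) :=
    hf.comp_affine c (R • ContinuousLinearMap.id ℝ (E n))
  have hx' : R⁻¹ • (x - c) ∈ Metric.closedBall (0 : E n) 1 := by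
    rw [mem_closedBall_zero_iff, norm_smul, norm_inv, Real.norm_eq_abs, abs_of_pos hR,
      inv_mul_le_iff₀ hR, mul_one]
    simpa [dist_eq_norm] using hx
  have hxe : c + R • (R⁻¹ • (x - c)) = x := by
    rw [smul_inv_smul₀ hR.ne']
    abel
  obtain ⟨h1, h2⟩ := h _ hg _ hx'
  rw [gradient_comp_add_smul (hf.contDiff.differentiable (by simp)), norm_smul, mul_pow,
    Real.norm_eq_abs, sq_abs] at h2
  simp only [hxe] at h1 h2
  rw [← integral_ball_comp_add_smul (fun y => f y ^ 2) c hR θ, mul_left_comm]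
  exact ⟨mul_le_mul_of_nonneg_left h1 (by positivity), mul_le_mul_of_nonneg_left h2 (by positivity)⟩

end

section

/-! ### Smooth bumps -/

theorem exists_bump (n : ℕ) : ∃ C : ℝ, 0 ≤ C ∧ ∀ (c : E n) (s : ℝ), 0 < s →
    ∃ φ : E n → ℝ, ContDiff ℝ ∞ φ ∧ (∀ x, 0 ≤ φ x) ∧ (∀ x, φ x ≤ 1) ∧
      (∀ x ∈ Metric.closedBall c s, φ x = 1) ∧ tsupport φ ⊆ Metric.closedBall c (2 * s) ∧
      ∀ x, s * ‖gradient φ x‖ ≤ C := by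
  -- All bumps are rescalings of this one, so a single bound on its gradient serves every center and
  -- radius.
  let b : ContDiffBump (0 : E n) := ⟨1, 2, one_pos, one_lt_two⟩
  have hb : ContDiff ℝ ∞ b := b.contDiff
  obtain ⟨C, hC⟩ := (gradient_contDiff hb).continuous.bounded_above_of_compact_support (by
    unfold gradient
    exact b.hasCompactSupport.fderiv (𝕜 := ℝ) |>.comp_left (map_zero _))
  refine ⟨C, (norm_nonneg _).trans (hC 0), fun c s hs => ?_⟩
  have e : ∀ x : E n, b (s⁻¹ • (x - c)) = b ((-s⁻¹ • c) + s⁻¹ • x) := by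
    intro x
    congr 1
    module
  refine ⟨fun x => b (s⁻¹ • (x - c)), ?_, fun x => b.nonneg, fun x => b.le_one, ?_, ?_, ?_⟩
  · exact hb.comp (by fun_prop : ContDiff ℝ ∞ fun x : E n => s⁻¹ • (x - c))
  · intro x hx
    refine b.one_of_mem_closedBall ?_
    rw [mem_closedBall_zero_iff, norm_smul, norm_inv, Real.norm_eq_abs, abs_of_pos hs,
      inv_mul_le_iff₀ hs]
    simpa [dist_eq_norm, b] using hx
  · refine closure_minimal (fun x hx => ?_) Metric.isClosed_closedBall
    by_contra h
    refine hx (b.zero_of_le_dist ?_)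
    rw [dist_zero_right, norm_smul, norm_inv, Real.norm_eq_abs, abs_of_pos hs]
    rw [Metric.mem_closedBall, dist_eq_norm, not_le] at h
    rw [inv_mul_eq_div, le_div_iff₀ hs]
    exact h.le
  · intro x
    simp only [e]
    rw [gradient_comp_add_smul (hb.differentiable (by simp)), norm_smul, norm_inv,
      Real.norm_eq_abs, abs_of_pos hs, ← mul_assoc, mul_inv_cancel₀ hs.ne', one_mul]
    exact hC _

/-! ### Hyperplanes -/

variable {m : ℕ}

theorem exists_tangent {n : E (m + 1)} (hn : ‖n‖ = 1) :
    ∃ L : E m →ₗᵢ[ℝ] E (m + 1), ∀ x, ⟪n, x⟫ = 0 ↔ x ∈ range L := by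
  have : Fact (Module.finrank ℝ (E (m + 1)) = m + 1) := ⟨by simp⟩
  have hn0 : n ≠ 0 := by
    rintro rfl
    simp at hn
  let b := OrthonormalBasis.fromOrthogonalSpanSingleton (𝕜 := ℝ) m hn0
  refine ⟨(ℝ ∙ n)ᗮ.subtypeₗᵢ.comp b.repr.symm.toLinearIsometry, fun x => ?_⟩
  rw [← Submodule.mem_orthogonal_singleton_iff_inner_right]
  constructor
  · intro hx
    exact ⟨b.repr ⟨x, hx⟩, by simp⟩
  · rintro ⟨y, rfl⟩
    simp

/-- An isometric parametrization of the hyperplane orthogonal to the unit vector `n`. -/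
def tangent {n : E (m + 1)} (hn : ‖n‖ = 1) : E m →ₗᵢ[ℝ] E (m + 1) := (exists_tangent hn).choose

theorem mem_range_tangent {n : E (m + 1)} (hn : ‖n‖ = 1) (x : E (m + 1)) :
    ⟪n, x⟫ = 0 ↔ x ∈ range (tangent hn) := (exists_tangent hn).choose_spec x

theorem inner_tangent {n : E (m + 1)} (hn : ‖n‖ = 1) (y : E m) : ⟪n, tangent hn y⟫ = 0 :=
  (mem_range_tangent hn _).2 ⟨y, rfl⟩

/-- The orthogonal projection onto the hyperplane, in the coordinates of `tangent`. -/
def cotangent {n : E (m + 1)} (hn : ‖n‖ = 1) : E (m + 1) →L[ℝ] E m :=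
  ContinuousLinearMap.adjoint (tangent hn).toContinuousLinearMap

theorem cotangent_tangent {n : E (m + 1)} (hn : ‖n‖ = 1) (y : E m) :
    cotangent hn (tangent hn y) = y := by
  refine ext_inner_right ℝ fun z => ?_
  rw [cotangent, ContinuousLinearMap.adjoint_inner_left]
  exact (tangent hn).inner_map_map y z

theorem norm_cotangent_le {n : E (m + 1)} (hn : ‖n‖ = 1) (x : E (m + 1)) :
    ‖cotangent hn x‖ ≤ ‖x‖ := by
  have h1 : ‖cotangent hn‖ ≤ 1 := by
    rw [cotangent, LinearIsometryEquiv.norm_map]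
    exact (tangent hn).norm_toContinuousLinearMap_le
  exact ((cotangent hn).le_opNorm x).trans (by nlinarith [norm_nonneg x])

/-- The point with tangential coordinate `y` and height `t` over the hyperplane through `x₀`. -/
def chart {n : E (m + 1)} (hn : ‖n‖ = 1) (x₀ : E (m + 1)) (q : E m × ℝ) : E (m + 1) :=
  x₀ + (tangent hn q.1 + q.2 • n)

/-- With the Euclidean norm on the product, `(y, t) ↦ tangent y + t n` is a linear isometry between
spaces of equal dimension. Such a map preserves Lebesgue measure, and so does the translation by
`x₀`. -/
theorem chart_measurePreserving {n : E (m + 1)} (hn : ‖n‖ = 1) (x₀ : E (m + 1)) :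
    MeasurePreserving (chart hn x₀) (volume.prod volume) volume := by
  let l : WithLp 2 (E m × ℝ) →ₗᵢ[ℝ] E (m + 1) :=
    { toLinearMap := ((tangent hn).toLinearMap.coprod (LinearMap.toSpanSingleton ℝ _ n)).comp
        (WithLp.linearEquiv 2 ℝ (E m × ℝ)).toLinearMap
      norm_map' := by
        intro q
        have h := WithLp.prod_norm_sq_eq_of_L2 q
        rw [← sq_eq_sq₀ (norm_nonneg _) (norm_nonneg _), h]
        have h2 := inner_tangent hn q.fst
        simp only [LinearMap.coe_comp, Function.comp_apply]
        change ‖tangent hn q.fst + q.snd • n‖ ^ 2 = _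
        rw [norm_add_sq_real, inner_smul_right, real_inner_comm, h2, norm_smul, hn,
          LinearIsometry.norm_map]
        simp }
  let le := l.toLinearIsometryEquiv (by simp [(WithLp.linearEquiv 2 ℝ (E m × ℝ)).finrank_eq])
  have h1 := (le.measurePreserving).comp (WithLp.volume_preserving_toLp (E m) ℝ)
  exact (measurePreserving_add_left volume x₀).comp h1

/-- The isometric parametrization of the hyperplane through `x₀` orthogonal to `n`. -/
def planeChart {n : E (m + 1)} (hn : ‖n‖ = 1) (x₀ : E (m + 1)) (y : E m) : E (m + 1) :=
  x₀ + tangent hn y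

theorem planeChart_isometry {n : E (m + 1)} (hn : ‖n‖ = 1) (x₀ : E (m + 1)) :
    Isometry (planeChart hn x₀) :=
  (IsometryEquiv.addLeft x₀).isometry.comp (tangent hn).isometry

theorem mem_range_planeChart {n : E (m + 1)} (hn : ‖n‖ = 1) (x₀ x : E (m + 1)) :
    x ∈ range (planeChart hn x₀) ↔ ⟪n, x - x₀⟫ = 0 := by
  rw [mem_range_tangent hn]
  constructor
  · rintro ⟨y, rfl⟩
    exact ⟨y, by simp [planeChart]⟩
  · rintro ⟨y, hy⟩
    exact ⟨y, by simp [planeChart, hy]⟩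

/-- Isometries transport the normalized Hausdorff measure, which on `E m` is Lebesgue measure. All
surface integrals over facets are computed through this identity. -/
theorem surf_restrict_range {n : E (m + 1)} (hn : ‖n‖ = 1) (x₀ : E (m + 1)) :
    (surf (m + 1)).restrict (range (planeChart hn x₀)) = volume.map (planeChart hn x₀) := by
  have h := (planeChart_isometry hn x₀).map_euclideanHausdorffMeasure (d := m)
  rw [EuclideanSpace.euclideanHausdorffMeasure_eq_volume] at h
  exact h.symm

theorem planeChart_measurableEmbedding {n : E (m + 1)} (hn : ‖n‖ = 1) (x₀ : E (m + 1)) :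
    MeasurableEmbedding (planeChart hn x₀) :=
  (planeChart_isometry hn x₀).isClosedEmbedding.measurableEmbedding

/-- No measurability of `S` is needed, because the hyperplane containing it is measurable. -/
theorem surf_restrict_eq_map {n : E (m + 1)} (hn : ‖n‖ = 1) (x₀ : E (m + 1)) {S : Set (E (m + 1))}
    (hS : S ⊆ range (planeChart hn x₀)) :
    (surf (m + 1)).restrict S =
      (volume.restrict (planeChart hn x₀ ⁻¹' S)).map (planeChart hn x₀) := by
  have hr : MeasurableSet (range (planeChart hn x₀)) :=
    (planeChart_measurableEmbedding hn x₀).measurableSet_range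
  rw [← (planeChart_measurableEmbedding hn x₀).restrict_map, ← surf_restrict_range,
    Measure.restrict_restrict' hr, inter_eq_left.2 hS]

theorem setIntegral_surf {n : E (m + 1)} (hn : ‖n‖ = 1) (x₀ : E (m + 1)) {S : Set (E (m + 1))}
    (hS : S ⊆ range (planeChart hn x₀)) (g : E (m + 1) → ℝ) :
    ∫ x in S, g x ∂(surf (m + 1)) =
      ∫ y in planeChart hn x₀ ⁻¹' S, g (planeChart hn x₀ y) := by
  rw [surf_restrict_eq_map hn x₀ hS, (planeChart_measurableEmbedding hn x₀).integral_map]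

theorem surf_eq_volume {n : E (m + 1)} (hn : ‖n‖ = 1) (x₀ : E (m + 1)) {S : Set (E (m + 1))}
    (hS : S ⊆ range (planeChart hn x₀)) :
    surf (m + 1) S = volume (planeChart hn x₀ ⁻¹' S) := by
  have h := congrArg (fun μ => μ univ) (surf_restrict_eq_map hn x₀ hS)
  simpa [(planeChart_measurableEmbedding hn x₀).map_apply] using h

/-! ### The divergence theorem for compactly supported fields on a half-space -/

theorem integrable_fderiv_apply {n : ℕ} {G : E n → ℝ} (hG : ContDiff ℝ 1 G)
    (hc : HasCompactSupport G) (v : E n) : Integrable (fun x => fderiv ℝ G x v) :=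
  ((hG.continuous_fderiv (by simp)).clm_apply continuous_const).integrable_of_hasCompactSupport
    (hc.fderiv_apply (𝕜 := ℝ) v)

theorem integral_fderiv_eq_zero {n : ℕ} {G : E n → ℝ} (hG : ContDiff ℝ 1 G)
    (hc : HasCompactSupport G) (v : E n) : ∫ x, fderiv ℝ G x v = 0 := by
  have h := integral_mul_fderiv_eq_neg_fderiv_mul_of_integrable (μ := (volume : Measure (E n)))
    (f := fun _ => (1 : ℝ)) (g := G) (v := v) (by simp)
    (by simpa using integrable_fderiv_apply hG hc v)
    (by simpa using hG.continuous.integrable_of_hasCompactSupport hc) (by fun_prop)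
    (fun x _ => hG.differentiable (by simp) x)
  simpa using h

/-- The half-space behind the hyperplane through `x₀` orthogonal to `n`. -/
def halfSpace {d : ℕ} (n x₀ : E d) : Set (E d) := {x | ⟪n, x - x₀⟫ < 0}

theorem isOpen_halfSpace {d : ℕ} (n x₀ : E d) : IsOpen (halfSpace n x₀) :=
  isOpen_lt (by fun_prop) continuous_const

/-- The indicator of the half-space is constant along tangential lines, so its line derivative in
the direction `v` is zero. Integration by parts moves the derivative from `G` onto that indicator.
-/
theorem integral_halfSpace_tangential {d : ℕ} {n x₀ v : E d} (hv : ⟪n, v⟫ = 0) {G : E d → ℝ}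
    (hG : ContDiff ℝ 1 G) (hc : HasCompactSupport G) :
    ∫ x in halfSpace n x₀, fderiv ℝ G x v = 0 := by
  classical
  have hm := (isOpen_halfSpace n x₀).measurableSet
  rw [← integral_indicator hm]
  have hd := integrable_fderiv_apply hG hc v
  have hi := hG.continuous.integrable_of_hasCompactSupport hc (μ := volume)
  have e : ∀ g : E d → ℝ, (halfSpace n x₀).indicator g =
      fun x => ContinuousLinearMap.mul ℝ ℝ ((halfSpace n x₀).indicator (fun _ => (1 : ℝ)) x)
        (g x) := by
    intro g
    ext x
    by_cases hx : x ∈ halfSpace n x₀ <;> simp [hx]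
  have h := integral_bilinear_hasLineDerivAt_right_eq_neg_left_of_integrable
    (μ := (volume : Measure (E d))) (B := ContinuousLinearMap.mul ℝ ℝ) (v := v)
    (f := (halfSpace n x₀).indicator fun _ => (1 : ℝ)) (f' := fun _ => 0) (g := G)
    (g' := fun x => fderiv ℝ G x v) (by simp)
    (by rw [← e]; exact hd.indicator hm)
    (by rw [← e]; exact hi.indicator hm)
    (fun x _ => by
      have : (fun t : ℝ => (halfSpace n x₀).indicator (fun _ => (1 : ℝ)) (x + t • v)) =
          fun _ => (halfSpace n x₀).indicator (fun _ => (1 : ℝ)) x := by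
        ext t
        have h1 : x + t • v ∈ halfSpace n x₀ ↔ x ∈ halfSpace n x₀ := by
          simp only [halfSpace, mem_ofPred_eq]
          rw [show x + t • v - x₀ = (x - x₀) + t • v by abel, inner_add_right, inner_smul_right,
            hv, mul_zero, add_zero]
        by_cases hx : x ∈ halfSpace n x₀
        · simp [hx, h1.2 hx]
        · simp [hx, mt h1.1 hx]
      rw [HasLineDerivAt, this]
      exact hasDerivAt_const _ _)
    (fun x _ => (hG.differentiable (by simp) x).hasFDerivAt.hasLineDerivAt v)
  rw [e, h]
  simp

/-- Fubini in the coordinates of `chart`, then the fundamental theorem of calculus along each normal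
half-line: compact support leaves only the value at height zero. -/
theorem integral_halfSpace_normal {n : E (m + 1)} (hn : ‖n‖ = 1) (x₀ : E (m + 1))
    {G : E (m + 1) → ℝ} (hG : ContDiff ℝ 1 G) (hc : HasCompactSupport G) :
    ∫ x in halfSpace n x₀, fderiv ℝ G x n = ∫ y, G (planeChart hn x₀ y) := by
  have hm := (isOpen_halfSpace n x₀).measurableSet
  have hmp := chart_measurePreserving hn x₀
  have hmem : ∀ q : E m × ℝ, chart hn x₀ q ∈ halfSpace n x₀ ↔ q.2 < 0 := by
    intro q
    simp only [halfSpace, mem_ofPred_eq, chart, add_sub_cancel_left, inner_add_right,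
      inner_tangent, inner_smul_right, real_inner_self_eq_norm_sq, hn]
    simp
  have hint : Integrable ((halfSpace n x₀).indicator fun x => fderiv ℝ G x n) :=
    (integrable_fderiv_apply hG hc n).indicator hm
  have hint' := hmp.integrable_comp_of_integrable hint
  rw [← integral_indicator hm, ← hmp.map_eq, integral_map hmp.aemeasurable
    (by rw [hmp.map_eq]; exact hint.aestronglyMeasurable)]
  refine (integral_prod _ hint').trans ?_
  simp only [Function.comp_apply]
  congr 1
  ext y
  have h1 : ∀ t : ℝ, (halfSpace n x₀).indicator (fun x => fderiv ℝ G x n) (chart hn x₀ (y, t)) =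
      (Iio (0 : ℝ)).indicator (deriv fun t => G (chart hn x₀ (y, t))) t := by
    intro t
    have h2 : HasDerivAt (fun t => G (chart hn x₀ (y, t))) (fderiv ℝ G (chart hn x₀ (y, t)) n) t := by
      have h3 : HasDerivAt (fun t : ℝ => chart hn x₀ (y, t)) n t := by
        have := (((hasDerivAt_id t).smul_const n).const_add (tangent hn y)).const_add x₀
        simpa [chart] using this
      exact (hG.differentiable (by simp) _).hasFDerivAt.comp_hasDerivAt t h3
    by_cases ht : t < 0
    · rw [indicator_of_mem ((hmem (y, t)).2 ht), indicator_of_mem (by exact ht), h2.deriv]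
    · rw [indicator_of_notMem (mt (hmem (y, t)).1 ht), indicator_of_notMem (by exact ht)]
  have hcd : ContDiff ℝ 1 fun t : ℝ => G (chart hn x₀ (y, t)) := by
    refine hG.comp ?_
    unfold chart
    fun_prop
  have hcs : HasCompactSupport fun t : ℝ => G (chart hn x₀ (y, t)) := by
    refine hc.comp_isClosedEmbedding (Isometry.isClosedEmbedding ?_)
    refine Isometry.of_dist_eq fun s t => ?_
    simp only [chart, dist_add_left]
    rw [dist_eq_norm, ← sub_smul, norm_smul, hn, mul_one, Real.dist_eq, Real.norm_eq_abs]
  simp only [h1]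
  rw [integral_indicator measurableSet_Iio, ← integral_Iic_eq_integral_Iio,
    hcs.integral_Iic_deriv_eq hcd]
  simp [chart, planeChart]

theorem integral_halfSpace_fderiv {n : E (m + 1)} (hn : ‖n‖ = 1) (x₀ v : E (m + 1))
    {G : E (m + 1) → ℝ} (hG : ContDiff ℝ 1 G) (hc : HasCompactSupport G) :
    ∫ x in halfSpace n x₀, fderiv ℝ G x v = ⟪n, v⟫ * ∫ y, G (planeChart hn x₀ y) := by
  have h0 : ⟪n, v - ⟪n, v⟫ • n⟫ = 0 := by
    rw [inner_sub_right, inner_smul_right, real_inner_self_eq_norm_sq, hn]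
    simp
  have h1 : ∀ x, fderiv ℝ G x v = fderiv ℝ G x (v - ⟪n, v⟫ • n) + ⟪n, v⟫ * fderiv ℝ G x n := by
    intro x
    rw [map_sub, map_smul, smul_eq_mul]
    ring
  simp only [h1]
  rw [integral_add (integrable_fderiv_apply hG hc _).integrableOn
    ((integrable_fderiv_apply hG hc _).integrableOn.const_mul _),
    integral_halfSpace_tangential h0 hG hc, integral_const_mul,
    integral_halfSpace_normal hn x₀ hG hc, zero_add]

theorem hasCompactSupport_coord {n : ℕ} {F : E n → E n} (hc : HasCompactSupport F) (i : Fin n) :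
    HasCompactSupport fun x => F x i :=
  hc.comp_left (g := fun v : E n => v i) rfl

theorem contDiff_coord {n : ℕ} {F : E n → E n} (hF : ContDiff ℝ 1 F) (i : Fin n) :
    ContDiff ℝ 1 fun x => F x i :=
  (EuclideanSpace.proj i : E n →L[ℝ] ℝ).contDiff.comp hF

theorem div_eq {n : ℕ} {F : E n → E n} (hF : ContDiff ℝ 1 F) (x : E n) :
    div F x = ∑ i, fderiv ℝ (fun x => F x i) x (EuclideanSpace.single i 1) := by
  refine Finset.sum_congr rfl fun i _ => ?_
  have h1 : HasFDerivAt (fun x => F x i)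
      ((EuclideanSpace.proj i : E n →L[ℝ] ℝ).comp (fderiv ℝ F x)) x :=
    (EuclideanSpace.proj i : E n →L[ℝ] ℝ).hasFDerivAt.comp x
      (hF.differentiable (by simp) x).hasFDerivAt
  rw [h1.fderiv]
  simp

theorem integral_div_eq_zero {n : ℕ} {F : E n → E n} (hF : ContDiff ℝ 1 F)
    (hc : HasCompactSupport F) : ∫ x, div F x = 0 := by
  simp only [div_eq hF]
  rw [integral_finsetSum _ fun i _ => integrable_fderiv_apply (contDiff_coord hF i)
    (hasCompactSupport_coord hc i) _]
  exact Finset.sum_eq_zero fun i _ =>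
    integral_fderiv_eq_zero (contDiff_coord hF i) (hasCompactSupport_coord hc i) _

/-- The half-space lies on the negative side of its bounding plane, hence `n` is the outward normal
and enters with a positive sign. -/
theorem integral_halfSpace_div {n : E (m + 1)} (hn : ‖n‖ = 1) (x₀ : E (m + 1))
    {F : E (m + 1) → E (m + 1)} (hF : ContDiff ℝ 1 F) (hc : HasCompactSupport F) :
    ∫ x in halfSpace n x₀, div F x = ∫ y, ⟪n, F (planeChart hn x₀ y)⟫ := by
  simp only [div_eq hF]
  rw [integral_finsetSum _ fun i _ => (integrable_fderiv_apply (contDiff_coord hF i)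
    (hasCompactSupport_coord hc i) _).integrableOn]
  simp only [integral_halfSpace_fderiv hn x₀ _ (contDiff_coord hF _) (hasCompactSupport_coord hc _)]
  simp only [← integral_const_mul]
  rw [← integral_finsetSum]
  · congr 1
    ext y
    simp [PiLp.inner_apply, mul_comm]
  · intro i _
    refine Integrable.const_mul ?_ _
    exact ((contDiff_coord hF i).continuous.comp
      (planeChart_isometry hn x₀).continuous).integrable_of_hasCompactSupport
      ((hasCompactSupport_coord hc i).comp_isClosedEmbedding
        (planeChart_isometry hn x₀).isClosedEmbedding)

end

section

/-! ### Geometry of a simplex -/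

variable {d : ℕ}

theorem isCompact_body (s : Finset (E d)) : IsCompact (body s) :=
  s.finite_toSet.isCompact_convexHull ℝ

theorem isClosed_body (s : Finset (E d)) : IsClosed (body s) := (isCompact_body s).isClosed

theorem convex_body (s : Finset (E d)) : Convex ℝ (body s) := convex_convexHull ℝ _

theorem subset_body (s : Finset (E d)) : (s : Set (E d)) ⊆ body s := subset_convexHull ℝ _

theorem body_mono {s t : Finset (E d)} (h : s ⊆ t) : body s ⊆ body t :=
  convexHull_mono (by exact_mod_cast h)

theorem barycenter_mem_body {s : Finset (E d)} (hs : s.Nonempty) : barycenter s ∈ body s :=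
  s.centroid_mem_convexHull hs

theorem map_barycenter {s : Finset (E d)} (hs : s.Nonempty) (f : E d →ᵃ[ℝ] ℝ) :
    f (barycenter s) = (s.card : ℝ)⁻¹ * ∑ v ∈ s, f v := by
  have h := Finset.sum_centroidWeights_eq_one_of_nonempty ℝ s hs
  rw [barycenter, Finset.centroid_def, Finset.map_affineCombination _ _ _ h,
    Finset.affineCombination_eq_linear_combination _ _ _ h, Finset.mul_sum]
  simp

/-- The vertex set of a `d`-dimensional simplex in `ℝᵈ`. -/
structure IsSimplex (K : Finset (E d)) : Prop where
  indep : AffineIndependent ℝ ((↑) : K → E d)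
  card : K.card = d + 1

/-- Barycentric coordinates. -/
theorem IsSimplex.exists_bary {K : Finset (E d)} (hK : IsSimplex K) :
    ∃ lam : E d → E d →ᵃ[ℝ] ℝ, (∀ v ∈ K, lam v v = 1) ∧ (∀ v ∈ K, ∀ w ∈ K, v ≠ w → lam v w = 0) ∧
      body K = {x | ∀ v ∈ K, 0 ≤ lam v x} ∧ interior (body K) = {x | ∀ v ∈ K, 0 < lam v x} ∧
      (∀ x, ∑ v ∈ K, lam v x = 1) ∧ ∀ x, ∑ v ∈ K, lam v x • v = x := by
  classical
  have htop : affineSpan ℝ (range ((↑) : K → E d)) = ⊤ := by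
    rw [hK.indep.affineSpan_eq_top_iff_card_eq_finrank_add_one]
    simp [hK.card]
  let b : AffineBasis K ℝ (E d) := ⟨(↑), hK.indep, htop⟩
  have hr : range b = (K : Set (E d)) := by
    change range ((↑) : K → E d) = _
    simp
  have hcoe : ∀ v : K, b v = v := fun v => rfl
  refine ⟨fun v => if h : v ∈ K then b.coord ⟨v, h⟩ else AffineMap.const ℝ _ 0, ?_, ?_, ?_, ?_,
    ?_, ?_⟩
  · intro v hv
    simp only [dif_pos hv]
    exact b.coord_apply_eq ⟨v, hv⟩
  · intro v hv w hw hvw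
    simp only [dif_pos hv]
    exact b.coord_apply_ne (i := ⟨v, hv⟩) (j := ⟨w, hw⟩) (by simpa using hvw)
  · rw [body, ← hr, b.convexHull_eq_nonneg_coord]
    ext x
    constructor
    · intro h v hv
      simp only [dif_pos hv]
      exact h ⟨v, hv⟩
    · intro h v
      simpa using h v v.2
  · rw [body, ← hr, b.interior_convexHull]
    ext x
    constructor
    · intro h v hv
      simp only [dif_pos hv]
      exact h ⟨v, hv⟩
    · intro h v
      simpa using h v v.2
  · intro x
    rw [← b.sum_coord_apply_eq_one x, ← Finset.sum_coe_sort]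
    simp
  · intro x
    conv_rhs => rw [← b.linear_combination_coord_eq_self x]
    rw [← Finset.sum_coe_sort]
    simp [hcoe]

theorem IsSimplex.nonempty {K : Finset (E d)} (hK : IsSimplex K) : K.Nonempty := by
  rw [← Finset.card_pos, hK.card]
  omega

theorem IsSimplex.barycenter_mem_interior {K : Finset (E d)} (hK : IsSimplex K) :
    barycenter K ∈ interior (body K) := by
  classical
  obtain ⟨lam, h1, h0, -, hint, -, -⟩ := hK.exists_bary
  rw [hint]
  intro v hv
  rw [map_barycenter hK.nonempty, Finset.sum_eq_single v (fun w hw hwv => h0 v hv w hw hwv.symm)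
    (fun h => absurd hv h), h1 v hv, hK.card]
  positivity

theorem IsSimplex.interior_nonempty {K : Finset (E d)} (hK : IsSimplex K) :
    (interior (body K)).Nonempty := ⟨_, hK.barycenter_mem_interior⟩

theorem IsSimplex.diam_pos {K : Finset (E d)} (hK : IsSimplex K) (hd : 0 < d) : 0 < diam K := by
  have : 1 < K.card := by rw [hK.card]; omega
  obtain ⟨v, hv, w, hw, hvw⟩ := Finset.one_lt_card.1 this
  exact (dist_pos.2 hvw).trans_le (Metric.dist_le_diam_of_mem (isCompact_body K).isBounded
    (subset_body K hv) (subset_body K hw))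

/-! ### The shape of a simplex near the barycenter of a facet. -/

/-- An affine function confined to `[0, 1]` on a ball changes by at most `1` over the distance `r`
from the center, so its slope is at most `1 / r`. Applied to barycentric coordinates, this is how an
inscribed ball quantifies the shape of the simplex. -/
theorem abs_linear_le_of_ball {f : E d →ᵃ[ℝ] ℝ} {x : E d} {r : ℝ} (hr : 0 < r)
    (h : ∀ y ∈ Metric.closedBall x r, 0 ≤ f y ∧ f y ≤ 1) (u : E d) :
    |f.linear u| ≤ ‖u‖ / r := by
  rcases eq_or_ne u 0 with rfl | hu
  · simp
  have hu' : 0 < ‖u‖ := norm_pos_iff.2 hu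
  have h1 := h x (Metric.mem_closedBall_self hr.le)
  have h2 := h ((r / ‖u‖) • u + x) (by
    rw [Metric.mem_closedBall, dist_eq_norm, add_sub_cancel_right, norm_smul, Real.norm_eq_abs,
      abs_of_pos (by positivity), div_mul_cancel₀ _ hu'.ne'])
  have h3 : f ((r / ‖u‖) • u + x) = (r / ‖u‖) * f.linear u + f x := by
    have := f.map_vadd x ((r / ‖u‖) • u)
    simpa using this
  rw [h3] at h2
  have h4 : |(r / ‖u‖) * f.linear u| ≤ 1 := abs_le.2 ⟨by linarith, by linarith⟩
  rw [abs_mul, abs_of_pos (by positivity : 0 < r / ‖u‖), div_mul_eq_mul_div, div_le_one hu'] at h4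
  rw [le_div_iff₀ hr]
  linarith

/-- The position of the simplex `K` relative to its facet `e`: near the barycenter of `e`, at
distances less than `δ`, `K` coincides with a half-space. -/
structure IsFacetAt (K e : Finset (E d)) (δ : ℝ) : Prop where
  norm_normal : ‖outwardNormal K e‖ = 1
  inner_facet : ∀ y ∈ body e, ⟪outwardNormal K e, y - barycenter e⟫ = 0
  inner_cell : ∀ y ∈ body K, ⟪outwardNormal K e, y - barycenter e⟫ ≤ 0
  mem_facet : ∀ y ∈ Metric.ball (barycenter e) δ, ⟪outwardNormal K e, y - barycenter e⟫ = 0 →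
    y ∈ body e ∧ ∀ s ⊆ e, y ∈ body s → s = e
  mem_interior : ∀ y ∈ Metric.ball (barycenter e) δ,
    ⟪outwardNormal K e, y - barycenter e⟫ < 0 → y ∈ interior (body K)
  normal_unique : ∀ w : E d, ‖w‖ = 1 → (∀ y ∈ body e, ⟪w, y - barycenter e⟫ = 0) →
    w = outwardNormal K e ∨ w = -outwardNormal K e

theorem IsFacetAt.mono {K e : Finset (E d)} {δ δ' : ℝ} (h : IsFacetAt K e δ) (hδ : δ' ≤ δ) :
    IsFacetAt K e δ' where
  norm_normal := h.norm_normal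
  inner_facet := h.inner_facet
  inner_cell := h.inner_cell
  mem_facet y hy := h.mem_facet y (Metric.ball_subset_ball hδ hy)
  mem_interior y hy := h.mem_interior y (Metric.ball_subset_ball hδ hy)
  normal_unique := h.normal_unique

theorem mem_orthogonal_vectorSpan {e : Finset (E d)} {w : E d}
    (h : ∀ y ∈ body e, ⟪w, y - barycenter e⟫ = 0) : w ∈ (vectorSpan ℝ (e : Set (E d)))ᗮ := by
  rw [Submodule.mem_orthogonal', vectorSpan_def]
  intro u hu
  induction hu using Submodule.span_induction with
  | mem u hu =>
    obtain ⟨a, ha, b, hb, rfl⟩ := hu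
    have h1 := h a (subset_body e ha)
    have h2 := h b (subset_body e hb)
    change ⟪w, a - b⟫ = 0
    rw [show a - b = (a - barycenter e) - (b - barycenter e) by abel, inner_sub_right,
      h1, h2, sub_zero]
  | zero => simp
  | add u v _ _ hu hv => rw [inner_add_right, hu, hv, add_zero]
  | smul c u _ hu => rw [inner_smul_right, hu, mul_zero]

/-- At the barycenter of `e` the coordinates of the `d` vertices of `e` equal `1 / d`, and their
slopes are at most `1 / r`. They therefore stay positive at distances less than `r / d`, where
membership in `K` is decided by the remaining coordinate alone. That coordinate vanishes on `e`, so
it is a negative multiple of the signed distance in the direction of the outward normal. -/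
theorem IsSimplex.isFacetAt {K e : Finset (E d)} (hK : IsSimplex K) (hd : 0 < d) (he : e ⊆ K)
    (hcard : e.card = d) {x : E d} {r : ℝ} (hr : 0 < r) (hball : Metric.closedBall x r ⊆ body K) :
    IsFacetAt K e (r / d) := by
  classical
  obtain ⟨lam, h1, h0, hbody, hint, hsum, hcomb⟩ := hK.exists_bary
  have hene : e.Nonempty := by rw [← Finset.card_pos, hcard]; exact hd
  obtain ⟨v₀, hv₀⟩ : ∃ v₀, K \ e = {v₀} := by
    rw [← Finset.card_eq_one, Finset.card_sdiff_of_subset he, hK.card, hcard]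
    omega
  have hv₀K : v₀ ∈ K ∧ v₀ ∉ e := by
    have : v₀ ∈ K \ e := by simp [hv₀]
    simpa using this
  have hKe : ∀ v ∈ K, v ≠ v₀ → v ∈ e := by
    intro v hv hne
    by_contra hve
    have : v ∈ K \ e := by simp [hv, hve]
    rw [hv₀] at this
    exact hne (by simpa using this)
  have hsplit : ∀ F : E d → E d, ∑ v ∈ K, F v = F v₀ + ∑ v ∈ e, F v := by
    intro F
    rw [← Finset.sum_sdiff he, hv₀, Finset.sum_singleton]
  have hsplit' : ∀ F : E d → ℝ, ∑ v ∈ K, F v = F v₀ + ∑ v ∈ e, F v := by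
    intro F
    rw [← Finset.sum_sdiff he, hv₀, Finset.sum_singleton]
  set V := vectorSpan ℝ (e : Set (E d)) with hV
  set xe := barycenter e with hxe
  set n := outwardNormal K e with hn
  -- the gradients of the barycentric coordinates are bounded
  have hlip : ∀ v ∈ K, ∀ u, |(lam v).linear u| ≤ ‖u‖ / r := by
    intro v hv
    refine abs_linear_le_of_ball (x := x) hr fun y hy => ?_
    have hy' := hball hy
    rw [hbody] at hy'
    refine ⟨hy' v hv, ?_⟩
    rw [← hsum y]
    exact Finset.single_le_sum (f := fun v => lam v y) (fun w hw => hy' w hw) hv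
  have hlin : ∀ v, ∀ y, lam v y = (lam v).linear (y - xe) + lam v xe := by
    intro v y
    have := (lam v).map_vadd xe (y - xe)
    simpa using this
  have hxe0 : lam v₀ xe = 0 := by
    rw [hxe, map_barycenter hene]
    rw [Finset.sum_eq_zero fun w hw => h0 v₀ hv₀K.1 w (he hw) (by
      rintro rfl
      exact hv₀K.2 hw)]
    simp
  have hxe1 : ∀ v ∈ e, lam v xe = (d : ℝ)⁻¹ := by
    intro v hv
    rw [hxe, map_barycenter hene, Finset.sum_eq_single v
      (fun w hw hwv => h0 v (he hv) w (he hw) hwv.symm) (fun h => absurd hv h), h1 v (he hv), hcard,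
      mul_one]
  have hd' : (0 : ℝ) < d := by exact_mod_cast hd
  have hpos : ∀ y ∈ Metric.ball xe (r / d), ∀ v ∈ e, 0 < lam v y := by
    intro y hy v hv
    have h2 := hlip v (he hv) (y - xe)
    have h3 : ‖y - xe‖ < r / d := by simpa [dist_eq_norm] using hy
    have h4 : ‖y - xe‖ / r < (d : ℝ)⁻¹ := by
      rw [div_lt_iff₀ hr, inv_mul_eq_div]
      exact h3
    rw [hlin v y, hxe1 v hv]
    have := (abs_le.1 h2).1
    linarith
  -- the linear part of the coordinate of the opposite vertex
  have hV0 : ∀ u ∈ V, (lam v₀).linear u = 0 := by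
    intro u hu
    rw [hV, vectorSpan_def] at hu
    induction hu using Submodule.span_induction with
    | mem u hu =>
      obtain ⟨a, ha, b, hb, rfl⟩ := hu
      have hz : ∀ a ∈ e, lam v₀ a = 0 := fun a ha => h0 v₀ hv₀K.1 a (he ha) (by
        rintro rfl
        exact hv₀K.2 ha)
      have := (lam v₀).linearMap_vsub a b
      rw [hz a ha, hz b hb] at this
      simpa using this
    | zero => simp
    | add u v _ _ hu hv => rw [map_add, hu, hv, add_zero]
    | smul c u _ hu => rw [map_smul, hu, smul_zero]
  set w := Vᗮ.starProjection (xe - barycenter K) with hw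
  have hnw : n = ‖w‖⁻¹ • w := rfl
  have hproj : ∀ u, (lam v₀).linear (Vᗮ.starProjection u) = (lam v₀).linear u := by
    intro u
    conv_rhs => rw [← Submodule.starProjection_add_starProjection_orthogonal (K := V) u]
    rw [map_add, hV0 _ (Submodule.starProjection_apply_mem V u), zero_add]
  have hKint := hK.barycenter_mem_interior
  rw [hint] at hKint
  have hlw : (lam v₀).linear w < 0 := by
    rw [hw, hproj]
    have h2 := hlin v₀ (barycenter K)
    rw [hxe0, add_zero] at h2
    rw [← neg_sub, map_neg, ← h2, neg_lt_zero]
    exact hKint v₀ hv₀K.1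
  have hw0 : w ≠ 0 := by
    intro h
    rw [h, map_zero] at hlw
    exact lt_irrefl _ hlw
  have hwpos : 0 < ‖w‖ := norm_pos_iff.2 hw0
  have hn1 : ‖n‖ = 1 := by
    rw [hnw, norm_smul, norm_inv, norm_norm, inv_mul_cancel₀ hwpos.ne']
  have hn0 : n ≠ 0 := by
    rw [← norm_pos_iff, hn1]
    exact one_pos
  have hln : (lam v₀).linear n < 0 := by
    rw [hnw, map_smul, smul_eq_mul]
    exact mul_neg_of_pos_of_neg (by positivity) hlw
  have hnV : n ∈ Vᗮ := by
    rw [hnw]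
    exact Submodule.smul_mem _ _ (Submodule.starProjection_apply_mem _ _)
  have hrank : Module.finrank ℝ Vᗮ = 1 := by
    have hei : AffineIndependent ℝ ((↑) : e → E d) := by
      have := hK.indep.mono (s := (e : Set (E d))) (t := (K : Set (E d))) (by exact_mod_cast he)
      exact this
    have h2 : Module.finrank ℝ (vectorSpan ℝ (range ((↑) : e → E d))) = d - 1 :=
      hei.finrank_vectorSpan (by simp only [Fintype.card_coe]; omega)
    have h3 : range ((↑) : e → E d) = (e : Set (E d)) := by simp
    rw [h3] at h2
    have h4 := V.finrank_add_finrank_orthogonal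
    rw [finrank_euclideanSpace_fin] at h4
    have h5 : Module.finrank ℝ V = d - 1 := h2
    omega
  have hspan : ∀ u ∈ Vᗮ, ∃ c : ℝ, c • n = u := by
    intro u hu
    have h2 := (finrank_eq_one_iff_of_nonzero' (⟨n, hnV⟩ : Vᗮ) (by simpa using hn0)).1 hrank ⟨u, hu⟩
    obtain ⟨c, hc⟩ := h2
    exact ⟨c, by simpa using congrArg Subtype.val hc⟩
  -- The orthogonal complement of the direction of `e` is the line spanned by `n`, and the linear
  -- part of `lam v₀` ignores everything else. Only the normal component of `y - xe` survives.
  have hprop : ∀ y, lam v₀ y = ⟪n, y - xe⟫ * (lam v₀).linear n := by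
    intro y
    rw [hlin v₀ y, hxe0, add_zero, ← hproj]
    obtain ⟨c, hc⟩ := hspan _ (Submodule.starProjection_apply_mem Vᗮ (y - xe))
    have h2 : ⟪n, y - xe⟫ = c := by
      conv_lhs => rw [← Submodule.starProjection_add_starProjection_orthogonal (K := V) (y - xe)]
      rw [← hc, inner_add_right, inner_smul_right, real_inner_self_eq_norm_sq, hn1,
        Submodule.inner_left_of_mem_orthogonal (Submodule.starProjection_apply_mem V _) hnV]
      ring
    rw [h2, ← hc, map_smul, smul_eq_mul]
  have hfacet : ∀ y ∈ body e, ⟪n, y - xe⟫ = 0 := by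
    intro y hy
    have h2 : lam v₀ y = 0 := by
      have h3 : body e ⊆ lam v₀ ⁻¹' {0} := by
        refine convexHull_min (fun a ha => ?_) ((convex_singleton 0).affine_preimage (lam v₀))
        exact h0 v₀ hv₀K.1 a (he ha) (by
          rintro rfl
          exact hv₀K.2 ha)
      exact h3 hy
    rw [hprop] at h2
    exact (mul_eq_zero.1 h2).resolve_right hln.ne
  refine ⟨hn1, hfacet, ?_, ?_, ?_, ?_⟩
  · intro y hy
    rw [hbody] at hy
    have h2 := hy v₀ hv₀K.1
    rw [hprop] at h2
    by_contra h3
    rw [not_le] at h3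
    linarith [mul_neg_of_pos_of_neg h3 hln]
  · intro y hy hy0
    have hl0 : lam v₀ y = 0 := by rw [hprop, hy0, zero_mul]
    refine ⟨?_, fun s hs hys => ?_⟩
    · have h2 := hcomb y
      rw [hsplit, hl0, zero_smul, zero_add] at h2
      have h3 := hsum y
      rw [hsplit' (fun v => lam v y), hl0, zero_add] at h3
      rw [← h2]
      exact (convex_body e).sum_mem (fun v hv => (hpos y hy v hv).le) h3
        fun v hv => subset_body e hv
    -- A face of `e` without the vertex `v` lies in the zero set of `lam v`, but `lam v` is positive
    -- near the barycenter.
    · refine Finset.Subset.antisymm hs fun v hv => ?_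
      by_contra hvs
      have h3 : body s ⊆ lam v ⁻¹' {0} := by
        refine convexHull_min (fun a ha => ?_) ((convex_singleton 0).affine_preimage (lam v))
        refine h0 v (he hv) a (he (hs ha)) ?_
        rintro rfl
        exact hvs ha
      exact (hpos y hy v hv).ne' (h3 hys)
  · intro y hy hy0
    rw [hint]
    intro v hv
    by_cases hvv : v = v₀
    · rw [hvv, hprop]
      exact mul_pos_of_neg_of_neg hy0 hln
    · exact hpos y hy v (hKe v hv hvv)
  · intro u hu1 hu
    obtain ⟨c, hc⟩ := hspan u (mem_orthogonal_vectorSpan hu)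
    have h2 : |c| = 1 := by
      rw [← hc, norm_smul, hn1, mul_one, Real.norm_eq_abs] at hu1
      exact hu1
    rcases eq_or_eq_neg_of_abs_eq h2 with rfl | rfl
    · left
      rw [← hc, one_smul]
    · right
      rw [← hc, neg_smul, one_smul]

/-- The affine span of `S` does not leave the hyperplane, so the trace of `W` on it is a relatively
open set contained in `S`. -/
theorem mem_intrinsicInterior_of_isOpen {S W : Set (E d)} {n x₀ : E d}
    (hS : ∀ z ∈ S, ⟪n, z - x₀⟫ = 0) (hW : IsOpen W)
    (hWS : ∀ z ∈ W, ⟪n, z - x₀⟫ = 0 → z ∈ S) {y : E d} (hy : y ∈ W) (hy0 : ⟪n, y - x₀⟫ = 0) :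
    y ∈ intrinsicInterior ℝ S := by
  have hpl : ∀ z ∈ affineSpan ℝ S, ⟪n, z - x₀⟫ = 0 := by
    intro z hz
    refine affineSpan_induction (p := fun z => ⟪n, z - x₀⟫ = 0) hz hS fun c u v w hu hv hw => ?_
    have e1 : c • (u - v) + w - x₀ = c • ((u - x₀) - (v - x₀)) + (w - x₀) := by module
    rw [vsub_eq_sub, vadd_eq_add, e1, inner_add_right, inner_smul_right, inner_sub_right, hu, hv,
      hw, sub_zero, mul_zero, add_zero]
  rw [mem_intrinsicInterior]
  refine ⟨⟨y, subset_affineSpan ℝ _ (hWS y hy hy0)⟩, ?_, rfl⟩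
  rw [mem_interior]
  exact ⟨((↑) : affineSpan ℝ S → E d) ⁻¹' W, fun z hz => hWS z hz (hpl z z.2), hW.preimage continuous_subtype_val, hy⟩

/-! ### Triangulations -/

/-- A Lipschitz domain lies on one side of its boundary. From a boundary point, a small step along
`-n` leads strictly below the graph, into an open set disjoint from `Ω`; no neighborhood of that
point is then contained in the closure. A slit domain is the kind of example this excludes. -/
theorem interior_closure_eq {Ω : Set (E d)} (hΩ : IsOpen Ω) (hL : HasLipschitzBoundary Ω) :
    interior (closure Ω) = Ω := by
  refine Subset.antisymm (fun x hx => ?_) (hΩ.subset_interior_iff.2 subset_closure)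
  by_contra hxΩ
  have hxf : x ∈ frontier Ω := by
    rw [hΩ.frontier_eq]
    exact ⟨interior_subset hx, hxΩ⟩
  obtain ⟨n, hn, L, φ, hφ, r, hr, hloc⟩ := hL x hxf
  have hx0 : ⟪n, x⟫ ≤ φ (x - ⟪n, x⟫ • n) := by
    by_contra h
    exact hxΩ ((hloc x (Metric.mem_ball_self hr)).2 (not_le.1 h))
  let c : ℝ → E d := fun t => x - t • n
  have hc : Tendsto c (𝓝[>] 0) (𝓝 x) := by
    have : ContinuousAt c 0 := by fun_prop
    have h2 := this.tendsto
    simp only [c, zero_smul, sub_zero] at h2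
    exact h2.mono_left nhdsWithin_le_nhds
  have hev : ∀ᶠ t in 𝓝[>] (0 : ℝ), c t ∈ interior (closure Ω) ∩ Metric.ball x r :=
    hc.eventually (inter_mem (isOpen_interior.mem_nhds hx) (Metric.ball_mem_nhds x hr))
  obtain ⟨t, ht, ht0⟩ := (hev.and self_mem_nhdsWithin).exists
  have ht0 : 0 < t := ht0
  let U : Set (E d) := Metric.ball x r ∩ {z | ⟪n, z⟫ < φ (z - ⟪n, z⟫ • n)}
  have hU : IsOpen U := by
    refine Metric.isOpen_ball.inter (isOpen_lt (by fun_prop) (hφ.continuous.comp (by fun_prop)))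
  have hcU : c t ∈ U := by
    refine ⟨ht.2, ?_⟩
    have h1 : ⟪n, c t⟫ = ⟪n, x⟫ - t := by
      simp only [c, inner_sub_right, inner_smul_right, real_inner_self_eq_norm_sq, hn]
      ring
    have h2 : c t - ⟪n, c t⟫ • n = x - ⟪n, x⟫ • n := by
      rw [h1]
      simp only [c]
      module
    rw [mem_ofPred_eq, h2, h1]
    linarith
  obtain ⟨z, hzU, hzΩ⟩ := mem_closure_iff.1 (interior_subset ht.1) U hU hcU
  exact lt_asymm hzU.2 ((hloc z hzU.1).1 hzΩ)

namespace Triangulation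

variable {Ω : Set (E d)} (T : Triangulation Ω)

theorem mem_cells {K : Finset (E d)} : K ∈ T.cells ↔ K ∈ T.complex.faces ∧ K.card = d + 1 := by
  simp [cells]

theorem mem_facets {e : Finset (E d)} : e ∈ T.facets ↔ e ∈ T.complex.faces ∧ e.card = d := by
  simp [facets]

theorem mem_facetsOf {K e : Finset (E d)} : e ∈ T.facetsOf K ↔ e ∈ T.facets ∧ e ⊆ K := by
  simp [facetsOf]

theorem mem_cellsAt {K e : Finset (E d)} : K ∈ T.cellsAt e ↔ K ∈ T.cells ∧ e ⊆ K := by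
  simp [cellsAt]

theorem mem_neighbors {K K' : Finset (E d)} :
    K' ∈ T.neighbors K ↔ K' ∈ T.cells ∧ ∃ e ∈ T.facets, e ⊆ K ∧ e ⊆ K' := by
  simp [neighbors]

variable {T}

theorem isSimplex {K : Finset (E d)} (hK : K ∈ T.cells) : IsSimplex K :=
  ⟨T.complex.indep (T.mem_cells.1 hK).1, (T.mem_cells.1 hK).2⟩

theorem closure_eq : closure Ω = ⋃ K ∈ T.cells, body K := by
  rw [← T.space_eq]
  ext x
  rw [Geometry.SimplicialComplex.mem_space_iff]
  simp only [mem_iUnion, exists_prop]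
  constructor
  · rintro ⟨s, hs, hx⟩
    obtain ⟨t, ht, hst, hc⟩ := T.pure s hs
    exact ⟨t, T.mem_cells.2 ⟨ht, hc⟩, body_mono hst hx⟩
  · rintro ⟨K, hK, hx⟩
    exact ⟨K, (T.mem_cells.1 hK).1, hx⟩

theorem body_subset_closure {K : Finset (E d)} (hK : K ∈ T.cells) : body K ⊆ closure Ω := by
  rw [closure_eq (T := T)]
  exact subset_biUnion_of_mem (u := fun K => body K) hK

/-- By conformity the intersection lies in the affine span of the common vertices. Affine
independence keeps any vertex belonging to one element only out of this span, which is therefore a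
proper subspace. -/
theorem volume_inter_eq_zero {K K' : Finset (E d)} (hK : K ∈ T.cells) (hK' : K' ∈ T.cells)
    (hne : K ≠ K') : volume (body K ∩ body K') = 0 := by
  classical
  have hsub := T.complex.inter_subset_convexHull (T.mem_cells.1 hK).1 (T.mem_cells.1 hK').1
  obtain ⟨v, hv, hv'⟩ : ∃ v ∈ K, v ∉ K' := by
    by_contra! h
    exact hne (Finset.eq_of_subset_of_card_le h (by
      rw [(isSimplex hK).card, (isSimplex hK').card]))
  refine measure_mono_null (hsub.trans (convexHull_subset_affineSpan _))
    (Measure.addHaar_affineSubspace _ _ fun htop => hv' ?_)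
  have h1 : v ∈ affineSpan ℝ ((K : Set (E d)) ∩ K') := by
    rw [htop]
    trivial
  have h2 : (K : Set (E d)) ∩ K' = ((↑) : K → E d) '' {w | (w : E d) ∈ K'} := by
    ext x
    simp [and_comm]
  rw [h2] at h1
  exact ((isSimplex hK).indep.mem_affineSpan_iff ⟨v, hv⟩ _).1 h1

theorem eq_of_mem_interior {K K' : Finset (E d)} (hK : K ∈ T.cells) (hK' : K' ∈ T.cells) {x : E d}
    (hx : x ∈ interior (body K)) (hx' : x ∈ interior (body K')) : K = K' := by
  by_contra hne
  have h := volume_inter_eq_zero hK hK' hne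
  have h2 : 0 < volume (interior (body K) ∩ interior (body K')) :=
    (isOpen_interior.inter isOpen_interior).measure_pos _ ⟨x, hx, hx'⟩
  exact h2.ne' (measure_mono_null (inter_subset_inter interior_subset interior_subset) h)

/-- Points of `closure Ω` near `x` lie in elements that contain `x`. -/
theorem eventually_mem_cell (x : E d) :
    ∀ᶠ z in 𝓝 x, z ∈ closure Ω → ∃ K ∈ T.cells, x ∈ body K ∧ z ∈ body K := by
  have h : ∀ᶠ z in 𝓝 x, ∀ K ∈ T.cells, z ∈ body K → x ∈ body K := by
    rw [Filter.eventually_all_finset]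
    intro K _
    by_cases hx : x ∈ body K
    · exact .of_forall fun _ _ => hx
    · filter_upwards [(isClosed_body K).isOpen_compl.mem_nhds hx] with z hz hz'
      exact absurd hz' hz
  filter_upwards [h] with z hz hzΩ
  rw [closure_eq (T := T)] at hzΩ
  simp only [mem_iUnion, exists_prop] at hzΩ
  obtain ⟨K, hK, hzK⟩ := hzΩ
  exact ⟨K, hK, hz K hK hzK, hzK⟩

/-! ### The elements adjacent to a facet. -/

/-- Conformity puts `y` in the hull of the vertices common to `K'` and `e`. Near the barycenter no
proper face of `e` is met, so all vertices of `e` are common. -/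
theorem subset_of_mem {K K' e : Finset (E d)} {δ : ℝ} (he : e ∈ T.facets) (h : IsFacetAt K e δ)
    (hK' : K' ∈ T.cells) {y : E d} (hy : y ∈ Metric.ball (barycenter e) δ)
    (hy0 : ⟪outwardNormal K e, y - barycenter e⟫ = 0) (hyK' : y ∈ body K') : e ⊆ K' := by
  classical
  obtain ⟨hye, hs⟩ := h.mem_facet y hy hy0
  have h1 := T.complex.inter_subset_convexHull (T.mem_cells.1 hK').1 (T.mem_facets.1 he).1
    ⟨hyK', hye⟩
  have h2 : K' ∩ e = e := hs _ Finset.inter_subset_right (by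
    rw [body, Finset.coe_inter]
    exact h1)
  exact Finset.inter_eq_right.1 h2

theorem normal_eq_or {K K' e : Finset (E d)} {δ : ℝ} (h : IsFacetAt K e δ)
    (h' : IsFacetAt K' e δ) :
    outwardNormal K' e = outwardNormal K e ∨ outwardNormal K' e = -outwardNormal K e :=
  h.normal_unique _ h'.norm_normal h'.inner_facet

/-- Both elements occupy the same side of `e`: a point slightly behind the barycenter is interior to
each, which is impossible for distinct elements. -/
theorem eq_of_normal_eq {K K' e : Finset (E d)} {δ : ℝ} (hδ : 0 < δ) (hK : K ∈ T.cells)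
    (hK' : K' ∈ T.cells) (h : IsFacetAt K e δ) (h' : IsFacetAt K' e δ)
    (hn : outwardNormal K' e = outwardNormal K e) : K = K' := by
  let z := barycenter e - (δ / 2) • outwardNormal K e
  have hz : z ∈ Metric.ball (barycenter e) δ := by
    rw [Metric.mem_ball, dist_eq_norm]
    simp only [z, sub_sub_cancel_left, norm_neg, norm_smul, h.norm_normal, Real.norm_eq_abs,
      abs_of_pos (half_pos hδ)]
    linarith
  have hz0 : ⟪outwardNormal K e, z - barycenter e⟫ < 0 := by
    simp only [z, sub_sub_cancel_left, inner_neg_right, inner_smul_right,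
      real_inner_self_eq_norm_sq, h.norm_normal]
    linarith
  exact eq_of_mem_interior hK hK' (h.mem_interior z hz hz0) (h'.mem_interior z hz (hn ▸ hz0))

theorem normal_eq_neg {K K' e : Finset (E d)} {δ : ℝ} (hδ : 0 < δ) (hK : K ∈ T.cells)
    (hK' : K' ∈ T.cells) (h : IsFacetAt K e δ) (h' : IsFacetAt K' e δ) (hne : K' ≠ K) :
    outwardNormal K' e = -outwardNormal K e :=
  (normal_eq_or h h').resolve_left fun hn => hne (eq_of_normal_eq hδ hK hK' h h' hn).symm

/-- The outward normals are opposite, so `K` fills one half of the ball, `K'` the other, and the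
disc between them belongs to `e`. -/
theorem ball_subset_union {K K' e : Finset (E d)} {δ : ℝ} (hδ : 0 < δ) (hK : K ∈ T.cells)
    (hK' : K' ∈ T.cells) (heK : e ⊆ K) (h : IsFacetAt K e δ) (h' : IsFacetAt K' e δ)
    (hne : K' ≠ K) : Metric.ball (barycenter e) δ ⊆ body K ∪ body K' := by
  intro y hy
  rcases lt_trichotomy ⟪outwardNormal K e, y - barycenter e⟫ 0 with h1 | h1 | h1
  · exact Or.inl (interior_subset (h.mem_interior y hy h1))
  · exact Or.inl (body_mono heK (h.mem_facet y hy h1).1)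
  · refine Or.inr (interior_subset (h'.mem_interior y hy ?_))
    rw [normal_eq_neg hδ hK hK' h h' hne, inner_neg_left]
    linarith

theorem mem_of_liesIn {K e : Finset (E d)} {δ : ℝ} {S : Set (E d)} (h : IsFacetAt K e δ)
    (heS : LiesIn e S) {y : E d} (hy : y ∈ Metric.ball (barycenter e) δ)
    (hy0 : ⟪outwardNormal K e, y - barycenter e⟫ = 0) : y ∈ S :=
  heS (mem_intrinsicInterior_of_isOpen h.inner_facet Metric.isOpen_ball
    (fun z hz hz0 => (h.mem_facet z hz hz0).1) hy hy0)

/-- An interior facet belongs to exactly two elements, which lie on opposite sides of it. -/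
theorem exists_neighbor {K e : Finset (E d)} {δ : ℝ} (hδ : 0 < δ) (hΩ : IsOpen Ω)
    (he : e ∈ T.facets) (hall : ∀ K ∈ T.cellsAt e, IsFacetAt K e δ)
    (heΩ : LiesIn e Ω) (hK : K ∈ T.cellsAt e) : ∃ K' ∈ T.cellsAt e, K' ≠ K := by
  have h := hall K hK
  have hx : barycenter e ∈ Ω := mem_of_liesIn h heΩ (Metric.mem_ball_self hδ) (by simp)
  -- Leaving `K` along its outward normal while remaining in `Ω` enters an element that contains the
  -- barycenter of `e`; it must contain `e` and differ from `K`.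
  let c : ℝ → E d := fun t => barycenter e + t • outwardNormal K e
  have hc : Tendsto c (𝓝[>] 0) (𝓝 (barycenter e)) := by
    have : ContinuousAt c 0 := by fun_prop
    have h2 := this.tendsto
    simp only [c, zero_smul, add_zero] at h2
    exact h2.mono_left nhdsWithin_le_nhds
  have hev := hc.eventually ((eventually_mem_cell (T := T) (barycenter e)).and
    (hΩ.mem_nhds hx : ∀ᶠ z in 𝓝 (barycenter e), z ∈ Ω))
  obtain ⟨t, ⟨ht, htΩ⟩, ht0⟩ := (hev.and self_mem_nhdsWithin).exists
  have ht0 : 0 < t := ht0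
  obtain ⟨K', hK', hxK', hzK'⟩ := ht (subset_closure htΩ)
  refine ⟨K', T.mem_cellsAt.2 ⟨hK', subset_of_mem he h hK' (Metric.mem_ball_self hδ) (by simp)
    hxK'⟩, ?_⟩
  rintro rfl
  have h3 := h.inner_cell _ hzK'
  simp only [c, add_sub_cancel_left, inner_smul_right, real_inner_self_eq_norm_sq,
    h.norm_normal] at h3
  linarith

theorem cellsAt_eq_pair [DecidableEq (Finset (E d))] {K K' e : Finset (E d)} {δ : ℝ} (hδ : 0 < δ)
    (hall : ∀ K ∈ T.cellsAt e, IsFacetAt K e δ) (hK : K ∈ T.cellsAt e) (hK' : K' ∈ T.cellsAt e)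
    (hne : K' ≠ K) : T.cellsAt e = {K, K'} := by
  ext K''
  simp only [Finset.mem_insert, Finset.mem_singleton]
  constructor
  · intro hK''
    by_cases h1 : K'' = K
    · exact Or.inl h1
    right
    have hc := fun {K} (hK : K ∈ T.cellsAt e) => (T.mem_cellsAt.1 hK).1
    have e1 := normal_eq_neg hδ (hc hK) (hc hK') (hall K hK) (hall K' hK') hne
    have e2 := normal_eq_neg hδ (hc hK) (hc hK'') (hall K hK) (hall K'' hK'') h1
    exact eq_of_normal_eq hδ (hc hK'') (hc hK') (hall K'' hK'') (hall K' hK') (e1.trans e2.symm)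
  · rintro (rfl | rfl) <;> assumption

/-- A boundary facet belongs to only one element. -/
theorem cellsAt_eq_singleton {K e : Finset (E d)} {δ : ℝ} (hδ : 0 < δ) (hΩ : IsOpen Ω)
    (hL : HasLipschitzBoundary Ω)
    (hall : ∀ K ∈ T.cellsAt e, IsFacetAt K e δ) {S : Set (E d)} (hS : S ⊆ frontier Ω)
    (heS : LiesIn e S) (hK : K ∈ T.cellsAt e) : T.cellsAt e = {K} := by
  have h := hall K hK
  have hx : barycenter e ∈ S := mem_of_liesIn h heS (Metric.mem_ball_self hδ) (by simp)
  refine Finset.eq_singleton_iff_unique_mem.2 ⟨hK, fun K' hK' => ?_⟩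
  by_contra hne
  have hc := fun {K} (hK : K ∈ T.cellsAt e) => (T.mem_cellsAt.1 hK).1
  -- Two elements would fill a ball around the barycenter, making it an interior point of the
  -- closure, hence a point of `Ω`, although it lies on the frontier.
  have hsub : Metric.ball (barycenter e) δ ⊆ closure Ω :=
    (ball_subset_union hδ (hc hK) (hc hK') (T.mem_cellsAt.1 hK).2 h (hall K' hK') hne).trans
      (union_subset (body_subset_closure (hc hK)) (body_subset_closure (hc hK')))
  have h2 : barycenter e ∈ interior (closure Ω) :=
    mem_interior.2 ⟨_, hsub, Metric.isOpen_ball, Metric.mem_ball_self hδ⟩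
  rw [interior_closure_eq hΩ hL] at h2
  have h3 := hS hx
  rw [hΩ.frontier_eq] at h3
  exact h3.2 h2

theorem exists_closedBall_subset {C₀ : ℝ} (hC₀ : 0 < C₀) (hT : T.ShapeRegular C₀) (hd : 0 < d)
    {K : Finset (E d)} (hK : K ∈ T.cells) :
    ∃ x, Metric.closedBall x (diam K / (2 * C₀)) ⊆ body K := by
  have h1 := hT K hK
  have h2 := (isSimplex hK).diam_pos hd
  -- The factor `2` makes the inequality strict, so a ball of at least this radius exists without
  -- asking whether the supremum defining the inradius is attained.
  have h3 : diam K / (2 * C₀) < inradius K := by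
    rw [div_lt_iff₀ (by positivity)]
    linarith
  -- A negative radius gives the empty ball, a free witness that the set of radii is nonempty.
  obtain ⟨r, ⟨x, hx⟩, hr⟩ := exists_lt_of_lt_csSup (⟨-1, 0, by
    rw [Metric.closedBall_eq_empty.2 (by norm_num)]
    exact empty_subset _⟩ : {r : ℝ | ∃ x, Metric.closedBall x r ⊆ body K}.Nonempty) h3
  exact ⟨x, (Metric.closedBall_subset_closedBall hr.le).trans hx⟩

theorem diam_mono {e K : Finset (E d)} (h : e ⊆ K) : diam e ≤ diam K :=
  Metric.diam_mono (body_mono h) (isCompact_body K).isBounded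

/-- The ball of radius `h_K / (2 C₀)` inscribed in `K` yields the distance `h_K / (2 C₀ d)`.
Weakening it by `h_e ≤ h_K` gives a distance depending on `e` alone, common to all elements at `e`.
-/
theorem isFacetAt {C₀ : ℝ} (hC₀ : 0 < C₀) (hT : T.ShapeRegular C₀) (hd : 0 < d)
    {e K : Finset (E d)} (he : e ∈ T.facets) (hK : K ∈ T.cellsAt e) :
    IsFacetAt K e (diam e / (2 * C₀ * d)) := by
  obtain ⟨hKc, heK⟩ := T.mem_cellsAt.1 hK
  obtain ⟨x, hx⟩ := exists_closedBall_subset hC₀ hT hd hKc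
  have h := (isSimplex hKc).isFacetAt hd heK (T.mem_facets.1 he).2
    (div_pos ((isSimplex hKc).diam_pos hd) (by positivity)) hx
  refine h.mono ?_
  rw [div_div]
  gcongr
  exact diam_mono heK

theorem interior_body_subset (hΩ : IsOpen Ω) (hL : HasLipschitzBoundary Ω) {K : Finset (E d)}
    (hK : K ∈ T.cells) : interior (body K) ⊆ Ω := by
  conv_rhs => rw [← interior_closure_eq hΩ hL]
  exact interior_mono (body_subset_closure hK)

end Triangulation

end

section

/-! ### Test functions supported in a patch of elements -/

variable {d : ℕ}

theorem continuous_gradient {V : E d → ℝ} (hV : ContDiff ℝ ∞ V) : Continuous (gradient V) :=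
  (gradient_contDiff hV).continuous

theorem hasCompactSupport_gradient {V : E d → ℝ} (hc : HasCompactSupport V) :
    HasCompactSupport (gradient V) := by
  unfold gradient
  exact hc.fderiv (𝕜 := ℝ) |>.comp_left (map_zero _)

theorem gradient_eq_zero_of_notMem_tsupport {V : E d → ℝ} {x : E d} (hx : x ∉ tsupport V) :
    gradient V x = 0 := by
  have h : V =ᶠ[𝓝 x] fun _ => 0 := notMem_tsupport_iff_eventuallyEq.1 hx
  rw [h.gradient_eq, gradient_fun_const]

/-- A function that is differentiable in an open set has its gradient as weak gradient there. -/
theorem isWeakGradient_of_hasGradientAt {Ω : Set (E d)} {v : E d → ℝ}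
    {g : E d → E d} (hv : Integrable v) (hg : Integrable g)
    (h : ∀ x ∈ Ω, HasGradientAt v (g x) x) : IsWeakGradient Ω v g := by
  refine ⟨hv.locallyIntegrable.locallyIntegrableOn Ω, hg.locallyIntegrable.locallyIntegrableOn Ω,
    fun ψ hψ hψc hψΩ => ?_⟩
  have hψ1 := hψ.continuous
  have hψ2 := continuous_gradient hψ
  obtain ⟨C₁, hC₁⟩ := hψ1.bounded_above_of_compact_support hψc
  obtain ⟨C₂, hC₂⟩ := hψ2.bounded_above_of_compact_support (hasCompactSupport_gradient hψc)
  have i1 : Integrable fun x => v x • gradient ψ x :=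
    hv.smul_bdd C₂ hψ2.aestronglyMeasurable (.of_forall hC₂)
  have i2 : Integrable fun x => ψ x • g x :=
    hg.bdd_smul C₁ hψ1.aestronglyMeasurable (.of_forall hC₁)
  -- The product is differentiable on the whole space although `v` need not be: off the support of
  -- `ψ` it vanishes locally.
  have hfd : ∀ x, HasGradientAt (fun x => v x * ψ x) (v x • gradient ψ x + ψ x • g x) x := by
    intro x
    by_cases hx : x ∈ tsupport ψ
    · have h1 := (h x (hψΩ hx)).hasFDerivAt.mul
        ((hψ.differentiable (by simp) x).hasGradientAt).hasFDerivAt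
      rw [hasGradientAt_iff_hasFDerivAt]
      refine h1.congr_fderiv ?_
      simp
    · rw [gradient_eq_zero_of_notMem_tsupport hx, image_eq_zero_of_notMem_tsupport hx, smul_zero,
        zero_smul, add_zero]
      refine (hasGradientAt_const x (0 : ℝ)).congr_of_eventuallyEq ?_
      filter_upwards [notMem_tsupport_iff_eventuallyEq.1 hx] with y hy
      rw [hy]
      simp
  -- The gradient of the integrable function `v ψ` integrates to zero; this is integration by parts
  -- against the constant `1`, one direction `w` at a time.
  have hsum : ∫ x, (v x • gradient ψ x + ψ x • g x) = 0 := by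
    refine ext_inner_right ℝ fun w => ?_
    have hi : Integrable fun x => v x • gradient ψ x + ψ x • g x := i1.add i2
    rw [inner_zero_left, real_inner_comm, ← integral_inner hi]
    have key := integral_bilinear_hasFDerivAt_right_eq_neg_left_of_integrable
      (μ := (volume : Measure (E d))) (B := ContinuousLinearMap.mul ℝ ℝ) (v := w)
      (f := fun _ => (1 : ℝ)) (f' := fun _ => 0) (g := fun x => v x * ψ x)
      (g' := fun x => InnerProductSpace.toDual ℝ _ (v x • gradient ψ x + ψ x • g x)) (by simp)
      (by
        refine (hi.const_inner (𝕜 := ℝ) w).congr (.of_forall fun x => ?_)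
        simp only []
        rw [ContinuousLinearMap.mul_apply', one_mul, InnerProductSpace.toDual_apply_apply,
          real_inner_comm])
      (by
        simpa using hv.mul_bdd hψ1.aestronglyMeasurable (.of_forall hC₁))
      (fun x _ => hasFDerivAt_const _ _) (fun x _ => (hfd x).hasFDerivAt)
    simp only [ContinuousLinearMap.mul_apply', one_mul, zero_apply, zero_mul,
      integral_zero, neg_zero, InnerProductSpace.toDual_apply_apply] at key
    rw [← key]
    congr 1
    ext x
    rw [real_inner_comm]
  rw [integral_add i1 i2] at hsum
  rw [setIntegral_eq_integral_of_forall_compl_eq_zero, setIntegral_eq_integral_of_forall_compl_eq_zero]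
  · exact eq_neg_of_add_eq_zero_left hsum
  · intro x hx
    rw [image_eq_zero_of_notMem_tsupport fun h => hx (hψΩ h), zero_smul]
  · intro x hx
    rw [gradient_eq_zero_of_notMem_tsupport fun h => hx (hψΩ h), smul_zero]

namespace Triangulation

variable {Ω : Set (E d)} {T : Triangulation Ω}

theorem ae_mem_interior (K : Finset (E d)) :
    ∀ᵐ x ∂(volume.restrict (body K)), x ∈ interior (body K) := by
  have h := (convex_body K).addHaar_frontier volume
  rw [ae_restrict_iff' (isClosed_body K).measurableSet]
  filter_upwards [compl_mem_ae_iff.2 h] with x hx hxK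
  by_contra hxi
  exact hx ⟨subset_closure hxK, hxi⟩

theorem ae_mem_domain (hΩ : IsOpen Ω) (hL : HasLipschitzBoundary Ω) {K : Finset (E d)}
    (hK : K ∈ T.cells) : ∀ᵐ x ∂(volume.restrict (body K)), x ∈ Ω := by
  filter_upwards [ae_mem_interior K] with x hx
  exact interior_body_subset hΩ hL hK hx

theorem restrict_body_le (hΩ : IsOpen Ω) (hL : HasLipschitzBoundary Ω) {K : Finset (E d)}
    (hK : K ∈ T.cells) : volume.restrict (body K) ≤ volume.restrict Ω := by
  have h : volume.restrict (body K) = volume.restrict (body K ∩ Ω) := by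
    refine Measure.restrict_congr_set ?_
    have := ae_mem_domain hΩ hL hK
    rw [ae_restrict_iff' (isClosed_body K).measurableSet] at this
    filter_upwards [this] with x hx
    exact propext ⟨fun h => ⟨h, hx h⟩, fun h => h.1⟩
  rw [h]
  exact Measure.restrict_mono inter_subset_right le_rfl

theorem restrict_biUnion {S : Finset (Finset (E d))} (hS : S ⊆ T.cells) :
    volume.restrict (⋃ K ∈ S, body K) = ∑ K ∈ S, volume.restrict (body K) := by
  classical
  induction S using Finset.induction_on with
  | empty => simp
  | insert K S hKS ih =>
    rw [Finset.sum_insert hKS, Finset.set_biUnion_insert, Measure.restrict_union₀, ih]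
    · exact fun K' hK' => hS (Finset.mem_insert_of_mem hK')
    · rw [AEDisjoint, inter_iUnion₂]
      refine (measure_biUnion_null_iff S.countable_toSet).2 fun K' hK' => ?_
      exact volume_inter_eq_zero (hS (Finset.mem_insert_self _ _))
        (hS (Finset.mem_insert_of_mem hK')) (fun h => hKS (h ▸ hK'))
    · exact (S.measurableSet_biUnion fun K _ => (isClosed_body K).measurableSet).nullMeasurableSet

theorem setIntegral_indicator_biUnion (hΩ : IsOpen Ω) (hL : HasLipschitzBoundary Ω)
    {S : Finset (Finset (E d))} (hS : S ⊆ T.cells) {F : E d → ℝ}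
    (hF : ∀ K ∈ S, IntegrableOn F (body K)) :
    ∫ x in Ω, (⋃ K ∈ S, body K).indicator F x = ∑ K ∈ S, ∫ x in body K, F x := by
  have hm : MeasurableSet (⋃ K ∈ S, body K) :=
    S.measurableSet_biUnion fun K _ => (isClosed_body K).measurableSet
  have h1 : volume.restrict (Ω ∩ ⋃ K ∈ S, body K) = volume.restrict (⋃ K ∈ S, body K) := by
    refine Measure.restrict_congr_set ?_
    have : ∀ᵐ x, ∀ K ∈ S, x ∈ body K → x ∈ Ω := by
      rw [Filter.eventually_all_finset]
      intro K hK
      have := ae_mem_domain hΩ hL (hS hK)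
      rwa [ae_restrict_iff' (isClosed_body K).measurableSet] at this
    filter_upwards [this] with x hx
    refine propext ⟨fun h => h.2, fun h => ⟨?_, h⟩⟩
    have h' : x ∈ ⋃ K ∈ S, body K := h
    simp only [mem_iUnion, exists_prop] at h'
    obtain ⟨K, hK, hxK⟩ := h'
    exact hx K hK hxK
  rw [setIntegral_indicator hm, h1, restrict_biUnion hS, integral_finsetSum_measure hF]

theorem ae_eq_cellValue {F : Type*} {c : E d → F} (hc : IsCellwiseConstant T c) {K : Finset (E d)}
    (hK : K ∈ T.cells) : ∀ᵐ x ∂(volume.restrict (body K)), c x = cellValue c K := by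
  filter_upwards [ae_mem_interior K] with x hx
  exact hc K hK x hx

end Triangulation

theorem MemLp_two_inner {X F : Type*} [MeasurableSpace X] {μ : Measure X} [NormedAddCommGroup F]
    [InnerProductSpace ℝ F] {f g : X → F} (hf : MemLp f 2 μ) (hg : MemLp g 2 μ) :
    Integrable (fun x => ⟪f x, g x⟫) μ := by
  refine (hf.norm.integrable_mul hg.norm).mono'
    (hf.aestronglyMeasurable.inner hg.aestronglyMeasurable) (.of_forall fun x => ?_)
  exact norm_inner_le_norm _ _

/-- The bilinear form on the element `K` with constant coefficients. -/
def cellBilin (α : ℝ) (a : E d) (b : ℝ) (K : Finset (E d)) (w : E d → ℝ) (Dw : E d → E d)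
    (V : E d → ℝ) : ℝ :=
  α * (∫ x in body K, ⟪Dw x, gradient V x⟫) + (∫ x in body K, ⟪a, Dw x⟫ * V x) +
    b * ∫ x in body K, w x * V x

open Triangulation in
/-- Testing the weak formulation with a smooth function cut off to the union of some elements. -/
theorem sum_cellBilin_eq {Ω ΓD ΓN : Set (E d)} (hdom : IsDomainWithBoundary Ω ΓD ΓN)
    {T : Triangulation Ω} {α : E d → ℝ} {a : E d → E d} {b : E d → ℝ}
    (hα : IsCellwiseConstant T α) (ha : IsCellwiseConstant T a) (hb : IsCellwiseConstant T b)
    {f gN : E d → ℝ} (hf : MemLp f 2 (volume.restrict Ω)) {u : H1Function Ω}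
    (hu : IsWeakSolution Ω ΓD ΓN α a b f gN u) {S : Finset (Finset (E d))} (hS : S ⊆ T.cells)
    {V : E d → ℝ} (hV : ContDiff ℝ ∞ V) (hVc : HasCompactSupport V) {A : Set (E d)}
    (hA : MeasurableSet A) (hAfin : surf d A ≠ ⊤) (hAN : A ⊆ ΓN) (hAU : A ⊆ ⋃ K ∈ S, body K)
    (hloc : ∀ x ∈ closure Ω, x ∈ tsupport V → x ∈ ⋃ K ∈ S, body K →
      (⋃ K ∈ S, body K) ∈ 𝓝[closure Ω] x)
    (hfr : ∀ x ∈ frontier Ω, x ∈ ⋃ K ∈ S, body K → V x ≠ 0 → x ∈ A) :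
    ∑ K ∈ S, cellBilin (cellValue α K) (cellValue a K) (cellValue b K) K u.toFun u.grad V =
      ∑ K ∈ S, (∫ x in body K, f x * V x) - ∫ x in A, gN x * V x ∂(surf d) := by
  have hΩ := hdom.isOpen
  have hL := hdom.lipschitz
  set U : Set (E d) := ⋃ K ∈ S, body K with hU
  have hUc : IsClosed U := S.finite_toSet.isClosed_biUnion fun K _ => isClosed_body K
  have hUm := hUc.measurableSet
  have hG := continuous_gradient hV
  have hGc := hasCompactSupport_gradient hVc
  have hV2 : MemLp V 2 (volume : Measure (E d)) := hV.continuous.memLp_of_hasCompactSupport hVc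
  have hG2 : MemLp (gradient V) 2 (volume : Measure (E d)) := hG.memLp_of_hasCompactSupport hGc
  -- The test function is `V` on `U` and zero elsewhere. By `hloc`, relative to the closure of `Ω`,
  -- the set `U` is a neighborhood of each of its points in the support of `V`. The cutoff thus
  -- creates no jump, and its gradient is the cut off gradient.
  let v : H1Function Ω :=
    { toFun := U.indicator V
      grad := U.indicator (gradient V)
      memLp := (hV2.indicator hUm).restrict _
      memLp_grad := (hG2.indicator hUm).restrict _
      weak := by
        refine isWeakGradient_of_hasGradientAt
          ((hV.continuous.integrable_of_hasCompactSupport hVc).indicator hUm)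
          ((hG.integrable_of_hasCompactSupport hGc).indicator hUm) fun x hx => ?_
        by_cases hxU : x ∈ U
        · rw [indicator_of_mem hxU]
          by_cases hxV : x ∈ tsupport V
          · have h1 := hloc x (subset_closure hx) hxV hxU
            rw [nhdsWithin_eq_nhds.2 (mem_of_superset (hΩ.mem_nhds hx) subset_closure)] at h1
            refine (hV.differentiable (by simp) x).hasGradientAt.congr_of_eventuallyEq ?_
            filter_upwards [h1] with y hy
            rw [indicator_of_mem hy]
          · rw [gradient_eq_zero_of_notMem_tsupport hxV]
            refine (hasGradientAt_const x (0 : ℝ)).congr_of_eventuallyEq ?_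
            filter_upwards [notMem_tsupport_iff_eventuallyEq.1 hxV] with y hy
            simp [hy]
        · rw [indicator_of_notMem hxU]
          refine (hasGradientAt_const x (0 : ℝ)).congr_of_eventuallyEq ?_
          filter_upwards [hUc.isOpen_compl.mem_nhds hxU] with y hy
          rw [indicator_of_notMem hy] }
  have hvc : ContinuousOn v.toFun (closure Ω) := by
    intro x hx
    by_cases hxU : x ∈ U
    · by_cases hxV : x ∈ tsupport V
      · refine hV.continuous.continuousWithinAt.congr_of_eventuallyEq ?_ (indicator_of_mem hxU V)
        filter_upwards [hloc x hx hxV hxU] with y hy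
        exact indicator_of_mem hy V
      · refine ContinuousAt.continuousWithinAt
          ((continuousAt_const (y := (0 : ℝ))).congr ?_)
        filter_upwards [notMem_tsupport_iff_eventuallyEq.1 hxV] with y hy
        have hy : V y = 0 := hy
        change 0 = U.indicator V y
        by_cases hyU : y ∈ U <;> simp [hyU, hy]
    · refine ContinuousAt.continuousWithinAt ((continuousAt_const (y := (0 : ℝ))).congr ?_)
      filter_upwards [hUc.isOpen_compl.mem_nhds hxU] with y hy
      exact (indicator_of_notMem hy V).symm
  have htr : ∀ x ∈ frontier Ω, v.toFun x = A.indicator V x := by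
    intro x hx
    by_cases hxA : x ∈ A
    · rw [indicator_of_mem hxA]
      exact indicator_of_mem (hAU hxA) V
    · rw [indicator_of_notMem hxA]
      by_cases hxU : x ∈ U
      · by_contra h
        exact hxA (hfr x hx hxU fun h0 => h (by simp [v, hxU, h0]))
      · exact indicator_of_notMem hxU V
  -- Since `v` is continuous up to the boundary, the constant sequence realizes its trace. The trace
  -- lives on `A`, a subset of `ΓN`, and so vanishes on `ΓD`.
  have hγ : IsTraceVanishing ΓD v (A.indicator V) := by
    refine ⟨⟨?_, fun _ => v, fun _ => hvc, by simp, by simp, ?_⟩, ?_⟩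
    · rw [memLp_indicator_iff_restrict hA]
      have : IsFiniteMeasure (((surf d).restrict (frontier Ω)).restrict A) := ⟨by
        rw [Measure.restrict_apply_univ]
        exact (Measure.restrict_apply_le _ _).trans_lt hAfin.lt_top⟩
      obtain ⟨C, hC⟩ := hV.continuous.bounded_above_of_compact_support hVc
      exact MemLp.of_bound hV.continuous.aestronglyMeasurable C (.of_forall hC)
    · have h0 : eLpNorm (v.toFun - A.indicator V) 2 ((surf d).restrict (frontier Ω)) = 0 := by
        refine (eLpNorm_congr_ae (g := 0) ?_).trans eLpNorm_zero
        filter_upwards [ae_restrict_mem isClosed_frontier.measurableSet] with x hx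
        simp [htr x hx]
      simp [h0]
    · have hdis : A ∩ ΓD = ∅ :=
        (hdom.disjoint.symm.mono_left hAN).inter_eq
      have h0 : (surf d).restrict ΓD A = 0 := by
        rw [Measure.restrict_apply hA, hdis, measure_empty]
      filter_upwards [compl_mem_ae_iff.2 h0] with x hx
      exact indicator_of_notMem hx V
  have key := hu.2 v _ hγ
  have hle : ∀ K ∈ S, volume.restrict (body K) ≤ volume.restrict Ω := fun K hK =>
    restrict_body_le hΩ hL (hS hK)
  have hfu : ∀ K ∈ S, MemLp u.toFun 2 (volume.restrict (body K)) := fun K hK =>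
    u.memLp.mono_measure (hle K hK)
  have hgu : ∀ K ∈ S, MemLp u.grad 2 (volume.restrict (body K)) := fun K hK =>
    u.memLp_grad.mono_measure (hle K hK)
  have e1 : ∫ x in Ω, α x * ⟪u.grad x, v.grad x⟫ =
      ∑ K ∈ S, cellValue α K * ∫ x in body K, ⟪u.grad x, gradient V x⟫ := by
    have h1 : ∀ x, α x * ⟪u.grad x, v.grad x⟫ =
        U.indicator (fun x => α x * ⟪u.grad x, gradient V x⟫) x := by
      intro x
      by_cases hx : x ∈ U <;> simp [v, hx]
    have h2 : ∀ K ∈ S, (fun x => α x * ⟪u.grad x, gradient V x⟫) =ᵐ[volume.restrict (body K)]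
        fun x => cellValue α K * ⟪u.grad x, gradient V x⟫ := by
      intro K hK
      filter_upwards [ae_eq_cellValue hα (hS hK)] with x hx
      rw [hx]
    simp only [h1]
    rw [setIntegral_indicator_biUnion hΩ hL hS fun K hK =>
      ((MemLp_two_inner (hgu K hK) (hG2.restrict _)).const_mul _).congr (h2 K hK).symm]
    refine Finset.sum_congr rfl fun K hK => ?_
    rw [integral_congr_ae (h2 K hK), integral_const_mul]
  have e2 : ∫ x in Ω, ⟪a x, u.grad x⟫ * v.toFun x =
      ∑ K ∈ S, ∫ x in body K, ⟪cellValue a K, u.grad x⟫ * V x := by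
    have h1 : ∀ x, ⟪a x, u.grad x⟫ * v.toFun x =
        U.indicator (fun x => ⟪a x, u.grad x⟫ * V x) x := by
      intro x
      by_cases hx : x ∈ U <;> simp [v, hx]
    have h2 : ∀ K ∈ S, (fun x => ⟪a x, u.grad x⟫ * V x) =ᵐ[volume.restrict (body K)]
        fun x => ⟪cellValue a K, u.grad x⟫ * V x := by
      intro K hK
      filter_upwards [ae_eq_cellValue ha (hS hK)] with x hx
      rw [hx]
    simp only [h1]
    rw [setIntegral_indicator_biUnion hΩ hL hS fun K hK =>
      (((hgu K hK).const_inner (𝕜 := ℝ) (cellValue a K)).integrable_mul (hV2.restrict _)).congr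
        (h2 K hK).symm]
    exact Finset.sum_congr rfl fun K hK => integral_congr_ae (h2 K hK)
  have e3 : ∫ x in Ω, b x * u.toFun x * v.toFun x =
      ∑ K ∈ S, cellValue b K * ∫ x in body K, u.toFun x * V x := by
    have h1 : ∀ x, b x * u.toFun x * v.toFun x =
        U.indicator (fun x => b x * u.toFun x * V x) x := by
      intro x
      by_cases hx : x ∈ U <;> simp [v, hx]
    have h2 : ∀ K ∈ S, (fun x => b x * u.toFun x * V x) =ᵐ[volume.restrict (body K)]
        fun x => cellValue b K * (u.toFun x * V x) := by
      intro K hK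
      filter_upwards [ae_eq_cellValue hb (hS hK)] with x hx
      rw [hx, mul_assoc]
    simp only [h1]
    rw [setIntegral_indicator_biUnion hΩ hL hS fun K hK =>
      (((hfu K hK).integrable_mul (hV2.restrict _)).const_mul _).congr (h2 K hK).symm]
    refine Finset.sum_congr rfl fun K hK => ?_
    rw [integral_congr_ae (h2 K hK), integral_const_mul]
  have e4 : ∫ x in Ω, f x * v.toFun x = ∑ K ∈ S, ∫ x in body K, f x * V x := by
    have h1 : ∀ x, f x * v.toFun x = U.indicator (fun x => f x * V x) x := by
      intro x
      by_cases hx : x ∈ U <;> simp [v, hx]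
    simp only [h1]
    exact setIntegral_indicator_biUnion hΩ hL hS fun K hK =>
      (hf.mono_measure (hle K hK)).integrable_mul (hV2.restrict _)
  have e5 : ∫ x in ΓN, gN x * A.indicator V x ∂(surf d) = ∫ x in A, gN x * V x ∂(surf d) := by
    have h1 : ∀ x, gN x * A.indicator V x = A.indicator (fun x => gN x * V x) x := by
      intro x
      by_cases hx : x ∈ A <;> simp [hx]
    simp only [h1]
    rw [integral_indicator hA, Measure.restrict_restrict hA, inter_eq_left.2 hAN]
  rw [bilin, e1, e2, e3, e4, e5] at key
  rw [← key]
  simp only [cellBilin, Finset.sum_add_distrib]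

end

section

/-! ### The `L²` norm -/

variable {d : ℕ}

section L2

variable {F : Type*} [NormedAddCommGroup F] {μ : Measure (E d)}

theorem l2norm_nonneg (μ : Measure (E d)) (f : E d → F) : 0 ≤ l2norm μ f := Real.sqrt_nonneg _

theorem sq_l2norm (μ : Measure (E d)) (f : E d → F) : l2norm μ f ^ 2 = ∫ x, ‖f x‖ ^ 2 ∂μ :=
  Real.sq_sqrt (integral_nonneg fun _ => by positivity)

theorem l2norm_congr {f g : E d → F} (h : f =ᵐ[μ] g) : l2norm μ f = l2norm μ g := by
  rw [l2norm, l2norm]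
  congr 1
  refine integral_congr_ae ?_
  filter_upwards [h] with x hx
  rw [hx]

theorem l2norm_le {f : E d → F} {B : ℝ} (hB : 0 ≤ B) (h : ∫ x, ‖f x‖ ^ 2 ∂μ ≤ B ^ 2) :
    l2norm μ f ≤ B := (Real.sqrt_le_left hB).2 h

theorem l2norm_smul_const [NormedSpace ℝ F] (c : ℝ) (f : E d → F) :
    l2norm μ (fun x => c • f x) = |c| * l2norm μ f := by
  rw [l2norm, l2norm]
  simp only [norm_smul, mul_pow, Real.norm_eq_abs]
  rw [integral_const_mul, Real.sqrt_mul (sq_nonneg _), Real.sqrt_sq (abs_nonneg c)]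

theorem MemLp_two_mul {f g : E d → ℝ} (hf : MemLp f 2 μ) (hg : MemLp g 2 μ) :
    Integrable (fun x => f x * g x) μ := hf.integrable_mul hg

/-- The Cauchy–Schwarz inequality. -/
theorem abs_integral_inner_le [InnerProductSpace ℝ F] {f g : E d → F} (hf : MemLp f 2 μ)
    (hg : MemLp g 2 μ) : |∫ x, ⟪f x, g x⟫ ∂μ| ≤ l2norm μ f * l2norm μ g := by
  have h := abs_real_inner_le_norm (hf.toLp f) (hg.toLp g)
  have e : ∀ {f : E d → F} (hf : MemLp f 2 μ), ‖hf.toLp f‖ = l2norm μ f := by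
    intro f hf
    rw [l2norm, ← Real.sqrt_sq (norm_nonneg (hf.toLp f)), ← real_inner_self_eq_norm_sq, L2.inner_def]
    congr 1
    refine integral_congr_ae ?_
    filter_upwards [hf.coeFn_toLp] with x hx
    rw [hx, real_inner_self_eq_norm_sq]
  rw [e hf, e hg, L2.inner_def] at h
  convert h using 2
  refine integral_congr_ae ?_
  filter_upwards [hf.coeFn_toLp, hg.coeFn_toLp] with x hx hx'
  rw [hx, hx']

theorem abs_integral_mul_le {f g : E d → ℝ} (hf : MemLp f 2 μ) (hg : MemLp g 2 μ) :
    |∫ x, f x * g x ∂μ| ≤ l2norm μ f * l2norm μ g := by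
  have h := abs_integral_inner_le hg hf
  simp only [RCLike.inner_apply, conj_trivial] at h
  rw [mul_comm (l2norm μ f)]
  exact h

end L2

theorem l2Proj_ae_eq_isPoly {μ : Measure (E d)} (m : ℕ) {f : E d → ℝ} (hf : MemLp f 2 μ) :
    ∃ F : E d → ℝ, IsPoly m F ∧ l2Proj μ m f =ᵐ[μ] F := by
  have h := (polyL2 μ m).starProjection_apply_mem (hf.toLp f)
  obtain ⟨p, hp, he⟩ := h
  refine ⟨_, ⟨p, hp, fun _ => rfl⟩, ?_⟩
  rw [l2Proj, dif_pos hf]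
  exact he

/-! ### Finite element functions on an element -/

section Cell

variable {K : Finset (E d)} {uT P : E d → ℝ}

theorem IsSimplex.uniqueDiffOn (hK : IsSimplex K) : UniqueDiffOn ℝ (body K) :=
  uniqueDiffOn_convex (convex_body K) hK.interior_nonempty

theorem cellGrad_eq (hK : IsSimplex K) (hP : ContDiff ℝ ∞ P) (h : ∀ x ∈ body K, uT x = P x)
    {x : E d} (hx : x ∈ body K) : cellGrad uT K x = gradient P x := by
  rw [cellGrad, gradientWithin, gradient, fderivWithin_congr h (h x hx),
    (hP.differentiable (by simp) x).fderivWithin (hK.uniqueDiffOn x hx)]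

theorem gradient_eq_of_mem_interior (h : ∀ x ∈ body K, uT x = P x) {x : E d}
    (hx : x ∈ interior (body K)) : gradient uT x = gradient P x := by
  refine Filter.EventuallyEq.gradient_eq ?_
  filter_upwards [mem_interior_iff_mem_nhds.1 hx] with y hy
  exact h y hy

theorem flux_eq (hK : IsSimplex K) (hP : ContDiff ℝ ∞ P) (h : ∀ x ∈ body K, uT x = P x)
    (α : E d → ℝ) {x : E d} (hx : x ∈ body K) :
    flux α uT K x = -(cellValue α K • gradient P x) := by
  rw [flux, cellGrad_eq hK hP h hx]

theorem cellDiv_flux_eq (hK : IsSimplex K) (hP : ContDiff ℝ ∞ P) (h : ∀ x ∈ body K, uT x = P x)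
    (α : E d → ℝ) {x : E d} (hx : x ∈ body K) :
    cellDiv (flux α uT K) K x = -(cellValue α K * div (gradient P) x) := by
  have hg := ((gradient_contDiff hP).differentiable (by simp) x).hasFDerivAt
  have h1 : HasFDerivAt (fun x => -(cellValue α K • gradient P x))
      (-(cellValue α K • fderiv ℝ (gradient P) x)) x :=
    (hg.const_smul (cellValue α K)).neg
  rw [cellDiv, div, fderivWithin_congr (fun y hy => flux_eq hK hP h α hy) (flux_eq hK hP h α hx),
    h1.hasFDerivWithinAt.fderivWithin (hK.uniqueDiffOn x hx), Finset.mul_sum,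
    ← Finset.sum_neg_distrib]
  simp

/-- The element residual is a polynomial. -/
theorem residual_ae_eq {k : ℕ} (hK : IsSimplex K) (hP : IsPoly k P)
    (h : ∀ x ∈ body K, uT x = P x) (α : E d → ℝ) (a : E d → E d) (b : E d → ℝ) {f F : E d → ℝ}
    (hF : l2Proj (cellMeasure K) (k - 1) f =ᵐ[cellMeasure K] F) :
    residual k α a b f uT K =ᵐ[cellMeasure K] fun x =>
      F x - ⟪cellValue a K, gradient P x⟫ - cellValue b K * P x +
        cellValue α K * div (gradient P) x := by
  filter_upwards [hF, ae_restrict_mem (isClosed_body K).measurableSet] with x hx hxK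
  rw [residual, hx, cellGrad_eq hK hP.contDiff h hxK, cellDiv_flux_eq hK hP.contDiff h α hxK,
    h x hxK, sub_neg_eq_add]

theorem memLp_body {F : Type*} [NormedAddCommGroup F] {g : E d → F} (hg : Continuous g)
    (K : Finset (E d)) : MemLp g 2 (volume.restrict (body K)) := by
  have : IsFiniteMeasure (volume.restrict (body K)) :=
    ⟨by simpa using (isCompact_body K).measure_lt_top⟩
  obtain ⟨C, hC⟩ := (isCompact_body K).exists_bound_of_continuousOn hg.continuousOn
  refine MemLp.of_bound (hg.aestronglyMeasurable) C ?_
  filter_upwards [ae_restrict_mem (isClosed_body K).measurableSet] with x hx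
  exact hC x hx

/-- Elementwise integration by parts turns the equation into residual form; `B` is the boundary
term. -/
theorem cellBilin_sub_eq {k : ℕ} (hK : IsSimplex K) (hP : IsPoly k P)
    (h : ∀ x ∈ body K, uT x = P x) {α : E d → ℝ} {a : E d → E d} {b : E d → ℝ} {f : E d → ℝ}
    (hf : MemLp f 2 (cellMeasure K)) {V : E d → ℝ} (hV : ContDiff ℝ ∞ V) {B : ℝ}
    (hparts : ∫ x in body K, ⟪gradient P x, gradient V x⟫ =
      -(∫ x in body K, div (gradient P) x * V x) + B) :
    cellBilin (cellValue α K) (cellValue a K) (cellValue b K) K uT (gradient uT) V -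
      ∫ x in body K, f x * V x =
    -(∫ x in body K, residual k α a b f uT K x * V x) -
      (∫ x in body K, (f x - l2Proj (cellMeasure K) (k - 1) f x) * V x) + cellValue α K * B := by
  obtain ⟨F, hF, hFe⟩ := l2Proj_ae_eq_isPoly (k - 1) hf
  have hres := residual_ae_eq hK hP h α a b hFe
  have hV2 := memLp_body hV.continuous K
  have hint : ∀ {g : E d → ℝ}, Continuous g → IntegrableOn (fun x => g x * V x) (body K) :=
    fun hg => MemLp_two_mul (memLp_body hg K) hV2
  have c1 : Continuous fun x => ⟪cellValue a K, gradient P x⟫ := (hP.inner_gradient _).continuous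
  have c2 : Continuous (div (gradient P)) := hP.div_gradient.continuous
  -- On the boundary of `K` the two gradients may differ, but that boundary is a null set.
  have e0 : ∀ᵐ x ∂(volume.restrict (body K)), gradient uT x = gradient P x := by
    filter_upwards [Triangulation.ae_mem_interior K] with x hx
    exact gradient_eq_of_mem_interior h hx
  have e1 : ∫ x in body K, ⟪gradient uT x, gradient V x⟫ =
      ∫ x in body K, ⟪gradient P x, gradient V x⟫ := by
    refine integral_congr_ae ?_
    filter_upwards [e0] with x hx
    rw [hx]
  have e2 : ∫ x in body K, ⟪cellValue a K, gradient uT x⟫ * V x =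
      ∫ x in body K, ⟪cellValue a K, gradient P x⟫ * V x := by
    refine integral_congr_ae ?_
    filter_upwards [e0] with x hx
    rw [hx]
  have e3 : ∫ x in body K, uT x * V x = ∫ x in body K, P x * V x := by
    refine setIntegral_congr_fun (isClosed_body K).measurableSet fun x hx => ?_
    simp only [h x hx]
  have e4 : ∫ x in body K, residual k α a b f uT K x * V x =
      (∫ x in body K, F x * V x) - (∫ x in body K, ⟪cellValue a K, gradient P x⟫ * V x) -
        cellValue b K * (∫ x in body K, P x * V x) +
        cellValue α K * ∫ x in body K, div (gradient P) x * V x := by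
    have : (fun x => residual k α a b f uT K x * V x) =ᵐ[volume.restrict (body K)] fun x =>
        F x * V x - ⟪cellValue a K, gradient P x⟫ * V x - cellValue b K * (P x * V x) +
          cellValue α K * (div (gradient P) x * V x) := by
      filter_upwards [hres] with x hx
      rw [hx]
      ring
    rw [integral_congr_ae this, integral_add, integral_sub, integral_sub, integral_const_mul,
      integral_const_mul]
    · exact hint hF.continuous
    · exact hint c1
    · exact (hint hF.continuous).sub (hint c1)
    · exact (hint hP.continuous).const_mul _
    · exact ((hint hF.continuous).sub (hint c1)).sub ((hint hP.continuous).const_mul _)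
    · exact (hint c2).const_mul _
  have e5 : ∫ x in body K, (f x - l2Proj (cellMeasure K) (k - 1) f x) * V x =
      (∫ x in body K, f x * V x) - ∫ x in body K, F x * V x := by
    have hf' : MemLp f 2 (volume.restrict (body K)) := hf
    rw [← integral_sub (MemLp_two_mul hf' hV2) (hint hF.continuous)]
    refine integral_congr_ae ?_
    filter_upwards [hFe] with x hx
    rw [hx]
    ring
  rw [cellBilin, e1, e2, e3, e4, e5, hparts]
  ring

/-! ### Integration by parts over an element. -/

theorem div_smul {V : E d → ℝ} {F : E d → E d} (hV : Differentiable ℝ V) (hF : Differentiable ℝ F)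
    (x : E d) : div (fun x => V x • F x) x = ⟪F x, gradient V x⟫ + div F x * V x := by
  have h := (hV x).hasFDerivAt.smul (hF x).hasFDerivAt
  have e : ∀ i, fderiv ℝ (fun x => V x • F x) x (EuclideanSpace.single i 1) i =
      V x * fderiv ℝ F x (EuclideanSpace.single i 1) i + gradient V x i * F x i := by
    intro i
    have h' : fderiv ℝ (fun x => V x • F x) x = _ := h.fderiv
    rw [h', gradient_ofLp]
    simp
  rw [div, Finset.sum_congr rfl fun i _ => e i, Finset.sum_add_distrib, add_comm, div,
    Finset.sum_mul]
  congr 1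
  exact Finset.sum_congr rfl fun i _ => mul_comm _ _

theorem contDiff_smul_gradient {V : E d → ℝ} (hV : ContDiff ℝ ∞ V) (hP : ContDiff ℝ ∞ P) :
    ContDiff ℝ 1 fun x => V x • gradient P x :=
  (hV.smul (gradient_contDiff hP)).of_le (by simp)

theorem div_eq_zero_of_notMem_tsupport {V : E d → ℝ} {F : E d → E d} {x : E d}
    (hx : x ∉ tsupport V) : div (fun x => V x • F x) x = 0 := by
  have h : (fun x => V x • F x) =ᶠ[𝓝 x] fun _ => 0 := by
    filter_upwards [notMem_tsupport_iff_eventuallyEq.1 hx] with y hy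
    simp [hy]
  simp [div, h.fderiv_eq]

theorem integral_body_div {V : E d → ℝ} (hV : ContDiff ℝ ∞ V) (hP : IsPoly k P)
    (K : Finset (E d)) :
    ∫ x in body K, div (fun x => V x • gradient P x) x =
      (∫ x in body K, ⟪gradient P x, gradient V x⟫) + ∫ x in body K, div (gradient P) x * V x := by
  rw [← integral_add]
  · refine integral_congr_ae (.of_forall fun x => ?_)
    exact div_smul (hV.differentiable (by simp))
      ((gradient_contDiff hP.contDiff).differentiable (by simp)) x
  · exact MemLp_two_inner (memLp_body (continuous_gradient hP.contDiff) K)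
      (memLp_body (continuous_gradient hV) K)
  · exact (memLp_body hP.div_gradient.continuous K).integrable_mul (memLp_body hV.continuous K)

/-- The field `V ∇P` is compactly supported inside `K`, so its divergence integrates to zero. The
summand `0` is the boundary term, written to match `cellBilin_sub_eq`. -/
theorem integral_parts_interior {k : ℕ} {V : E d → ℝ} (hV : ContDiff ℝ ∞ V)
    (hVc : HasCompactSupport V) (hsupp : tsupport V ⊆ body K) (hP : IsPoly k P) :
    ∫ x in body K, ⟪gradient P x, gradient V x⟫ =
      -(∫ x in body K, div (gradient P) x * V x) + 0 := by
  have h := integral_div_eq_zero (contDiff_smul_gradient hV hP.contDiff)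
    (hVc.smul_right (f' := gradient P))
  rw [← setIntegral_eq_integral_of_forall_compl_eq_zero (s := body K) fun x hx =>
    div_eq_zero_of_notMem_tsupport fun h => hx (hsupp h), integral_body_div hV hP] at h
  linarith

end Cell

/-- An interior point can be moved a little along the outward normal without leaving `K`; from
height zero this would violate `inner_cell`. -/
theorem IsFacetAt.inner_neg {K e : Finset (E d)} {δ : ℝ} (h : IsFacetAt K e δ) {y : E d}
    (hy : y ∈ interior (body K)) : ⟪outwardNormal K e, y - barycenter e⟫ < 0 := by
  refine lt_of_le_of_ne (h.inner_cell y (interior_subset hy)) fun h0 => ?_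
  let c : ℝ → E d := fun t => y + t • outwardNormal K e
  have hc : Tendsto c (𝓝[>] 0) (𝓝 y) := by
    have : ContinuousAt c 0 := by fun_prop
    have h2 := this.tendsto
    simp only [c, zero_smul, add_zero] at h2
    exact h2.mono_left nhdsWithin_le_nhds
  obtain ⟨t, ht, ht0⟩ := ((hc.eventually (mem_interior_iff_mem_nhds.1 hy)).and
    self_mem_nhdsWithin).exists
  have ht0 : 0 < t := ht0
  have h1 := h.inner_cell _ ht
  rw [show c t - barycenter e = (y - barycenter e) + t • outwardNormal K e by
    simp only [c]; abel, inner_add_right, h0, inner_smul_right, real_inner_self_eq_norm_sq,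
    h.norm_normal] at h1
  linarith

/-- On the support of `V` the element agrees with a half-space up to a null set, and the points of
the bounding plane belong to `e`. The divergence theorem on the half-space thus does the work of one
on the simplex, with no other facet contributing. -/
theorem integral_parts_facet {m k : ℕ} {K e : Finset (E (m + 1))} {δ : ℝ} (h : IsFacetAt K e δ)
    {V P : E (m + 1) → ℝ} (hV : ContDiff ℝ ∞ V) (hVc : HasCompactSupport V)
    (hsupp : tsupport V ⊆ Metric.ball (barycenter e) δ) (hP : IsPoly k P) :
    ∫ x in body K, ⟪gradient P x, gradient V x⟫ =
      -(∫ x in body K, div (gradient P) x * V x) +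
        ∫ x in body e, ⟪outwardNormal K e, gradient P x⟫ * V x ∂(surf (m + 1)) := by
  have h1 := integral_halfSpace_div h.norm_normal (barycenter e)
    (contDiff_smul_gradient hV hP.contDiff) (hVc.smul_right (f' := gradient P))
  have hsub : body e ⊆ range (planeChart h.norm_normal (barycenter e)) := fun y hy =>
    (mem_range_planeChart _ _ _).2 (h.inner_facet y hy)
  have h2 : ∫ x in body e, ⟪outwardNormal K e, gradient P x⟫ * V x ∂(surf (m + 1)) =
      ∫ y, ⟪outwardNormal K e, V (planeChart h.norm_normal (barycenter e) y) •
        gradient P (planeChart h.norm_normal (barycenter e) y)⟫ := by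
    rw [setIntegral_surf h.norm_normal (barycenter e) hsub,
      setIntegral_eq_integral_of_forall_compl_eq_zero]
    · congr 1
      ext y
      rw [inner_smul_right, mul_comm]
    · intro y hy
      have : V (planeChart h.norm_normal (barycenter e) y) = 0 := by
        by_contra hne
        refine hy (h.mem_facet _ (hsupp (subset_tsupport V hne)) ?_).1
        exact (mem_range_planeChart h.norm_normal _ _).1 ⟨y, rfl⟩
      rw [this, mul_zero]
  have h3 : ∫ x in body K, div (fun x => V x • gradient P x) x =
      ∫ x in halfSpace (outwardNormal K e) (barycenter e),
        div (fun x => V x • gradient P x) x := by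
    rw [← integral_indicator (isClosed_body K).measurableSet,
      ← integral_indicator (isOpen_halfSpace _ _).measurableSet]
    have hae := Triangulation.ae_mem_interior K
    rw [ae_restrict_iff' (isClosed_body K).measurableSet] at hae
    refine integral_congr_ae ?_
    filter_upwards [hae] with x hx
    by_cases hxV : x ∈ tsupport V
    · have hiff : x ∈ body K ↔ x ∈ halfSpace (outwardNormal K e) (barycenter e) :=
        ⟨fun hxK => h.inner_neg (hx hxK),
          fun hxh => interior_subset (h.mem_interior x (hsupp hxV) hxh)⟩
      by_cases hxK : x ∈ body K
      · rw [indicator_of_mem hxK, indicator_of_mem (hiff.1 hxK)]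
      · rw [indicator_of_notMem hxK, indicator_of_notMem (mt hiff.2 hxK)]
    · have h0 := div_eq_zero_of_notMem_tsupport (F := gradient P) hxV
      rw [indicator_apply_eq_zero.2 fun _ => h0, indicator_apply_eq_zero.2 fun _ => h0]
  rw [integral_body_div hV hP, h1, ← h2] at h3
  linarith

/-! ### Continuity of the bilinear form in the energy norm -/

theorem energyNorm_nonneg (α : E d → ℝ) (β : ℝ) (S : Set (E d)) (w : E d → ℝ) (Dw : E d → E d) :
    0 ≤ energyNorm α β S w Dw := Real.sqrt_nonneg _

theorem sqrt_mul_l2norm_le_energyNorm {Ω : Set (E d)} {T : Triangulation Ω} {α : E d → ℝ}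
    (hα : IsCellwiseConstant T α) {β : ℝ} (hβ : 0 ≤ β) {K : Finset (E d)} (hK : K ∈ T.cells)
    (w : E d → ℝ) (Dw : E d → E d) :
    √(cellValue α K) * l2norm (volume.restrict (body K)) Dw ≤ energyNorm α β (body K) w Dw ∧
      √β * l2norm (volume.restrict (body K)) w ≤ energyNorm α β (body K) w Dw := by
  have e : l2norm (volume.restrict (body K)) (fun x => √(α x) • Dw x) =
      √(cellValue α K) * l2norm (volume.restrict (body K)) Dw := by
    rw [← abs_of_nonneg (Real.sqrt_nonneg (cellValue α K)), ← l2norm_smul_const]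
    refine l2norm_congr ?_
    filter_upwards [Triangulation.ae_eq_cellValue hα hK] with x hx
    rw [hx]
  rw [energyNorm, e]
  constructor
  · refine Real.le_sqrt_of_sq_le ?_
    nlinarith [mul_nonneg hβ (sq_nonneg (l2norm (volume.restrict (body K)) w))]
  · refine Real.le_sqrt_of_sq_le ?_
    rw [mul_pow, Real.sq_sqrt hβ]
    nlinarith [sq_nonneg (√(cellValue α K) * l2norm (volume.restrict (body K)) Dw)]

/-- In each term the coefficient is split so that one part forms an energy quantity of `w` and the
other contributes `√α`. For diffusion and convection, `α = √α √α`; for reaction, the geometric mean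
of the two bounds on `|b|` produces `√α √β`, and `√β` goes with the `L²` norm of `w`. -/
theorem abs_cellBilin_le {K : Finset (E d)} {α : ℝ} {a : E d} {b β Cb cb : ℝ} (hα : 0 < α)
    (hCb : 0 ≤ Cb) (hcb : 0 ≤ cb) (ha : ‖a‖ ≤ Cb * α) (hb : |b| ≤ Cb * α)
    (hb' : |b| ≤ cb * β) {w : E d → ℝ} {Dw : E d → E d}
    (hw : MemLp w 2 (volume.restrict (body K))) (hDw : MemLp Dw 2 (volume.restrict (body K)))
    {V : E d → ℝ} (hV : ContDiff ℝ ∞ V) {En : ℝ}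
    (h1 : √α * l2norm (volume.restrict (body K)) Dw ≤ En)
    (h2 : √β * l2norm (volume.restrict (body K)) w ≤ En) :
    |cellBilin α a b K w Dw V| ≤ En * √α *
      (l2norm (volume.restrict (body K)) (gradient V) +
        (Cb + √(Cb * cb)) * l2norm (volume.restrict (body K)) V) := by
  set μ := volume.restrict (body K) with hμ
  have hV2 : MemLp V 2 μ := memLp_body hV.continuous K
  have hG2 : MemLp (gradient V) 2 μ := memLp_body (continuous_gradient hV) K
  set A := l2norm μ Dw with hA
  set B := l2norm μ w
  set G := l2norm μ (gradient V)
  set N := l2norm μ V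
  have hA0 : 0 ≤ A := l2norm_nonneg _ _
  have hB0 : 0 ≤ B := l2norm_nonneg _ _
  have hG0 : 0 ≤ G := l2norm_nonneg _ _
  have hN0 : 0 ≤ N := l2norm_nonneg _ _
  have hsα := Real.sqrt_nonneg α
  have hss : √α * √α = α := Real.mul_self_sqrt hα.le
  have t1 : |α * ∫ x in body K, ⟪Dw x, gradient V x⟫| ≤ En * √α * G := by
    rw [abs_mul, abs_of_pos hα]
    have := abs_integral_inner_le hDw hG2
    calc α * |∫ x in body K, ⟪Dw x, gradient V x⟫| ≤ α * (A * G) := by gcongr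
      _ = (√α * √α) * (A * G) := by rw [hss]
      _ = (√α * A) * (√α * G) := by ring
      _ ≤ En * (√α * G) := by gcongr
      _ = _ := by ring
  have t2 : |∫ x in body K, ⟪a, Dw x⟫ * V x| ≤ En * √α * (Cb * N) := by
    have hi : MemLp (fun x => ⟪a, Dw x⟫) 2 μ := hDw.const_inner (𝕜 := ℝ) a
    have := abs_integral_mul_le hi hV2
    have h3 : l2norm μ (fun x => ⟪a, Dw x⟫) ≤ ‖a‖ * A := by
      refine l2norm_le (by positivity) ?_
      rw [mul_pow, hA, sq_l2norm, ← integral_const_mul]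
      refine integral_mono_of_nonneg (.of_forall fun x => sq_nonneg _)
        ((hDw.integrable_norm_pow (by simp)).const_mul _) (.of_forall fun x => ?_)
      simp only
      rw [← mul_pow]
      exact pow_le_pow_left₀ (norm_nonneg _) (norm_inner_le_norm _ _) 2
    calc |∫ x in body K, ⟪a, Dw x⟫ * V x| ≤ ‖a‖ * A * N := this.trans (by gcongr)
      _ ≤ Cb * α * A * N := by gcongr
      _ = (√α * A) * √α * (Cb * N) := by
          calc Cb * α * A * N = Cb * (√α * √α) * A * N := by rw [hss]
            _ = _ := by ring
      _ ≤ En * √α * (Cb * N) := by gcongr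
  have t3 : |b * ∫ x in body K, w x * V x| ≤ En * √α * (√(Cb * cb) * N) := by
    rw [abs_mul]
    have := abs_integral_mul_le hw hV2
    have h3 : |b| ≤ √(Cb * cb) * √α * √β := by
      rw [← Real.sqrt_mul (by positivity), ← Real.sqrt_mul (by positivity)]
      refine Real.le_sqrt_of_sq_le ?_
      calc |b| ^ 2 = |b| * |b| := sq _
        _ ≤ (Cb * α) * (cb * β) := by gcongr
        _ = _ := by ring
    calc |b| * |∫ x in body K, w x * V x| ≤ (√(Cb * cb) * √α * √β) * (B * N) := by gcongr
      _ = (√β * B) * √α * (√(Cb * cb) * N) := by ring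
      _ ≤ En * √α * (√(Cb * cb) * N) := by gcongr
  calc |cellBilin α a b K w Dw V| ≤ En * √α * G + En * √α * (Cb * N) +
        En * √α * (√(Cb * cb) * N) :=
        (abs_add_le _ _).trans (add_le_add ((abs_add_le _ _).trans (add_le_add t1 t2)) t3)
    _ = _ := by ring

theorem cellBilin_sub {K : Finset (E d)} (α : ℝ) (a : E d) (b : ℝ) {w w' : E d → ℝ}
    {Dw Dw' : E d → E d} (hw : MemLp w 2 (volume.restrict (body K)))
    (hw' : MemLp w' 2 (volume.restrict (body K)))
    (hDw : MemLp Dw 2 (volume.restrict (body K))) (hDw' : MemLp Dw' 2 (volume.restrict (body K)))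
    {V : E d → ℝ} (hV : ContDiff ℝ ∞ V) :
    cellBilin α a b K (fun x => w x - w' x) (fun x => Dw x - Dw' x) V =
      cellBilin α a b K w Dw V - cellBilin α a b K w' Dw' V := by
  have hV2 := memLp_body hV.continuous K
  have hG2 := memLp_body (continuous_gradient hV) K
  simp only [cellBilin, inner_sub_left, inner_sub_right, sub_mul]
  rw [integral_sub (MemLp_two_inner hDw hG2) (MemLp_two_inner hDw' hG2),
    integral_sub (MemLp_two_mul hw hV2) (MemLp_two_mul hw' hV2),
    integral_sub (MemLp_two_mul (hDw.const_inner (𝕜 := ℝ) a) hV2)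
      (MemLp_two_mul (hDw'.const_inner (𝕜 := ℝ) a) hV2)]
  ring

end

section

/-! ### Bubble functions -/

/-- The volume of the unit ball. -/
def ballVolume (n : ℕ) : ℝ := volume.real (Metric.ball (0 : E n) 1)

theorem ballVolume_nonneg (n : ℕ) : 0 ≤ ballVolume n := measureReal_nonneg

theorem volume_real_closedBall {n : ℕ} (c : E n) {R : ℝ} (hR : 0 ≤ R) :
    volume.real (Metric.closedBall c R) = R ^ n * ballVolume n := by
  rw [Measure.addHaar_real_closedBall _ c hR, finrank_euclideanSpace_fin, ballVolume]

theorem setIntegral_le_of_subset_closedBall {n : ℕ} {g : E n → ℝ} {M R : ℝ} {c : E n} {S : Set (E n)}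
    (hR : 0 ≤ R) (hM : 0 ≤ M) (hS : S ⊆ Metric.closedBall c R)
    (h : ∀ x ∈ S, |g x| ≤ M) : ∫ x in S, g x ≤ M * (R ^ n * ballVolume n) := by
  have hfin : volume S < ⊤ :=
    (measure_mono hS).trans_lt (isCompact_closedBall c R).measure_lt_top
  have h1 := norm_setIntegral_le_of_norm_le_const (f := g) hfin h
  refine (le_abs_self _).trans (h1.trans ?_)
  rw [← volume_real_closedBall c hR]
  exact mul_le_mul_of_nonneg_left
    (measureReal_mono hS (isCompact_closedBall c R).measure_lt_top.ne) hM

theorem setIntegral_sq_le {n : ℕ} {F : Type*} [NormedAddCommGroup F] {g : E n → F} {M R : ℝ}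
    {c : E n} (hg : Continuous g) (hgs : tsupport g ⊆ Metric.closedBall c R) (hR : 0 ≤ R)
    (hM : 0 ≤ M) (h : ∀ x, ‖g x‖ ^ 2 ≤ M) (S : Set (E n)) :
    ∫ x in S, ‖g x‖ ^ 2 ≤ M * (R ^ n * ballVolume n) := by
  have hc : HasCompactSupport g :=
    (isCompact_closedBall c R).of_isClosed_subset (isClosed_tsupport g) hgs
  have hi : Integrable fun x => ‖g x‖ ^ 2 :=
    (hg.memLp_of_hasCompactSupport (p := 2) hc).integrable_norm_pow (by simp)
  have h1 : ∫ x in S, ‖g x‖ ^ 2 ≤ ∫ x, ‖g x‖ ^ 2 :=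
    setIntegral_le_integral hi (.of_forall fun x => sq_nonneg _)
  have h2 : ∫ x in Metric.closedBall c R, ‖g x‖ ^ 2 = ∫ x, ‖g x‖ ^ 2 :=
    setIntegral_eq_integral_of_forall_compl_eq_zero fun x hx => by
      rw [image_eq_zero_of_notMem_tsupport fun h => hx (hgs h)]
      simp
  refine h1.trans (h2.ge.trans ?_)
  refine (setIntegral_le_of_subset_closedBall hR hM Subset.rfl fun x _ => ?_)
  rw [abs_of_nonneg (sq_nonneg _)]
  exact h x

theorem gradient_mul {n : ℕ} {φ q : E n → ℝ} (hφ : Differentiable ℝ φ) (hq : Differentiable ℝ q)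
    (x : E n) : gradient (fun x => φ x * q x) x = φ x • gradient q x + q x • gradient φ x := by
  have h := (hφ x).hasFDerivAt.mul (hq x).hasFDerivAt
  have h' : fderiv ℝ (fun x => φ x * q x) x = _ := h.fderiv
  rw [gradient, h', map_add, map_smul, map_smul]
  rfl

theorem norm_gradient {n : ℕ} (f : E n → ℝ) (x : E n) : ‖gradient f x‖ = ‖fderiv ℝ f x‖ := by
  rw [gradient, LinearIsometryEquiv.norm_map]

/-- Bounds for the product of a bump function with a smooth function that is under control on the
support of the bump. -/
theorem exists_bump_mul (n : ℕ) : ∃ C : ℝ, 0 ≤ C ∧ ∀ (c : E n) (s : ℝ), 0 < s →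
    ∃ φ : E n → ℝ, ContDiff ℝ ∞ φ ∧ (∀ x, 0 ≤ φ x) ∧ (∀ x, φ x ≤ 1) ∧
      (∀ x ∈ Metric.closedBall c s, φ x = 1) ∧ tsupport φ ⊆ Metric.closedBall c (2 * s) ∧
      ∀ (q : E n → ℝ) (M : ℝ), ContDiff ℝ ∞ q → 0 ≤ M →
        (∀ x ∈ Metric.closedBall c (2 * s), q x ^ 2 ≤ M ∧ s ^ 2 * ‖gradient q x‖ ^ 2 ≤ M) →
        ∀ S : Set (E n), ∫ x in S, ‖φ x * q x‖ ^ 2 ≤ C * s ^ n * M ∧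
          s ^ 2 * ∫ x in S, ‖gradient (fun x => φ x * q x) x‖ ^ 2 ≤ C * s ^ n * M := by
  obtain ⟨C₀, hC₀, h⟩ := exists_bump n
  have hω := ballVolume_nonneg n
  -- The first factor comes from the product rule and `(x + y)² ≤ 2x² + 2y²`, the second from the
  -- volume of the supporting ball of radius `2s`.
  refine ⟨(2 + 2 * C₀ ^ 2) * (2 ^ n * ballVolume n), by positivity, fun c s hs => ?_⟩
  obtain ⟨φ, hφ, hφ0, hφ1, hφe, hφs, hφg⟩ := h c s hs
  refine ⟨φ, hφ, hφ0, hφ1, hφe, hφs, fun q M hq hM hqM S => ?_⟩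
  have hs1 : tsupport (fun x => φ x * q x) ⊆ Metric.closedBall c (2 * s) :=
    (tsupport_mul_subset_left).trans hφs
  have hs2 : tsupport (gradient fun x => φ x * q x) ⊆ Metric.closedBall c (2 * s) := by
    refine Subset.trans ?_ hs1
    refine closure_minimal (fun x hx => ?_) (isClosed_tsupport _)
    by_contra h
    exact hx (gradient_eq_zero_of_notMem_tsupport h)
  have hV : ContDiff ℝ ∞ fun x => φ x * q x := hφ.mul hq
  have b1 : ∀ x, ‖φ x * q x‖ ^ 2 ≤ M := by
    intro x
    by_cases hx : x ∈ Metric.closedBall c (2 * s)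
    · have h1 := (hqM x hx).1
      have h2 : φ x ^ 2 ≤ 1 := pow_le_one₀ (hφ0 x) (hφ1 x)
      rw [Real.norm_eq_abs, sq_abs, mul_pow]
      nlinarith [sq_nonneg (q x)]
    · rw [image_eq_zero_of_notMem_tsupport (f := φ) fun h => hx (hφs h)]
      simpa using hM
  have b2 : ∀ x, ‖gradient (fun x => φ x * q x) x‖ ^ 2 ≤ (2 + 2 * C₀ ^ 2) * M / s ^ 2 := by
    intro x
    by_cases hx : x ∈ Metric.closedBall c (2 * s)
    · obtain ⟨h1, h2⟩ := hqM x hx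
      rw [le_div_iff₀ (by positivity), gradient_mul (hφ.differentiable (by simp))
        (hq.differentiable (by simp))]
      have t : ‖φ x • gradient q x + q x • gradient φ x‖ ≤
          ‖gradient q x‖ + |q x| * ‖gradient φ x‖ := by
        refine (norm_add_le _ _).trans ?_
        rw [norm_smul, norm_smul, Real.norm_eq_abs, Real.norm_eq_abs, abs_of_nonneg (hφ0 x)]
        nlinarith [norm_nonneg (gradient q x), hφ1 x]
      have t2 : s * ‖φ x • gradient q x + q x • gradient φ x‖ ≤
          s * ‖gradient q x‖ + |q x| * C₀ := by
        have := mul_le_mul_of_nonneg_left (hφg x) (abs_nonneg (q x))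
        nlinarith
      have t3 := pow_le_pow_left₀ (by positivity) t2 2
      have t4 : (s * ‖gradient q x‖ + |q x| * C₀) ^ 2 ≤
          2 * (s ^ 2 * ‖gradient q x‖ ^ 2) + 2 * (q x ^ 2 * C₀ ^ 2) := by
        rw [← sq_abs (q x)]
        nlinarith [sq_nonneg (s * ‖gradient q x‖ - |q x| * C₀)]
      have t5 : q x ^ 2 * C₀ ^ 2 ≤ M * C₀ ^ 2 := by gcongr
      rw [mul_pow] at t3
      nlinarith
    · rw [gradient_eq_zero_of_notMem_tsupport fun h => hx (hs1 h)]
      simp only [norm_zero, ne_eq, OfNat.ofNat_ne_zero, not_false_eq_true, zero_pow]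
      positivity
  have i1 := setIntegral_sq_le (hV.continuous) hs1 (by positivity) hM b1 S
  have i2 := setIntegral_sq_le (continuous_gradient hV) hs2 (by positivity) (by positivity) b2 S
  have e : (2 * s) ^ n = 2 ^ n * s ^ n := mul_pow _ _ _
  rw [e] at i1 i2
  have hX : 0 ≤ 2 ^ n * s ^ n * ballVolume n := by positivity
  constructor
  · refine i1.trans ?_
    have : M * (2 ^ n * s ^ n * ballVolume n) ≤
        (2 + 2 * C₀ ^ 2) * (M * (2 ^ n * s ^ n * ballVolume n)) := by
      refine le_mul_of_one_le_left (by positivity) ?_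
      nlinarith [sq_nonneg C₀]
    refine this.trans (le_of_eq ?_)
    ring
  · refine (mul_le_mul_of_nonneg_left i2 (by positivity)).trans (le_of_eq ?_)
    field_simp

theorem setIntegral_mono_ball {n : ℕ} {f g : E n → ℝ} {c : E n} {r R : ℝ}
    {S : Set (E n)} (hS : MeasurableSet S) (hSR : S ⊆ Metric.closedBall c R)
    (hr : Metric.ball c r ⊆ S) (hg : Continuous g) (hg0 : ∀ x ∈ S, 0 ≤ g x)
    (he : ∀ x ∈ Metric.ball c r, f x = g x) : ∫ x in Metric.ball c r, f x ≤ ∫ x in S, g x := by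
  rw [setIntegral_congr_fun measurableSet_ball he]
  refine setIntegral_mono_set ?_ ?_ (LE.le.eventuallyLE hr)
  · exact (hg.continuousOn.integrableOn_compact (isCompact_closedBall c R)).mono_set hSR
  · filter_upwards [ae_restrict_mem hS] with x hx
    exact hg0 x hx

/-- Bubble functions on elements. -/
theorem exists_cell_bubble (n k : ℕ) {κ : ℝ} (hκ : 0 < κ) (hκ1 : κ ≤ 1) :
    ∃ C : ℝ, 1 ≤ C ∧ ∀ R : E n → ℝ, IsPoly k R → ∀ (x : E n) (h : ℝ), 0 < h →
      ∀ S : Set (E n), MeasurableSet S → S ⊆ Metric.closedBall x h →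
      Metric.closedBall x (κ * h) ⊆ S →
      ∃ (V : E n → ℝ) (N : ℝ), ContDiff ℝ ∞ V ∧ tsupport V ⊆ Metric.closedBall x (κ * h / 2) ∧
        0 ≤ N ∧ N ^ 2 ≤ ∫ y in S, R y * V y ∧ l2norm (volume.restrict S) R ≤ C * N ∧
        l2norm (volume.restrict S) V ≤ C * N ∧
        h * l2norm (volume.restrict S) (gradient V) ≤ C * N := by
  have hθ : 0 < κ / 4 := by positivity
  obtain ⟨C₁, hC₁, h₁⟩ := inverse_estimate n k hθ
  obtain ⟨C₂, hC₂, h₂⟩ := exists_bump_mul n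
  have hω := ballVolume_nonneg n
  set θ := κ / 4 with hθdef
  have hθ1 : θ ≤ 1 := by rw [hθdef]; linarith
  -- One summand for each of the three norms to be bounded, and `1` to ensure `C ≤ C ^ 2`, so that
  -- bounds on squared norms by `C * I` become bounds on the norms by `C * √I`.
  set C := 1 + C₁ * ballVolume n + C₂ * C₁ + C₂ * C₁ / θ ^ 2 with hC
  have p1 : 0 ≤ C₁ * ballVolume n := by positivity
  have p2 : 0 ≤ C₂ * C₁ := by positivity
  have p3 : 0 ≤ C₂ * C₁ / θ ^ 2 := by positivity
  have hC1 : 1 ≤ C := by linarith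
  refine ⟨C, hC1, fun R hR x h hh S hS hSh hSκ => ?_⟩
  have hCC : C ≤ C ^ 2 := by nlinarith
  have hs : 0 < h * θ := by positivity
  obtain ⟨φ, hφ, hφ0, hφ1, hφe, hφs, hφb⟩ := h₂ x (h * θ) hs
  set I := ∫ y in Metric.ball x (h * θ), R y ^ 2 with hI
  have hI0 : 0 ≤ I := integral_nonneg fun _ => sq_nonneg _
  have hN : √I ^ 2 = I := Real.sq_sqrt hI0
  have h2s : 2 * (h * θ) = κ * h / 2 := by rw [hθdef]; ring
  have hsub2 : Metric.closedBall x (2 * (h * θ)) ⊆ Metric.closedBall x h := by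
    refine Metric.closedBall_subset_closedBall ?_
    rw [h2s]
    nlinarith
  have hpow : (h * θ) ^ n ≤ h ^ n := pow_le_pow_left₀ hs.le (by nlinarith) n
  have hhn : 0 < h ^ n := by positivity
  set M := C₁ * I / h ^ n with hM
  have hM0 : 0 ≤ M := by positivity
  have hMh : h ^ n * M = C₁ * I := by rw [hM]; field_simp
  have hb1 : ∀ y ∈ Metric.closedBall x h, R y ^ 2 ≤ M := by
    intro y hy
    rw [hM, le_div_iff₀ hhn, mul_comm]
    exact (h₁ R hR x h hh y hy).1
  have hb2 : ∀ y ∈ Metric.closedBall x h, h ^ 2 * ‖gradient R y‖ ^ 2 ≤ M := by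
    intro y hy
    rw [hM, le_div_iff₀ hhn, mul_comm]
    exact (h₁ R hR x h hh y hy).2
  have hb3 : ∀ y ∈ Metric.closedBall x h, (h * θ) ^ 2 * ‖gradient R y‖ ^ 2 ≤ M := by
    intro y hy
    refine le_trans ?_ (hb2 y hy)
    have : (h * θ) ^ 2 ≤ h ^ 2 := pow_le_pow_left₀ hs.le (by nlinarith) 2
    gcongr
  obtain ⟨i1, i2⟩ := hφb R M hR.contDiff hM0
    (fun y hy => ⟨hb1 y (hsub2 hy), hb3 y (hsub2 hy)⟩) S
  have hle : C₂ * (h * θ) ^ n * M ≤ C₂ * C₁ * I := by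
    calc C₂ * (h * θ) ^ n * M ≤ C₂ * h ^ n * M := by gcongr
      _ = C₂ * (h ^ n * M) := by ring
      _ = C₂ * C₁ * I := by rw [hMh]; ring
  have hfin : ∀ {c : ℝ}, c ≤ C → c * I ≤ (C * √I) ^ 2 := by
    intro c hc
    rw [mul_pow, hN]
    exact mul_le_mul_of_nonneg_right (hc.trans hCC) hI0
  -- `N` is the norm of `R` on the ball where `φ = 1`. The test integral dominates `N ^ 2` since its
  -- integrand is nonnegative elsewhere, and the inverse estimate recovers the norms over all of `S`
  -- from `N`.
  refine ⟨fun y => φ y * R y, √I, hφ.mul hR.contDiff,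
    (tsupport_mul_subset_left).trans (h2s ▸ hφs), Real.sqrt_nonneg _, ?_, ?_, ?_, ?_⟩
  · rw [hN, hI]
    refine setIntegral_mono_ball hS hSh ?_ (hR.continuous.mul (hφ.continuous.mul hR.continuous))
      (fun y _ => ?_) fun y hy => ?_
    · refine Metric.ball_subset_closedBall.trans (Subset.trans ?_ hSκ)
      refine Metric.closedBall_subset_closedBall ?_
      rw [hθdef]
      nlinarith
    · nlinarith [hφ0 y, mul_nonneg (hφ0 y) (sq_nonneg (R y))]
    · change R y ^ 2 = R y * (φ y * R y)
      rw [hφe y (Metric.ball_subset_closedBall hy)]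
      ring
  · refine l2norm_le (by positivity) (le_trans ?_ (hfin (c := C₁ * ballVolume n) (by linarith)))
    refine (setIntegral_le_of_subset_closedBall hh.le hM0 hSh fun y hy => ?_).trans (le_of_eq ?_)
    · rw [abs_of_nonneg (sq_nonneg _), Real.norm_eq_abs, sq_abs]
      exact hb1 y (hSh hy)
    · calc M * (h ^ n * ballVolume n) = (h ^ n * M) * ballVolume n := by ring
        _ = C₁ * ballVolume n * I := by rw [hMh]; ring
  · exact l2norm_le (by positivity) ((i1.trans hle).trans (hfin (by linarith)))
  · have h3 : l2norm (volume.restrict S) (gradient fun y => φ y * R y) ≤ C * √I / h := by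
      refine l2norm_le (by positivity) ?_
      rw [div_pow, le_div_iff₀ (by positivity)]
      refine le_trans ?_ (hfin (c := C₂ * C₁ / θ ^ 2) (by linarith))
      have := i2.trans hle
      rw [div_mul_eq_mul_div, le_div_iff₀ (by positivity)]
      refine le_trans (le_of_eq ?_) this
      ring
    rwa [le_div_iff₀ hh, mul_comm] at h3

theorem gradient_comp_cotangent_le {m : ℕ} {n : E (m + 1)} (hn : ‖n‖ = 1) (x₀ : E (m + 1))
    {Q : E m → ℝ} (hQ : Differentiable ℝ Q) (x : E (m + 1)) :
    ‖gradient (fun x => Q (cotangent hn (x - x₀))) x‖ ≤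
      ‖gradient Q (cotangent hn (x - x₀))‖ := by
  have h1 : HasFDerivAt (fun x => cotangent hn (x - x₀)) (cotangent hn) x := by
    have := (cotangent hn).hasFDerivAt (x := x - x₀)
    exact this.comp x ((hasFDerivAt_id x).sub_const x₀)
  have h2 : HasFDerivAt (fun x => Q (cotangent hn (x - x₀))) _ x :=
    (hQ (cotangent hn (x - x₀))).hasFDerivAt.comp x h1
  rw [norm_gradient, norm_gradient, h2.fderiv]
  refine ContinuousLinearMap.opNorm_le_bound _ (norm_nonneg _) fun v => ?_
  exact ((fderiv ℝ Q (cotangent hn (x - x₀))).le_opNorm (cotangent hn v)).trans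
    (mul_le_mul_of_nonneg_left (norm_cotangent_le hn v) (norm_nonneg _))

/-- Bubble functions on facets. -/
theorem exists_facet_bubble (m k : ℕ) {κ : ℝ} (hκ : 0 < κ) (hκ1 : κ ≤ 1) :
    ∃ C : ℝ, 1 ≤ C ∧ ∀ Q : E m → ℝ, IsPoly k Q → ∀ (n : E (m + 1)) (hn : ‖n‖ = 1) (x₀ : E (m + 1))
      (h : ℝ), 0 < h → ∀ S' : Set (E m), MeasurableSet S' → S' ⊆ Metric.closedBall 0 h →
      Metric.ball 0 (κ * h) ⊆ S' →
      ∃ (V : E (m + 1) → ℝ) (N : ℝ), ContDiff ℝ ∞ V ∧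
        tsupport V ⊆ Metric.closedBall x₀ (κ * h / 2) ∧
        0 ≤ N ∧ N ^ 2 ≤ ∫ y in S', Q y * V (planeChart hn x₀ y) ∧
        ∫ y in S', Q y ^ 2 ≤ (C * N) ^ 2 ∧
        ∫ y in S', V (planeChart hn x₀ y) ^ 2 ≤ (C * N) ^ 2 ∧
        (∀ S, l2norm (volume.restrict S) V ≤ C * √h * N) ∧
        ∀ S, √h * l2norm (volume.restrict S) (gradient V) ≤ C * N := by
  have hθ : 0 < κ / 4 := by positivity
  obtain ⟨C₁, hC₁, h₁⟩ := inverse_estimate m k hθ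
  obtain ⟨C₂, hC₂, h₂⟩ := exists_bump_mul (m + 1)
  have hω := ballVolume_nonneg m
  set θ := κ / 4 with hθdef
  have hθ1 : θ ≤ 1 := by rw [hθdef]; linarith
  set C := 1 + C₁ * ballVolume m + C₂ * C₁ + C₂ * C₁ / θ ^ 2 with hC
  have p1 : 0 ≤ C₁ * ballVolume m := by positivity
  have p2 : 0 ≤ C₂ * C₁ := by positivity
  have p3 : 0 ≤ C₂ * C₁ / θ ^ 2 := by positivity
  have hC1 : 1 ≤ C := by linarith
  refine ⟨C, hC1, fun Q hQ n hn x₀ h hh S' hS' hSh hSκ => ?_⟩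
  have hCC : C ≤ C ^ 2 := by nlinarith
  have hs : 0 < h * θ := by positivity
  obtain ⟨φ, hφ, hφ0, hφ1, hφe, hφs, hφb⟩ := h₂ x₀ (h * θ) hs
  set I := ∫ y in Metric.ball (0 : E m) (h * θ), Q y ^ 2 with hI
  have hI0 : 0 ≤ I := integral_nonneg fun _ => sq_nonneg _
  have hN : √I ^ 2 = I := Real.sq_sqrt hI0
  have h2s : 2 * (h * θ) = κ * h / 2 := by rw [hθdef]; ring
  have hpow : (h * θ) ^ (m + 1) ≤ h ^ (m + 1) := pow_le_pow_left₀ hs.le (by nlinarith) _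
  have hhn : 0 < h ^ m := by positivity
  set M := C₁ * I / h ^ m with hM
  have hM0 : 0 ≤ M := by positivity
  have hMh : h ^ m * M = C₁ * I := by rw [hM]; field_simp
  have hb1 : ∀ y ∈ Metric.closedBall (0 : E m) h, Q y ^ 2 ≤ M := by
    intro y hy
    rw [hM, le_div_iff₀ hhn, mul_comm]
    exact (h₁ Q hQ 0 h hh y hy).1
  have hb3 : ∀ y ∈ Metric.closedBall (0 : E m) h, (h * θ) ^ 2 * ‖gradient Q y‖ ^ 2 ≤ M := by
    intro y hy
    have h3 : h ^ 2 * ‖gradient Q y‖ ^ 2 ≤ M := by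
      rw [hM, le_div_iff₀ hhn, mul_comm]
      exact (h₁ Q hQ 0 h hh y hy).2
    refine le_trans ?_ h3
    have : (h * θ) ^ 2 ≤ h ^ 2 := pow_le_pow_left₀ hs.le (by nlinarith) 2
    gcongr
  -- The polynomial on the facet is extended to the whole space constantly in the normal direction.
  -- The orthogonal projection is nonexpansive, so gradient bounds carry over.
  set q : E (m + 1) → ℝ := fun x => Q (cotangent hn (x - x₀)) with hq
  have hqc : ContDiff ℝ ∞ q :=
    hQ.contDiff.comp ((cotangent hn).contDiff.comp (contDiff_id.sub contDiff_const))
  have hqQ : ∀ y, q (planeChart hn x₀ y) = Q y := by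
    intro y
    simp only [hq, planeChart, add_sub_cancel_left, cotangent_tangent]
  have hmem : ∀ x ∈ Metric.closedBall x₀ (2 * (h * θ)),
      cotangent hn (x - x₀) ∈ Metric.closedBall (0 : E m) h := by
    intro x hx
    rw [mem_closedBall_zero_iff]
    refine (norm_cotangent_le hn _).trans ?_
    rw [Metric.mem_closedBall, dist_eq_norm, h2s] at hx
    nlinarith
  have hι := planeChart_isometry hn x₀
  have hchart : ∀ y r, planeChart hn x₀ y ∈ Metric.closedBall x₀ r ↔
      y ∈ Metric.closedBall (0 : E m) r := by
    intro y r
    simp [planeChart, dist_eq_norm]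
  obtain ⟨i1, i2⟩ := forall_and.1 (hφb q M hqc hM0 fun x hx =>
    ⟨hb1 _ (hmem x hx), le_trans (mul_le_mul_of_nonneg_left (pow_le_pow_left₀ (norm_nonneg _)
      (gradient_comp_cotangent_le hn x₀ (hQ.contDiff.differentiable (by simp)) x) 2)
      (by positivity)) (hb3 _ (hmem x hx))⟩)
  -- The bubble occupies a ball of dimension `m + 1`, whereas `M` is normalized by `h ^ m`. The
  -- leftover factor `h` is the origin of the `√h` weights in the volume norms.
  have hle : C₂ * (h * θ) ^ (m + 1) * M ≤ C₂ * C₁ * I * h := by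
    calc C₂ * (h * θ) ^ (m + 1) * M ≤ C₂ * h ^ (m + 1) * M := by gcongr
      _ = C₂ * (h ^ m * M) * h := by ring
      _ = C₂ * C₁ * I * h := by rw [hMh]; ring
  have hfin : ∀ {c : ℝ}, c ≤ C → c * I ≤ (C * √I) ^ 2 := by
    intro c hc
    rw [mul_pow, hN]
    exact mul_le_mul_of_nonneg_right (hc.trans hCC) hI0
  have hQint : ∀ g : E m → ℝ, (∀ y ∈ S', |g y| ≤ M) → ∫ y in S', g y ≤ (C * √I) ^ 2 := by
    intro g hg
    refine le_trans ?_ (hfin (c := C₁ * ballVolume m) (by linarith))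
    refine (setIntegral_le_of_subset_closedBall hh.le hM0 hSh hg).trans (le_of_eq ?_)
    calc M * (h ^ m * ballVolume m) = (h ^ m * M) * ballVolume m := by ring
      _ = C₁ * ballVolume m * I := by rw [hMh]; ring
  refine ⟨fun x => φ x * q x, √I, hφ.mul hqc,
    (tsupport_mul_subset_left).trans (h2s ▸ hφs), Real.sqrt_nonneg _, ?_, ?_, ?_, ?_, ?_⟩
  · rw [hN, hI]
    simp only [hqQ]
    refine setIntegral_mono_ball hS' hSh ?_ (hQ.continuous.mul
      ((hφ.continuous.comp hι.continuous).mul hQ.continuous)) (fun y _ => ?_) fun y hy => ?_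
    · refine (Metric.ball_subset_ball ?_).trans hSκ
      rw [hθdef]
      nlinarith
    · nlinarith [mul_nonneg (hφ0 (planeChart hn x₀ y)) (sq_nonneg (Q y))]
    · rw [hφe _ ((hchart y _).2 (Metric.ball_subset_closedBall hy))]
      ring
  · refine hQint _ fun y hy => ?_
    rw [abs_of_nonneg (sq_nonneg _)]
    exact hb1 y (hSh hy)
  · refine hQint _ fun y hy => ?_
    rw [abs_of_nonneg (sq_nonneg _)]
    change (φ (planeChart hn x₀ y) * q (planeChart hn x₀ y)) ^ 2 ≤ M
    rw [hqQ, mul_pow]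
    have h2 : φ (planeChart hn x₀ y) ^ 2 ≤ 1 := pow_le_one₀ (hφ0 _) (hφ1 _)
    nlinarith [hb1 y (hSh hy), sq_nonneg (Q y)]
  · intro S
    refine l2norm_le (by positivity) ((i1 S).trans (hle.trans ?_))
    calc C₂ * C₁ * I * h ≤ (C * √I) ^ 2 * h := by
          refine mul_le_mul_of_nonneg_right (hfin (by linarith)) hh.le
      _ = (C * √I) ^ 2 * √h ^ 2 := by rw [Real.sq_sqrt hh.le]
      _ = _ := by ring
  · intro S
    have hsh : 0 < √h := Real.sqrt_pos.2 hh
    have h3 : l2norm (volume.restrict S) (gradient fun x => φ x * q x) ≤ C * √I / √h := by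
      refine l2norm_le (by positivity) ?_
      rw [div_pow, Real.sq_sqrt hh.le, le_div_iff₀ hh]
      refine le_trans ?_ (hfin (c := C₂ * C₁ / θ ^ 2) (by linarith))
      have h4 := (i2 S).trans hle
      rw [div_mul_eq_mul_div, le_div_iff₀ (by positivity)]
      have h5 : (h * (θ ^ 2 * h * ∫ x in S, ‖gradient (fun x => φ x * q x) x‖ ^ 2)) ≤
          h * (C₂ * C₁ * I) := by
        refine le_trans (le_of_eq ?_) (h4.trans (le_of_eq ?_)) <;> ring
      refine le_trans (le_of_eq ?_) (le_of_mul_le_mul_left h5 hh)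
      ring
    rwa [le_div_iff₀ hsh, mul_comm] at h3

end

section

variable {d : ℕ}

/-! ### Local estimates on one element -/

theorem memLp_l2Proj {μ : Measure (E d)} (m : ℕ) {f : E d → ℝ} (hf : MemLp f 2 μ) :
    MemLp (l2Proj μ m f) 2 μ := by
  rw [l2Proj, dif_pos hf]
  exact Lp.memLp _

/-- The properties of the data and of the discrete and exact solutions on one element that enter
the local estimates. -/
structure IsCellProblem {Ω : Set (E d)} (k : ℕ) (α : E d → ℝ) (a : E d → E d) (b : E d → ℝ)
    (β Cb cb : ℝ) (f : E d → ℝ) (u : H1Function Ω) (uT : E d → ℝ) (K : Finset (E d)) : Prop where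
  isSimplex : IsSimplex K
  alpha_pos : 0 < cellValue α K
  norm_le : ‖cellValue a K‖ ≤ Cb * cellValue α K
  abs_le_alpha : |cellValue b K| ≤ Cb * cellValue α K
  abs_le_beta : |cellValue b K| ≤ cb * β
  memLp_f : MemLp f 2 (cellMeasure K)
  memLp_u : MemLp u.toFun 2 (cellMeasure K)
  memLp_grad : MemLp u.grad 2 (cellMeasure K)
  exists_poly : ∃ P, IsPoly k P ∧ ∀ x ∈ body K, uT x = P x
  sqrt_alpha_mul_le : √(cellValue α K) * l2norm (cellMeasure K) (fun x => gradient uT x - u.grad x) ≤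
    energyNorm α β (body K) (fun x => uT x - u.toFun x) (fun x => gradient uT x - u.grad x)
  sqrt_beta_mul_le : √β * l2norm (cellMeasure K) (fun x => uT x - u.toFun x) ≤
    energyNorm α β (body K) (fun x => uT x - u.toFun x) (fun x => gradient uT x - u.grad x)

/-- The energy norm of the error on `K`. -/
def cellError {Ω : Set (E d)} (α : E d → ℝ) (β : ℝ) (u : H1Function Ω) (uT : E d → ℝ)
    (K : Finset (E d)) : ℝ :=
  energyNorm α β (body K) (fun x => uT x - u.toFun x) (fun x => gradient uT x - u.grad x)

/-- The norm of the element residual on `K`. -/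
def residualNorm (k : ℕ) (α : E d → ℝ) (a : E d → E d) (b f uT : E d → ℝ) (K : Finset (E d)) : ℝ :=
  l2norm (cellMeasure K) (residual k α a b f uT K)

/-- The distance of `f` from the polynomials on `K`. -/
def dataNorm (k : ℕ) (f : E d → ℝ) (K : Finset (E d)) : ℝ :=
  l2norm (cellMeasure K) (fun x => f x - l2Proj (cellMeasure K) (k - 1) f x)

/-- The constant in the continuity estimate of the lower order terms. -/
def lowerConst (Cb cb : ℝ) : ℝ := Cb + √(Cb * cb)

theorem lowerConst_nonneg {Cb : ℝ} (cb : ℝ) (h : 0 ≤ Cb) : 0 ≤ lowerConst Cb cb :=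
  add_nonneg h (Real.sqrt_nonneg _)

namespace IsCellProblem

variable {Ω : Set (E d)} {k : ℕ} {α : E d → ℝ} {a : E d → E d} {b : E d → ℝ} {β Cb cb : ℝ}
  {f : E d → ℝ} {u : H1Function Ω} {uT : E d → ℝ} {K : Finset (E d)}

theorem memLp_uT (h : IsCellProblem k α a b β Cb cb f u uT K) : MemLp uT 2 (cellMeasure K) := by
  obtain ⟨P, hP, hPu⟩ := h.exists_poly
  refine (memLp_congr_ae ?_).2 (memLp_body hP.continuous K)
  filter_upwards [ae_restrict_mem (isClosed_body K).measurableSet] with x hx using hPu x hx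

theorem memLp_gradient_uT (h : IsCellProblem k α a b β Cb cb f u uT K) :
    MemLp (gradient uT) 2 (cellMeasure K) := by
  obtain ⟨P, hP, hPu⟩ := h.exists_poly
  refine (memLp_congr_ae ?_).2 (memLp_body (continuous_gradient hP.contDiff) K)
  filter_upwards [Triangulation.ae_mem_interior K] with x hx
    using gradient_eq_of_mem_interior hPu hx

theorem exists_residual_poly (h : IsCellProblem k α a b β Cb cb f u uT K) :
    ∃ R, IsPoly k R ∧ residual k α a b f uT K =ᵐ[cellMeasure K] R := by
  obtain ⟨P, hP, hPu⟩ := h.exists_poly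
  obtain ⟨F, hF, hFf⟩ := l2Proj_ae_eq_isPoly (k - 1) h.memLp_f
  exact ⟨_, ((((hF.mono (Nat.sub_le k 1)).sub (hP.inner_gradient _)).sub (hP.const_mul _)).add
    (hP.div_gradient.const_mul _)), residual_ae_eq h.isSimplex hP hPu α a b hFf⟩

theorem memLp_residual (h : IsCellProblem k α a b β Cb cb f u uT K) :
    MemLp (residual k α a b f uT K) 2 (cellMeasure K) := by
  obtain ⟨R, hR, hR'⟩ := h.exists_residual_poly
  exact (memLp_congr_ae hR').2 (memLp_body hR.continuous K)

theorem abs_cellBilin_sub_le (h : IsCellProblem k α a b β Cb cb f u uT K) (hCb : 0 ≤ Cb)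
    (hcb : 0 ≤ cb) {V : E d → ℝ} (hV : ContDiff ℝ ∞ V) :
    |cellBilin (cellValue α K) (cellValue a K) (cellValue b K) K uT (gradient uT) V -
      cellBilin (cellValue α K) (cellValue a K) (cellValue b K) K u.toFun u.grad V| ≤
    cellError α β u uT K * √(cellValue α K) * (l2norm (cellMeasure K) (gradient V) +
      lowerConst Cb cb * l2norm (cellMeasure K) V) := by
  rw [← cellBilin_sub _ _ _ h.memLp_uT h.memLp_u h.memLp_gradient_uT h.memLp_grad hV]
  exact abs_cellBilin_le h.alpha_pos hCb hcb h.norm_le h.abs_le_alpha h.abs_le_beta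
    (h.memLp_uT.sub h.memLp_u) (h.memLp_gradient_uT.sub h.memLp_grad) hV h.sqrt_alpha_mul_le
    h.sqrt_beta_mul_le

theorem abs_integral_residual_le (h : IsCellProblem k α a b β Cb cb f u uT K) {V : E d → ℝ}
    (hV : Continuous V) : |∫ x in body K, residual k α a b f uT K x * V x| ≤
      residualNorm k α a b f uT K * l2norm (cellMeasure K) V :=
  abs_integral_mul_le h.memLp_residual (memLp_body hV K)

theorem abs_integral_data_le (h : IsCellProblem k α a b β Cb cb f u uT K) {V : E d → ℝ}
    (hV : Continuous V) :
    |∫ x in body K, (f x - l2Proj (cellMeasure K) (k - 1) f x) * V x| ≤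
      dataNorm k f K * l2norm (cellMeasure K) V :=
  abs_integral_mul_le (h.memLp_f.sub (memLp_l2Proj _ h.memLp_f)) (memLp_body hV K)

/-- The contribution of one element to the error equation. -/
theorem abs_boundary_term_le (h : IsCellProblem k α a b β Cb cb f u uT K) (hCb : 0 ≤ Cb)
    (hcb : 0 ≤ cb) {P : E d → ℝ} (hP : IsPoly k P) (hPu : ∀ x ∈ body K, uT x = P x) {V : E d → ℝ}
    (hV : ContDiff ℝ ∞ V) {B : ℝ}
    (hparts : ∫ x in body K, ⟪gradient P x, gradient V x⟫ =
      -(∫ x in body K, div (gradient P) x * V x) + B) :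
    |cellValue α K * B -
      (cellBilin (cellValue α K) (cellValue a K) (cellValue b K) K u.toFun u.grad V -
        ∫ x in body K, f x * V x)| ≤
    (residualNorm k α a b f uT K + dataNorm k f K) * l2norm (cellMeasure K) V +
      cellError α β u uT K * √(cellValue α K) * (l2norm (cellMeasure K) (gradient V) +
        lowerConst Cb cb * l2norm (cellMeasure K) V) := by
  have h1 := cellBilin_sub_eq h.isSimplex hP hPu (α := α) (a := a) (b := b) h.memLp_f hV hparts
  have h2 := abs_le.1 (h.abs_integral_residual_le hV.continuous)
  have h3 := abs_le.1 (h.abs_integral_data_le hV.continuous)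
  have h4 := abs_le.1 (h.abs_cellBilin_sub_le hCb hcb hV)
  rw [abs_le]
  constructor <;> nlinarith

end IsCellProblem

/-- The element residual is bounded by the error and the data oscillation. -/
theorem exists_residual_bound (d k : ℕ) {C₀ Cb cb D : ℝ} (hC₀ : 1 < C₀) (hCb : 0 ≤ Cb)
    (hcb : 0 ≤ cb) (hD : 0 ≤ D) : ∃ C : ℝ, 1 ≤ C ∧
    ∀ {Ω : Set (E d)} {α : E d → ℝ} {a : E d → E d} {b : E d → ℝ} {β : ℝ} {f : E d → ℝ}
      {u : H1Function Ω} {uT : E d → ℝ} {K : Finset (E d)},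
      IsCellProblem k α a b β Cb cb f u uT K → 0 < diam K → diam K ≤ D →
      (∃ x, Metric.closedBall x (diam K / (2 * C₀)) ⊆ body K) →
      (∀ V : E d → ℝ, ContDiff ℝ ∞ V → HasCompactSupport V → tsupport V ⊆ interior (body K) →
        cellBilin (cellValue α K) (cellValue a K) (cellValue b K) K u.toFun u.grad V =
          ∫ x in body K, f x * V x) →
      diam K * (√(cellValue α K))⁻¹ * residualNorm k α a b f uT K ≤
        C * (diam K * (√(cellValue α K))⁻¹ * dataNorm k f K + cellError α β u uT K) := by
  obtain ⟨c, hc, hbub⟩ := exists_cell_bubble d k (κ := 1 / (2 * C₀)) (by positivity)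
    (by rw [div_le_one (by positivity)]; linarith)
  have hM := lowerConst_nonneg cb hCb
  set M := lowerConst Cb cb with hMdef
  -- One `c` bounds the residual by `N`, the other bounds the norms of the bubble; `1 + M * D`
  -- accounts for the lower order terms.
  refine ⟨c ^ 2 * (1 + M * D), ?_, ?_⟩
  · have : 0 ≤ M * D := by positivity
    nlinarith
  intro Ω α a b β f u uT K h hh hhD ⟨x, hx⟩ htest
  obtain ⟨P, hP, hPu⟩ := h.exists_poly
  obtain ⟨R, hR, hRr⟩ := h.exists_residual_poly
  set η := diam K with hη
  have hκ : η / (2 * C₀) = 1 / (2 * C₀) * η := by ring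
  have hκ0 : 0 < 1 / (2 * C₀) * η := by positivity
  have hxK : x ∈ body K := hx (Metric.mem_closedBall_self (by rw [hκ]; positivity))
  obtain ⟨V, N, hV, hVs, hN0, hN, hRN, hVN, hDN⟩ := hbub R hR x η hh (body K)
    (isClosed_body K).measurableSet
    (fun y hy => Metric.dist_le_diam_of_mem (isCompact_body K).isBounded hy hxK) (hκ ▸ hx)
  have hVc : HasCompactSupport V :=
    (isCompact_closedBall _ _).of_isClosed_subset (isClosed_tsupport V) hVs
  have hVi : tsupport V ⊆ interior (body K) := by
    refine hVs.trans (Subset.trans (Metric.closedBall_subset_ball ?_)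
      (interior_maximal (Metric.ball_subset_closedBall.trans (hκ ▸ hx)) Metric.isOpen_ball))
    linarith
  have hparts := integral_parts_interior hV hVc (hVi.trans interior_subset) hP
  have h1 := cellBilin_sub_eq h.isSimplex hP hPu (α := α) (a := a) (b := b) h.memLp_f hV hparts
  rw [← htest V hV hVc hVi] at h1
  have h2 : ∫ y in body K, R y * V y = ∫ y in body K, residual k α a b f uT K y * V y := by
    refine integral_congr_ae ?_
    filter_upwards [hRr] with y hy
    rw [hy]
  have h3 := (abs_le.1 (h.abs_integral_data_le hV.continuous)).1
  have h4 := (abs_le.1 (h.abs_cellBilin_sub_le hCb hcb hV)).1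
  set A := √(cellValue α K) with hA
  have hA0 : 0 < A := Real.sqrt_pos.2 h.alpha_pos
  have ho : 0 ≤ dataNorm k f K := l2norm_nonneg _ _
  have hE : 0 ≤ cellError α β u uT K := energyNorm_nonneg _ _ _ _ _
  set o := dataNorm k f K with hodef
  set En := cellError α β u uT K with hEn
  have hr : residualNorm k α a b f uT K ≤ c * N := by
    rw [residualNorm, l2norm_congr hRr]
    exact hRN
  change l2norm (cellMeasure K) V ≤ c * N at hVN
  change η * l2norm (cellMeasure K) (gradient V) ≤ c * N at hDN
  have hV0 : 0 ≤ l2norm (cellMeasure K) V := l2norm_nonneg _ _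
  -- Multiplication by `η` compensates the inverse power of the diameter in the gradient of the
  -- bubble. The zero order norm has no need of this power, and there `η ≤ D` is used.
  have h5 : η * (N * N) ≤ c * N * (η * o + En * A * (1 + M * D)) := by
    have e1 : N * N ≤ o * l2norm (cellMeasure K) V + En * A *
        (l2norm (cellMeasure K) (gradient V) + M * l2norm (cellMeasure K) V) := by
      rw [← sq]
      linarith
    have e2 : o * l2norm (cellMeasure K) V ≤ o * (c * N) := mul_le_mul_of_nonneg_left hVN ho
    have e3 : η * (l2norm (cellMeasure K) (gradient V) + M * l2norm (cellMeasure K) V) ≤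
        c * N * (1 + M * D) := by
      have e4 : η * (M * l2norm (cellMeasure K) V) ≤ D * (M * (c * N)) := by gcongr
      linarith
    calc η * (N * N) ≤ η * (o * (c * N) + En * A *
          (l2norm (cellMeasure K) (gradient V) + M * l2norm (cellMeasure K) V)) := by
            gcongr; linarith
      _ = η * o * (c * N) + En * A *
          (η * (l2norm (cellMeasure K) (gradient V) + M * l2norm (cellMeasure K) V)) := by ring
      _ ≤ η * o * (c * N) + En * A * (c * N * (1 + M * D)) := by gcongr
      _ = _ := by ring
  have h6 : η * N ≤ c * (η * o + En * A * (1 + M * D)) := by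
    -- One factor `N` is cancelled, which requires the trivial case `N = 0` to be set aside.
    rcases hN0.eq_or_lt with h0 | h0
    · rw [← h0, mul_zero]
      positivity
    · refine le_of_mul_le_mul_right ?_ h0
      linarith
  have hMD : 0 ≤ M * D := by positivity
  calc η * A⁻¹ * residualNorm k α a b f uT K ≤ η * A⁻¹ * (c * N) := by gcongr
    _ = A⁻¹ * c * (η * N) := by ring
    _ ≤ A⁻¹ * c * (c * (η * o + En * A * (1 + M * D))) := by gcongr
    _ = c ^ 2 * (η * A⁻¹ * o + (A⁻¹ * A) * En * (1 + M * D)) := by ring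
    _ = c ^ 2 * (η * A⁻¹ * o + En * (1 + M * D)) := by rw [inv_mul_cancel₀ hA0.ne', one_mul]
    _ ≤ c ^ 2 * ((1 + M * D) * (η * A⁻¹ * o) + En * (1 + M * D)) := by
        have t : 0 ≤ η * A⁻¹ * o := by positivity
        refine mul_le_mul_of_nonneg_left ?_ (by positivity)
        nlinarith [mul_nonneg hMD t]
    _ = _ := by ring

/-! ### Local estimates on one facet -/

section Facet

variable {m : ℕ} {K e : Finset (E (m + 1))} {δ : ℝ}

theorem IsFacetAt.body_subset_range (h : IsFacetAt K e δ) :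
    body e ⊆ range (planeChart h.norm_normal (barycenter e)) := fun x hx =>
  (mem_range_planeChart _ _ _).2 (h.inner_facet x hx)

theorem isCompact_preimage_planeChart {n : E (m + 1)} (hn : ‖n‖ = 1) (x₀ : E (m + 1))
    {S : Set (E (m + 1))} (hS : IsCompact S) : IsCompact (planeChart hn x₀ ⁻¹' S) :=
  (planeChart_isometry hn x₀).isClosedEmbedding.isCompact_preimage hS

theorem IsFacetAt.surf_body_lt_top (h : IsFacetAt K e δ) : surf (m + 1) (body e) < ⊤ := by
  rw [surf_eq_volume h.norm_normal (barycenter e) h.body_subset_range]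
  exact (isCompact_preimage_planeChart _ _ (isCompact_body e)).measure_lt_top

theorem IsFacetAt.isFiniteMeasure (h : IsFacetAt K e δ) : IsFiniteMeasure (facetMeasure e) :=
  ⟨by rw [facetMeasure, Measure.restrict_apply_univ]; exact h.surf_body_lt_top⟩

theorem IsFacetAt.memLp {F : Type*} [NormedAddCommGroup F] [SecondCountableTopology F]
    (h : IsFacetAt K e δ) {g : E (m + 1) → F}
    (hg : Continuous g) : MemLp g 2 (facetMeasure e) := by
  have := h.isFiniteMeasure
  obtain ⟨C, hC⟩ := (isCompact_body e).exists_bound_of_continuousOn hg.continuousOn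
  refine MemLp.of_bound hg.aestronglyMeasurable C ?_
  filter_upwards [ae_restrict_mem (isClosed_body e).measurableSet] with x hx using hC x hx

/-- A polynomial on a facet is controlled by testing with smooth functions. -/
theorem exists_facet_bound (m k : ℕ) {κ : ℝ} (hκ : 0 < κ) (hκ1 : κ ≤ 1) :
    ∃ C : ℝ, 1 ≤ C ∧ ∀ {K e : Finset (E (m + 1))}, IsFacetAt K e (κ * diam e) → 0 < diam e →
      e.Nonempty → ∀ {j J : E (m + 1) → ℝ}, IsPoly k J → j =ᵐ[facetMeasure e] J →
      ∀ {X Y g : ℝ}, 0 ≤ X → 0 ≤ Y → 0 ≤ g →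
      (∀ (V : E (m + 1) → ℝ) (A B : ℝ), ContDiff ℝ ∞ V → HasCompactSupport V →
        tsupport V ⊆ Metric.ball (barycenter e) (κ * diam e) →
        (∀ S, l2norm (volume.restrict S) V ≤ A) →
        (∀ S, l2norm (volume.restrict S) (gradient V) ≤ B) →
        ∫ x in body e, J x * V x ∂surf (m + 1) ≤ X * A + Y * B + g * l2norm (facetMeasure e) V) →
      √(diam e) * l2norm (facetMeasure e) j ≤ C * (diam e * X + Y + √(diam e) * g) := by
  obtain ⟨c, hc, hbub⟩ := exists_facet_bubble m k hκ hκ1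
  refine ⟨c ^ 2, by nlinarith, fun {K e} h hh hne {j J} hJ hjJ {X Y g} hX hY hg htest => ?_⟩
  set n := outwardNormal K e
  have hn : ‖n‖ = 1 := h.norm_normal
  set x₀ := barycenter e with hx₀
  set η := diam e with hη
  set S' := planeChart hn x₀ ⁻¹' body e with hS'
  have hsub : body e ⊆ range (planeChart hn x₀) := h.body_subset_range
  have hx₀e : x₀ ∈ body e := barycenter_mem_body hne
  have hdist : ∀ y, dist (planeChart hn x₀ y) x₀ = ‖y‖ := by
    intro y
    simp [planeChart, dist_eq_norm]
  have hQ : IsPoly k fun y => J (planeChart hn x₀ y) :=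
    hJ.comp_affine x₀ (tangent hn).toContinuousLinearMap
  have hκh : 0 < κ * η := by positivity
  obtain ⟨V, N, hV, hVs, hN0, hN, hJN, hVN, hV2, hDV⟩ := hbub _ hQ n hn x₀ η hh S'
    (isCompact_preimage_planeChart hn x₀ (isCompact_body e)).measurableSet
    (fun y hy => by
      rw [mem_closedBall_zero_iff, ← hdist]
      exact Metric.dist_le_diam_of_mem (isCompact_body e).isBounded hy hx₀e)
    (fun y hy => (h.mem_facet _ (by
      rw [mem_ball_zero_iff] at hy
      rwa [Metric.mem_ball, hdist]) ((mem_range_planeChart hn x₀ _).1 (mem_range_self y))).1)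
  have hVc : HasCompactSupport V :=
    (isCompact_closedBall _ _).of_isClosed_subset (isClosed_tsupport V) hVs
  have hint : ∀ F : E (m + 1) → ℝ, ∫ x, F x ∂facetMeasure e =
      ∫ y in S', F (planeChart hn x₀ y) := fun F => setIntegral_surf hn x₀ hsub F
  have hsη : 0 < √η := Real.sqrt_pos.2 hh
  have hl2 : ∀ F : E (m + 1) → ℝ, ∫ y in S', F (planeChart hn x₀ y) ^ 2 ≤ (c * N) ^ 2 →
      l2norm (facetMeasure e) F ≤ c * N := by
    intro F hF
    refine l2norm_le (by positivity) ?_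
    rw [hint fun x => ‖F x‖ ^ 2]
    simpa only [Real.norm_eq_abs, sq_abs] using hF
  have hj : l2norm (facetMeasure e) j ≤ c * N := by
    rw [l2norm_congr hjJ]
    exact hl2 J hJN
  have hVe := hl2 V hVN
  -- These are the bounds of the facet bubble and its gradient in volume norms. After multiplication
  -- by `√η`, they give `X` the weight `η` and `Y` the weight `1`.
  have h1 := htest V (c * √η * N) (c * N / √η) hV hVc
    (hVs.trans (Metric.closedBall_subset_ball (by linarith))) hV2
    (fun S => by rw [le_div_iff₀ hsη, mul_comm]; exact hDV S)
  change ∫ x, J x * V x ∂facetMeasure e ≤ _ at h1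
  rw [hint fun x => J x * V x] at h1
  have h2 : N * N ≤ c * N * (X * √η + Y / √η + g) := by
    have e1 : g * l2norm (facetMeasure e) V ≤ g * (c * N) := mul_le_mul_of_nonneg_left hVe hg
    calc N * N = N ^ 2 := (sq N).symm
      _ ≤ X * (c * √η * N) + Y * (c * N / √η) + g * (c * N) := by linarith
      _ = _ := by ring
  have h3 : N ≤ c * (X * √η + Y / √η + g) := by
    rcases hN0.eq_or_lt with h0 | h0
    · rw [← h0]
      positivity
    · refine le_of_mul_le_mul_right ?_ h0
      linarith
  calc √η * l2norm (facetMeasure e) j ≤ √η * (c * (c * (X * √η + Y / √η + g))) := by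
        gcongr
        exact hj.trans (by gcongr)
    _ = c ^ 2 * ((√η * √η) * X + (√η / √η) * Y + √η * g) := by ring
    _ = _ := by rw [Real.mul_self_sqrt hh.le, div_self hsη.ne', one_mul]

/-- Square integrability on a facet follows from that on a set containing its relative interior,
which has full surface measure. -/
theorem IsFacetAt.memLp_of_liesIn (h : IsFacetAt K e δ) {S : Set (E (m + 1))} (heS : LiesIn e S)
    {g : E (m + 1) → ℝ} (hg : MemLp g 2 ((surf (m + 1)).restrict S)) :
    MemLp g 2 (facetMeasure e) := by
  set n := outwardNormal K e
  have hn : ‖n‖ = 1 := h.norm_normal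
  set x₀ := barycenter e with hx₀
  set S' := planeChart hn x₀ ⁻¹' body e with hS'
  have hsub : body e ⊆ range (planeChart hn x₀) := h.body_subset_range
  -- The frontier of a convex set is null. In plane coordinates, almost every point of the facet is
  -- thus relatively interior, hence in `S`.
  have hconv : Convex ℝ S' := by
    have : S' = (tangent hn).toLinearMap ⁻¹' ((fun z => x₀ + z) ⁻¹' body e) := rfl
    rw [this]
    exact ((convex_body e).translate_preimage_right x₀).linear_preimage _
  have hint : ∀ y ∈ interior S', planeChart hn x₀ y ∈ intrinsicInterior ℝ (body e) := by
    intro y hy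
    have hc : ∀ y, cotangent hn (planeChart hn x₀ y - x₀) = y := by
      intro y
      simp only [planeChart, add_sub_cancel_left, cotangent_tangent]
    refine mem_intrinsicInterior_of_isOpen (n := n) (x₀ := x₀)
      (W := (fun x => cotangent hn (x - x₀)) ⁻¹' interior S') h.inner_facet
      (isOpen_interior.preimage ((cotangent hn).continuous.comp (continuous_id.sub
        continuous_const))) ?_ ?_ ((mem_range_planeChart hn x₀ _).1 (mem_range_self y))
    · intro z hz hz0
      obtain ⟨w, rfl⟩ := (mem_range_planeChart hn x₀ z).2 hz0
      rw [mem_preimage, hc] at hz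
      exact (interior_subset : interior S' ⊆ S') hz
    · rw [mem_preimage, hc]
      exact hy
  have hle : facetMeasure e ≤ (surf (m + 1)).restrict S := by
    refine Measure.restrict_mono_ae ?_
    have hae : ∀ᵐ x ∂facetMeasure e, x ∈ S := by
      rw [facetMeasure, surf_restrict_eq_map hn x₀ hsub,
        (planeChart_measurableEmbedding hn x₀).ae_map_iff]
      have hnull : volume (frontier S') = 0 := hconv.addHaar_frontier volume
      have : ∀ᵐ y ∂volume.restrict S', y ∉ frontier S' :=
        ae_restrict_of_ae (measure_eq_zero_iff_ae_notMem.1 hnull)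
      have hcl : IsClosed S' :=
        (isClosed_body e).preimage (planeChart_isometry hn x₀).continuous
      filter_upwards [this, ae_restrict_mem hcl.measurableSet] with y hy hyS
      refine heS (hint y ?_)
      by_contra hni
      exact hy ⟨subset_closure hyS, hni⟩
    filter_upwards [(ae_restrict_iff' (isClosed_body e).measurableSet).1 hae] with x hx hxe
      using hx hxe
  exact hg.mono_measure hle

end Facet

end

section

variable {d : ℕ}

/-! ### The error equation tested with bubble functions -/

theorem IsDomainWithBoundary.neumann_subset {Ω ΓD ΓN : Set (E d)}
    (h : IsDomainWithBoundary Ω ΓD ΓN) : ΓN ⊆ frontier Ω :=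
  h.union_eq ▸ subset_union_right

theorem Triangulation.exists_mem_interior {Ω : Set (E d)} {T : Triangulation Ω} (hΩ : IsOpen Ω)
    (hL : HasLipschitzBoundary Ω) {K : Finset (E d)} (hK : K ∈ T.cells) {p : E d → Prop}
    (hp : ∀ᵐ x ∂(volume.restrict Ω), p x) : ∃ x ∈ interior (body K), p x := by
  have h1 : ∀ᵐ x ∂(volume.restrict (body K)), p x :=
    ae_mono (restrict_body_le hΩ hL hK) hp
  have h0 : volume.restrict (body K) ≠ 0 := by
    rw [Ne, Measure.restrict_eq_zero]
    exact (Measure.measure_pos_of_nonempty_interior volume (isSimplex hK).interior_nonempty).ne'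
  have : (ae (volume.restrict (body K))).NeBot := ae_neBot.2 h0
  exact ((ae_mem_interior K).and h1).exists

/-- All coefficients are constant inside `K`, and `K` has positive measure. One interior point at
which the almost everywhere inequalities hold together therefore yields them for the cell values. -/
theorem IsAdmissible.isCellProblem {Ω ΓD ΓN : Set (E d)} (hdom : IsDomainWithBoundary Ω ΓD ΓN)
    {T : Triangulation Ω} {α : E d → ℝ} {a : E d → E d} {b : E d → ℝ} {β cb Cb : ℝ}
    {Da : Fin d → E d → E d} (h : IsAdmissible T ΓD α a b β cb Da)
    (hdd : DiffusionDominated Ω α a b Cb) {f : E d → ℝ} (hf : MemLp f 2 (volume.restrict Ω))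
    (u : H1Function Ω) {k : ℕ} {uT : E d → ℝ} (huT : IsFEFunction T ΓD k uT) {K : Finset (E d)}
    (hK : K ∈ T.cells) : IsCellProblem k α a b β Cb cb f u uT K := by
  have hle := Triangulation.restrict_body_le hdom.isOpen hdom.lipschitz hK
  obtain ⟨δ, hδ, hαδ⟩ := h.alpha_pos
  obtain ⟨x, hx, ⟨h1, h2, h3⟩, h4⟩ := Triangulation.exists_mem_interior hdom.isOpen hdom.lipschitz
    hK ((hαδ.and hdd).and h.b_bound)
  rw [h.alpha_const K hK x hx] at h1
  rw [h.alpha_const K hK x hx, h.a_const K hK x hx] at h2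
  rw [h.alpha_const K hK x hx, h.b_const K hK x hx] at h3
  rw [h.b_const K hK x hx] at h4
  have hα : 0 < cellValue α K := hδ.trans_le h1
  obtain ⟨i1, i2⟩ := sqrt_mul_l2norm_le_energyNorm h.alpha_const h.beta_nonneg hK
    (fun x => uT x - u.toFun x) (fun x => gradient uT x - u.grad x)
  exact {
    isSimplex := Triangulation.isSimplex hK
    alpha_pos := hα
    norm_le := (div_le_iff₀ hα).1 h2
    abs_le_alpha := (div_le_iff₀ hα).1 h3
    abs_le_beta := h4
    memLp_f := hf.mono_measure hle
    memLp_u := u.memLp.mono_measure hle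
    memLp_grad := u.memLp_grad.mono_measure hle
    exists_poly := huT.2.1 K hK |>.imp' (fun p x => MvPolynomial.eval (fun i => x i) p)
      fun p hp => ⟨⟨p, hp.1, fun _ => rfl⟩, hp.2⟩
    sqrt_alpha_mul_le := i1
    sqrt_beta_mul_le := i2 }

/-- The ingredients of the local lower bounds. -/
structure IsProblem {Ω : Set (E d)} (ΓD ΓN : Set (E d)) (T : Triangulation Ω) (k : ℕ)
    (C₀ Cb cb D : ℝ) (α : E d → ℝ) (a : E d → E d) (b : E d → ℝ) (β : ℝ) (f gN : E d → ℝ)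
    (u : H1Function Ω) (uT : E d → ℝ) : Prop where
  domain : IsDomainWithBoundary Ω ΓD ΓN
  diam_le : Metric.diam Ω ≤ D
  shapeRegular : T.ShapeRegular C₀
  cell : ∀ K ∈ T.cells, IsCellProblem k α a b β Cb cb f u uT K
  alpha_const : IsCellwiseConstant T α
  a_const : IsCellwiseConstant T a
  b_const : IsCellwiseConstant T b
  memLp_f : MemLp f 2 (volume.restrict Ω)
  memLp_gN : MemLp gN 2 ((surf d).restrict ΓN)
  solution : IsWeakSolution Ω ΓD ΓN α a b f gN u

/-- The contribution of the element `K` to the error equation tested with `V`. -/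
def testBound {Ω : Set (E d)} (k : ℕ) (M : ℝ) (α : E d → ℝ) (a : E d → E d) (b : E d → ℝ) (β : ℝ)
    (f : E d → ℝ) (u : H1Function Ω) (uT V : E d → ℝ) (K : Finset (E d)) : ℝ :=
  (residualNorm k α a b f uT K + dataNorm k f K) * l2norm (cellMeasure K) V +
    cellError α β u uT K * √(cellValue α K) * (l2norm (cellMeasure K) (gradient V) +
      M * l2norm (cellMeasure K) V)

theorem testBound_nonneg {Ω : Set (E d)} (k : ℕ) {M : ℝ} (hM : 0 ≤ M) (α : E d → ℝ)
    (a : E d → E d) (b : E d → ℝ) (β : ℝ) (f : E d → ℝ) (u : H1Function Ω) (uT V : E d → ℝ)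
    (K : Finset (E d)) : 0 ≤ testBound k M α a b β f u uT V K := by
  have h1 : 0 ≤ residualNorm k α a b f uT K := l2norm_nonneg _ _
  have h2 : 0 ≤ dataNorm k f K := l2norm_nonneg _ _
  have h3 : 0 ≤ cellError α β u uT K := energyNorm_nonneg _ _ _ _ _
  have h4 := l2norm_nonneg (cellMeasure K) V
  have h5 := l2norm_nonneg (cellMeasure K) (gradient V)
  unfold testBound
  positivity

/-- The distance of the Neumann data from the polynomials on a Neumann facet. -/
def neumannNorm (ΓN : Set (E d)) (k : ℕ) (gN : E d → ℝ) (e : Finset (E d)) : ℝ :=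
  open Classical in
  if LiesIn e ΓN then
    l2norm (facetMeasure e) (fun x => gN x - l2Proj (facetMeasure e) (k - 1) gN x) else 0

theorem neumannNorm_nonneg (ΓN : Set (E d)) (k : ℕ) (gN : E d → ℝ) (e : Finset (E d)) :
    0 ≤ neumannNorm ΓN k gN e := by
  unfold neumannNorm
  split_ifs
  exacts [l2norm_nonneg _ _, le_rfl]

namespace IsProblem

/-- The case of a single element with `A` empty in `sum_cellBilin_eq`: the test function vanishes
near the boundary of `K`. -/
theorem cellBilin_eq {Ω ΓD ΓN : Set (E d)} {T : Triangulation Ω} {k : ℕ} {C₀ Cb cb D : ℝ}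
    {α : E d → ℝ} {a : E d → E d} {b : E d → ℝ} {β : ℝ} {f gN : E d → ℝ} {u : H1Function Ω}
    {uT : E d → ℝ} (h : IsProblem ΓD ΓN T k C₀ Cb cb D α a b β f gN u uT) {K : Finset (E d)}
    (hK : K ∈ T.cells) {V : E d → ℝ} (hV : ContDiff ℝ ∞ V) (hVc : HasCompactSupport V)
    (hVs : tsupport V ⊆ interior (body K)) :
    cellBilin (cellValue α K) (cellValue a K) (cellValue b K) K u.toFun u.grad V =
      ∫ x in body K, f x * V x := by
  have := sum_cellBilin_eq h.domain h.alpha_const h.a_const h.b_const h.memLp_f h.solution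
    (S := {K}) (by simpa using hK) hV hVc (A := ∅) MeasurableSet.empty (by simp) (empty_subset _)
    (empty_subset _) ?_ ?_
  · simpa using this
  · intro x _ hx _
    refine mem_nhdsWithin_of_mem_nhds ?_
    simpa using mem_interior_iff_mem_nhds.1 (hVs hx)
  · intro x hx _ hVx
    have hxΩ : x ∈ Ω := Triangulation.interior_body_subset h.domain.isOpen h.domain.lipschitz hK
      (hVs (subset_tsupport V hVx))
    exact (h.domain.isOpen.frontier_eq ▸ hx).2 hxΩ

variable {m : ℕ} {Ω ΓD ΓN : Set (E (m + 1))} {T : Triangulation Ω} {k : ℕ} {C₀ Cb cb D : ℝ}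
  {α : E (m + 1) → ℝ} {a : E (m + 1) → E (m + 1)} {b : E (m + 1) → ℝ} {β : ℝ}
  {f gN : E (m + 1) → ℝ} {u : H1Function Ω} {uT : E (m + 1) → ℝ} {e : Finset (E (m + 1))} {δ : ℝ}

theorem exists_flux_poly (h : IsProblem ΓD ΓN T k C₀ Cb cb D α a b β f gN u uT) :
    ∃ J, IsPoly k J ∧ ∀ x ∈ body e,
      ∑ K ∈ T.cellsAt e, ⟪flux α uT K x, outwardNormal K e⟫ = J x := by
  choose! P hP hPu using fun K hK => (h.cell K hK).exists_poly
  have hc : ∀ K ∈ T.cellsAt e, K ∈ T.cells := fun K hK => (T.mem_cellsAt.1 hK).1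
  refine ⟨fun x => ∑ K ∈ T.cellsAt e,
    -cellValue α K * ⟪outwardNormal K e, gradient (P K) x⟫,
    IsPoly.sum _ fun K hK => ((hP K (hc K hK)).inner_gradient _).const_mul _, fun x hx => ?_⟩
  refine Finset.sum_congr rfl fun K hK => ?_
  rw [flux_eq (h.cell K (hc K hK)).isSimplex (hP K (hc K hK)).contDiff (hPu K (hc K hK)) α
    (body_mono (T.mem_cellsAt.1 hK).2 hx), inner_neg_left, real_inner_smul_left,
    real_inner_comm, neg_mul]

/-- Integration by parts in each element at `e` leaves one boundary term apiece, and their sum is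
minus the flux jump tested with `V`. `X` is the Neumann contribution: zero on an interior facet, the
integral of `gN * V` on a Neumann facet. -/
theorem abs_facet_term_le (h : IsProblem ΓD ΓN T k C₀ Cb cb D α a b β f gN u uT) (hCb : 0 ≤ Cb)
    (hcb : 0 ≤ cb) (hfac : ∀ K ∈ T.cellsAt e, IsFacetAt K e δ) {V : E (m + 1) → ℝ}
    (hV : ContDiff ℝ ∞ V) (hVc : HasCompactSupport V)
    (hVs : tsupport V ⊆ Metric.ball (barycenter e) δ) {X : ℝ}
    (hX : ∑ K ∈ T.cellsAt e,
        cellBilin (cellValue α K) (cellValue a K) (cellValue b K) K u.toFun u.grad V =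
      ∑ K ∈ T.cellsAt e, (∫ x in body K, f x * V x) - X) :
    |X - ∫ x in body e, (∑ K ∈ T.cellsAt e, ⟪flux α uT K x, outwardNormal K e⟫) * V x
      ∂surf (m + 1)| ≤
      ∑ K ∈ T.cellsAt e, testBound k (lowerConst Cb cb) α a b β f u uT V K := by
  choose! P hP hPu using fun K hK => (h.cell K hK).exists_poly
  have hc : ∀ K ∈ T.cellsAt e, K ∈ T.cells := fun K hK => (T.mem_cellsAt.1 hK).1
  set B : Finset (E (m + 1)) → ℝ := fun K =>
    ∫ x in body e, ⟪outwardNormal K e, gradient (P K) x⟫ * V x ∂surf (m + 1) with hB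
  have h1 : ∫ x in body e, (∑ K ∈ T.cellsAt e, ⟪flux α uT K x, outwardNormal K e⟫) * V x
      ∂surf (m + 1) = -∑ K ∈ T.cellsAt e, cellValue α K * B K := by
    have e1 : ∫ x in body e, (∑ K ∈ T.cellsAt e, ⟪flux α uT K x, outwardNormal K e⟫) * V x
        ∂surf (m + 1) = ∫ x in body e, ∑ K ∈ T.cellsAt e,
          -cellValue α K * (⟪outwardNormal K e, gradient (P K) x⟫ * V x) ∂surf (m + 1) := by
      refine setIntegral_congr_fun (isClosed_body e).measurableSet fun x hx => ?_
      simp only [Finset.sum_mul]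
      refine Finset.sum_congr rfl fun K hK => ?_
      rw [flux_eq (h.cell K (hc K hK)).isSimplex (hP K (hc K hK)).contDiff (hPu K (hc K hK)) α
        (body_mono (T.mem_cellsAt.1 hK).2 hx), inner_neg_left, real_inner_smul_left,
        real_inner_comm]
      ring
    rw [e1, integral_finsetSum, ← Finset.sum_neg_distrib]
    · refine Finset.sum_congr rfl fun K _ => ?_
      rw [integral_const_mul, hB, neg_mul]
    · intro K hK
      refine Integrable.const_mul ?_ _
      exact MemLp_two_mul ((hfac K hK).memLp ((hP K (hc K hK)).inner_gradient _).continuous)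
        ((hfac K hK).memLp hV.continuous)
  rw [h1, sub_neg_eq_add]
  have h2 : X + ∑ K ∈ T.cellsAt e, cellValue α K * B K = ∑ K ∈ T.cellsAt e,
      (cellValue α K * B K -
        (cellBilin (cellValue α K) (cellValue a K) (cellValue b K) K u.toFun u.grad V -
          ∫ x in body K, f x * V x)) := by
    rw [Finset.sum_sub_distrib, Finset.sum_sub_distrib, hX]
    ring
  rw [h2]
  refine (Finset.abs_sum_le_sum_abs _ _).trans (Finset.sum_le_sum fun K hK => ?_)
  exact (h.cell K (hc K hK)).abs_boundary_term_le hCb hcb (hP K (hc K hK)) (hPu K (hc K hK)) hV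
    (integral_parts_facet (hfac K hK) hV hVc hVs (hP K (hc K hK)))

/-- The two elements at an interior facet fill the ball carrying `V`. The cutoff therefore has no
effect near the support, and the boundary of `Ω` is not reached. -/
theorem sum_cellBilin_interior (h : IsProblem ΓD ΓN T k C₀ Cb cb D α a b β f gN u uT)
    (hδ : 0 < δ) (he : e ∈ T.facets) (hfac : ∀ K ∈ T.cellsAt e, IsFacetAt K e δ)
    (heΩ : LiesIn e Ω) {K : Finset (E (m + 1))} (hK : K ∈ T.cellsAt e) {V : E (m + 1) → ℝ}
    (hV : ContDiff ℝ ∞ V) (hVc : HasCompactSupport V)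
    (hVs : tsupport V ⊆ Metric.ball (barycenter e) δ) :
    ∑ K ∈ T.cellsAt e,
        cellBilin (cellValue α K) (cellValue a K) (cellValue b K) K u.toFun u.grad V =
      ∑ K ∈ T.cellsAt e, (∫ x in body K, f x * V x) - 0 := by
  obtain ⟨K', hK', hne⟩ := Triangulation.exists_neighbor hδ h.domain.isOpen he hfac heΩ hK
  have hc : ∀ K ∈ T.cellsAt e, K ∈ T.cells := fun K hK => (T.mem_cellsAt.1 hK).1
  have hball : Metric.ball (barycenter e) δ ⊆ ⋃ K ∈ T.cellsAt e, body K :=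
    (Triangulation.ball_subset_union hδ (hc K hK) (hc K' hK') (T.mem_cellsAt.1 hK).2 (hfac K hK)
      (hfac K' hK') hne).trans (union_subset (subset_biUnion_of_mem (u := body) hK)
        (subset_biUnion_of_mem (u := body) hK'))
  have := sum_cellBilin_eq h.domain h.alpha_const h.a_const h.b_const h.memLp_f h.solution
    (S := T.cellsAt e) hc hV hVc (A := ∅) MeasurableSet.empty (by simp) (empty_subset _)
    (empty_subset _) ?_ ?_
  · simpa using this
  · intro x _ hx _
    exact mem_nhdsWithin_of_mem_nhds
      (mem_of_superset (Metric.isOpen_ball.mem_nhds (hVs hx)) hball)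
  · intro x hx _ hVx
    have hxΩ : x ∈ Ω := by
      rw [← interior_closure_eq h.domain.isOpen h.domain.lipschitz]
      exact interior_maximal (hball.trans (iUnion₂_subset fun K hK =>
        Triangulation.body_subset_closure (hc K hK))) Metric.isOpen_ball
        (hVs (subset_tsupport V hVx))
    exact (h.domain.isOpen.frontier_eq ▸ hx).2 hxΩ

/-- Only one element meets a boundary facet, and near the barycenter the closure of `Ω` coincides
with it. Cutting `V` off to this element hence preserves continuity, and the trace is supported in
the facet. -/
theorem sum_cellBilin_neumann (h : IsProblem ΓD ΓN T k C₀ Cb cb D α a b β f gN u uT)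
    (hδ : 0 < δ) (he : e ∈ T.facets) (hfac : ∀ K ∈ T.cellsAt e, IsFacetAt K e δ)
    (heN : LiesIn e ΓN) {K : Finset (E (m + 1))} (hK : K ∈ T.cellsAt e) {V : E (m + 1) → ℝ}
    (hV : ContDiff ℝ ∞ V) (hVc : HasCompactSupport V)
    (hVs : tsupport V ⊆ Metric.ball (barycenter e) δ) :
    ∑ K ∈ T.cellsAt e,
        cellBilin (cellValue α K) (cellValue a K) (cellValue b K) K u.toFun u.grad V =
      ∑ K ∈ T.cellsAt e, (∫ x in body K, f x * V x) -
        ∫ x in body e, gN x * V x ∂surf (m + 1) := by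
  have hKT : K ∈ T.cells := (T.mem_cellsAt.1 hK).1
  have hS := Triangulation.cellsAt_eq_singleton hδ h.domain.isOpen h.domain.lipschitz hfac
    h.domain.neumann_subset heN hK
  have hF := hfac K hK
  -- `A` is an open disc in the facet rather than the closed facet: only the relative interior is
  -- known to lie in `ΓN`.
  set A : Set (E (m + 1)) := Metric.ball (barycenter e) δ ∩
    {y | ⟪outwardNormal K e, y - barycenter e⟫ = 0} with hA
  have hAm : MeasurableSet A := measurableSet_ball.inter (isClosed_eq (by fun_prop)
    continuous_const).measurableSet
  have hAe : A ⊆ body e := fun y hy => (hF.mem_facet y hy.1 hy.2).1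
  have hU : ⋃ K ∈ T.cellsAt e, body K = body K := by simp [hS]
  have hVA : ∀ x, V x ≠ 0 → x ∈ Metric.ball (barycenter e) δ := fun x hx =>
    hVs (subset_tsupport V hx)
  have h1 := sum_cellBilin_eq h.domain h.alpha_const h.a_const h.b_const h.memLp_f h.solution
    (S := T.cellsAt e) (fun K hK => (T.mem_cellsAt.1 hK).1) hV hVc (A := A) hAm
    ((measure_mono hAe).trans_lt hF.surf_body_lt_top).ne
    (fun y hy => Triangulation.mem_of_liesIn hF heN hy.1 hy.2)
    (hU ▸ hAe.trans (body_mono (T.mem_cellsAt.1 hK).2)) ?_ ?_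
  · rw [h1]
    congr 1
    refine setIntegral_eq_of_subset_of_forall_sdiff_eq_zero (isClosed_body e).measurableSet hAe
      (fun x hx => ?_) |>.symm
    by_contra hne
    exact hx.2 ⟨hVA x (right_ne_zero_of_mul hne), hF.inner_facet x hx.1⟩
  · intro x hx hxV hxK
    rw [hU] at hxK ⊢
    rcases (hF.inner_cell x hxK).lt_or_eq with hlt | h0
    · exact mem_nhdsWithin_of_mem_nhds
        (mem_interior_iff_mem_nhds.1 (hF.mem_interior x (hVs hxV) hlt))
    -- At a point of the facet, every nearby point of the closure lies in an element containing that
    -- point. Such an element contains `e` and is therefore `K`.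
    · filter_upwards [nhdsWithin_le_nhds (T.eventually_mem_cell x), self_mem_nhdsWithin] with z hz hzΩ
      obtain ⟨K', hK', hxK', hzK'⟩ := hz hzΩ
      have : K' ∈ T.cellsAt e :=
        T.mem_cellsAt.2 ⟨hK', Triangulation.subset_of_mem he hF hK' (hVs hxV) h0 hxK'⟩
      rw [hS, Finset.mem_singleton] at this
      rwa [← this]
  · intro x hx hxK hVx
    rw [hU] at hxK
    refine ⟨hVA x hVx, ?_⟩
    rcases (hF.inner_cell x hxK).lt_or_eq with hlt | h0
    · have hxΩ : x ∈ Ω := Triangulation.interior_body_subset h.domain.isOpen h.domain.lipschitz hKT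
        (hF.mem_interior x (hVA x hVx) hlt)
      exact absurd hxΩ (h.domain.isOpen.frontier_eq ▸ hx).2
    · exact h0

/-- The flux jump on a facet is a polynomial that satisfies the error equation. -/
theorem exists_jump_poly (h : IsProblem ΓD ΓN T k C₀ Cb cb D α a b β f gN u uT) (hCb : 0 ≤ Cb)
    (hcb : 0 ≤ cb) (hδ : 0 < δ) (he : e ∈ T.facets) (hfac : ∀ K ∈ T.cellsAt e, IsFacetAt K e δ)
    {K : Finset (E (m + 1))} (hK : K ∈ T.cellsAt e) :
    ∃ J, IsPoly k J ∧ jump T ΓN k α gN uT e =ᵐ[facetMeasure e] J ∧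
      ∀ V : E (m + 1) → ℝ, ContDiff ℝ ∞ V → HasCompactSupport V →
        tsupport V ⊆ Metric.ball (barycenter e) δ →
        ∫ x in body e, J x * V x ∂surf (m + 1) ≤
          ∑ K ∈ T.cellsAt e, testBound k (lowerConst Cb cb) α a b β f u uT V K +
            neumannNorm ΓN k gN e * l2norm (facetMeasure e) V := by
  obtain ⟨G, hG, hGe⟩ := h.exists_flux_poly (e := e)
  have hm : MeasurableSet (body e) := (isClosed_body e).measurableSet
  have hGV : ∀ V : E (m + 1) → ℝ, ∫ x in body e,
      (∑ K ∈ T.cellsAt e, ⟪flux α uT K x, outwardNormal K e⟫) * V x ∂surf (m + 1) =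
      ∫ x in body e, G x * V x ∂surf (m + 1) := fun V =>
    setIntegral_congr_fun hm fun x hx => by rw [hGe x hx]
  by_cases h1 : LiesIn e Ω
  · refine ⟨G, hG, ?_, fun V hV hVc hVs => ?_⟩
    · filter_upwards [ae_restrict_mem hm] with x hx
      rw [jump, if_pos h1, hGe x hx]
    · have := h.abs_facet_term_le hCb hcb hfac hV hVc hVs
        (h.sum_cellBilin_interior hδ he hfac h1 hK hV hVc hVs)
      rw [hGV, zero_sub, abs_neg] at this
      exact (le_abs_self _).trans (this.trans (le_add_of_nonneg_right
        (mul_nonneg (neumannNorm_nonneg _ _ _ _) (l2norm_nonneg _ _))))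
  by_cases h2 : LiesIn e ΓN
  · have hg := (hfac K hK).memLp_of_liesIn h2 h.memLp_gN
    obtain ⟨F, hF, hFg⟩ := l2Proj_ae_eq_isPoly (k - 1) hg
    refine ⟨fun x => G x - F x, hG.sub (hF.mono (Nat.sub_le k 1)), ?_, fun V hV hVc hVs => ?_⟩
    · filter_upwards [ae_restrict_mem hm, hFg] with x hx hx'
      rw [jump, if_neg h1, if_pos h2, hGe x hx, hx']
    · have h3 := h.abs_facet_term_le hCb hcb hfac hV hVc hVs
        (h.sum_cellBilin_neumann hδ he hfac h2 hK hV hVc hVs)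
      rw [hGV] at h3
      have hVm := (hfac K hK).memLp hV.continuous
      have h4 := abs_integral_mul_le (hg.sub (memLp_l2Proj (k - 1) hg)) hVm
      have h5 : ∫ x, (gN - l2Proj (facetMeasure e) (k - 1) gN) x * V x ∂facetMeasure e =
          (∫ x, gN x * V x ∂facetMeasure e) - ∫ x, F x * V x ∂facetMeasure e := by
        rw [← integral_sub (MemLp_two_mul hg hVm)
          (MemLp_two_mul ((hfac K hK).memLp hF.continuous) hVm)]
        refine integral_congr_ae ?_
        filter_upwards [hFg] with x hx
        rw [Pi.sub_apply, hx, sub_mul]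
      have h6 : ∫ x, (G x - F x) * V x ∂facetMeasure e =
          (∫ x, G x * V x ∂facetMeasure e) - ∫ x, F x * V x ∂facetMeasure e := by
        rw [← integral_sub (MemLp_two_mul ((hfac K hK).memLp hG.continuous) hVm)
          (MemLp_two_mul ((hfac K hK).memLp hF.continuous) hVm)]
        simp only [sub_mul]
      have h7 : neumannNorm ΓN k gN e =
          l2norm (facetMeasure e) (gN - l2Proj (facetMeasure e) (k - 1) gN) := if_pos h2
      rw [h5, ← h7] at h4
      change ∫ x, (G x - F x) * V x ∂facetMeasure e ≤ _
      change |(∫ x, gN x * V x ∂facetMeasure e) - ∫ x, G x * V x ∂facetMeasure e| ≤ _ at h3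
      rw [h6]
      linarith [(abs_le.1 h3).1, (abs_le.1 h4).2]
  -- On the remaining facets the jump is zero by definition and the right-hand side is nonnegative.
  · refine ⟨fun _ => 0, IsPoly.const 0, ?_, fun V _ _ _ => ?_⟩
    · filter_upwards with x
      rw [jump, if_neg h1, if_neg h2]
    · simp only [zero_mul, integral_zero]
      exact add_nonneg (Finset.sum_nonneg fun K _ =>
        testBound_nonneg k (lowerConst_nonneg cb hCb) α a b β f u uT V K)
        (mul_nonneg (neumannNorm_nonneg _ _ _ _) (l2norm_nonneg _ _))

end IsProblem

end

section

variable {d : ℕ}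

/-! ### Local efficiency -/

theorem le_alphaFacet {Ω : Set (E d)} {T : Triangulation Ω} (α : E d → ℝ) {e K : Finset (E d)}
    (hK : K ∈ T.cellsAt e) : cellValue α K ≤ alphaFacet T α e :=
  le_csSup ((T.cellsAt e).finite_toSet.image _).bddAbove (mem_image_of_mem _ hK)

theorem diam_nonneg (s : Finset (E d)) : 0 ≤ diam s := Metric.diam_nonneg

theorem diam_pos_of_one_lt_card {e : Finset (E d)} (h : 1 < e.card) : 0 < diam e := by
  obtain ⟨x, hx, y, hy, hne⟩ := Finset.one_lt_card.1 h
  exact (dist_pos.2 hne).trans_le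
    (Metric.dist_le_diam_of_mem (isCompact_body e).isBounded (subset_body e hx) (subset_body e hy))

theorem IsProblem.diam_cell_le {Ω ΓD ΓN : Set (E d)} {T : Triangulation Ω} {k : ℕ}
    {C₀ Cb cb D : ℝ} {α : E d → ℝ} {a : E d → E d} {b : E d → ℝ} {β : ℝ} {f gN : E d → ℝ}
    {u : H1Function Ω} {uT : E d → ℝ} (h : IsProblem ΓD ΓN T k C₀ Cb cb D α a b β f gN u uT)
    {K : Finset (E d)} (hK : K ∈ T.cells) : diam K ≤ D :=
  (Metric.diam_mono (Triangulation.body_subset_closure hK) h.domain.isBounded.closure).trans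
    ((Metric.diam_closure Ω).trans_le h.diam_le)

/-- The flux jump is bounded by the error, the residuals and the data oscillation. -/
theorem exists_jump_bound {m : ℕ} (hm : 0 < m) (k : ℕ) {C₀ Cb cb D : ℝ} (hC₀ : 1 < C₀)
    (hCb : 0 ≤ Cb) (hcb : 0 ≤ cb) (hD : 0 ≤ D) : ∃ C : ℝ, 1 ≤ C ∧
    ∀ {Ω ΓD ΓN : Set (E (m + 1))} {T : Triangulation Ω} {α : E (m + 1) → ℝ}
      {a : E (m + 1) → E (m + 1)} {b : E (m + 1) → ℝ} {β : ℝ} {f gN : E (m + 1) → ℝ}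
      {u : H1Function Ω} {uT : E (m + 1) → ℝ},
      IsProblem ΓD ΓN T k C₀ Cb cb D α a b β f gN u uT →
      ∀ {e K : Finset (E (m + 1))}, e ∈ T.facets → K ∈ T.cellsAt e →
      √(diam e) * (√(alphaFacet T α e))⁻¹ * l2norm (facetMeasure e) (jump T ΓN k α gN uT e) ≤
        C * (∑ K' ∈ T.cellsAt e, (diam K' * (√(cellValue α K'))⁻¹ *
          (residualNorm k α a b f uT K' + dataNorm k f K') + cellError α β u uT K') +
          √(diam e) * (√(alphaFacet T α e))⁻¹ * neumannNorm ΓN k gN e) := by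
  have hκ : 0 < 1 / (2 * C₀ * ((m + 1 : ℕ) : ℝ)) := by positivity
  have hκ1 : 1 / (2 * C₀ * ((m + 1 : ℕ) : ℝ)) ≤ 1 := by
    rw [div_le_one (by positivity)]
    have : (1 : ℝ) ≤ ((m + 1 : ℕ) : ℝ) := by exact_mod_cast Nat.le_add_left 1 m
    nlinarith
  obtain ⟨c, hc, hb⟩ := exists_facet_bound m k hκ hκ1
  set κ := 1 / (2 * C₀ * ((m + 1 : ℕ) : ℝ)) with hκdef
  have hM := lowerConst_nonneg cb hCb
  set M := lowerConst Cb cb with hMdef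
  have hMD : 0 ≤ M * D := by positivity
  refine ⟨c * (1 + M * D), by nlinarith, ?_⟩
  intro Ω ΓD ΓN T α a b β f gN u uT h e K he hK
  have hcells : ∀ K ∈ T.cellsAt e, K ∈ T.cells := fun K hK => (T.mem_cellsAt.1 hK).1
  have hcard : e.card = m + 1 := (T.mem_facets.1 he).2
  -- In dimension at least two a facet has two distinct vertices; a single point would have diameter
  -- zero.
  have hh : 0 < diam e := diam_pos_of_one_lt_card (by omega)
  have hfac : ∀ K ∈ T.cellsAt e, IsFacetAt K e (κ * diam e) := fun K hK => by
    have := Triangulation.isFacetAt (by linarith) h.shapeRegular m.succ_pos he hK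
    rwa [show diam e / (2 * C₀ * ((m + 1 : ℕ) : ℝ)) = κ * diam e by rw [hκdef]; ring] at this
  obtain ⟨J, hJ, hjJ, htest⟩ := h.exists_jump_poly hCb hcb (by positivity) he hfac hK
  have hr : ∀ K, 0 ≤ residualNorm k α a b f uT K + dataNorm k f K := fun K =>
    add_nonneg (l2norm_nonneg _ _) (l2norm_nonneg _ _)
  have hE : ∀ K, 0 ≤ cellError α β u uT K := fun K => energyNorm_nonneg _ _ _ _ _
  have hg := neumannNorm_nonneg ΓN k gN e
  set r : Finset (E (m + 1)) → ℝ := fun K => residualNorm k α a b f uT K + dataNorm k f K with hrdef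
  set En : Finset (E (m + 1)) → ℝ := fun K => cellError α β u uT K with hEdef
  set A : Finset (E (m + 1)) → ℝ := fun K => √(cellValue α K) with hA
  have hA0 : ∀ K, 0 ≤ A K := fun K => Real.sqrt_nonneg _
  set Ae := √(alphaFacet T α e) with hAe
  have hAKe : ∀ K ∈ T.cellsAt e, A K ≤ Ae := fun K hK => Real.sqrt_le_sqrt (le_alphaFacet α hK)
  have hApos : ∀ K ∈ T.cellsAt e, 0 < A K := fun K hK =>
    Real.sqrt_pos.2 (h.cell K (hcells K hK)).alpha_pos
  have hAe0 : 0 < Ae := (hApos K hK).trans_le (hAKe K hK)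
  -- `X` and `Y` collect the coefficients of the norms of `V` and of its gradient in `testBound`;
  -- the reaction and convection constant `M` belongs to `X`.
  have hb' := hb (hfac K hK) hh (Finset.card_pos.1 (by omega)) hJ hjJ
    (X := ∑ K ∈ T.cellsAt e, (r K + En K * A K * M)) (Y := ∑ K ∈ T.cellsAt e, En K * A K)
    (g := neumannNorm ΓN k gN e)
    (Finset.sum_nonneg fun K _ => add_nonneg (hr K) (mul_nonneg (mul_nonneg (hE K) (hA0 K)) hM))
    (Finset.sum_nonneg fun K _ => mul_nonneg (hE K) (hA0 K)) hg
    (fun V a₁ a₂ hV hVc hVs h1 h2 => by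
      refine (htest V hV hVc hVs).trans (add_le_add_left ?_ _)
      rw [Finset.sum_mul, Finset.sum_mul, ← Finset.sum_add_distrib]
      refine Finset.sum_le_sum fun K _ => ?_
      have i1 : l2norm (cellMeasure K) V ≤ a₁ := h1 _
      have i2 : l2norm (cellMeasure K) (gradient V) ≤ a₂ := h2 _
      have hEA : 0 ≤ En K * A K := mul_nonneg (hE K) (hA0 K)
      calc testBound k M α a b β f u uT V K = r K * l2norm (cellMeasure K) V +
            En K * A K * (l2norm (cellMeasure K) (gradient V) + M * l2norm (cellMeasure K) V) := rfl
        _ ≤ r K * a₁ + En K * A K * (a₂ + M * a₁) := by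
          have := hr K
          gcongr
        _ = _ := by ring)
  have hDe : diam e ≤ D :=
    (Triangulation.diam_mono (T.mem_cellsAt.1 hK).2).trans (h.diam_cell_le (hcells K hK))
  -- The decisive use of `α_e` as a maximum: `Ae⁻¹ ≤ (A K)⁻¹` converts the residual weights to those
  -- of the element, and `Ae⁻¹ * A K ≤ 1` removes the coefficient from the error terms.
  have key : Ae⁻¹ * (diam e * ∑ K ∈ T.cellsAt e, (r K + En K * A K * M) +
      ∑ K ∈ T.cellsAt e, En K * A K) ≤ (1 + M * D) *
      ∑ K ∈ T.cellsAt e, (diam K * (A K)⁻¹ * r K + En K) := by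
    rw [Finset.mul_sum, ← Finset.sum_add_distrib, Finset.mul_sum, Finset.mul_sum]
    refine Finset.sum_le_sum fun K hK => ?_
    have i1 : Ae⁻¹ ≤ (A K)⁻¹ := inv_anti₀ (hApos K hK) (hAKe K hK)
    have i2 : Ae⁻¹ * A K ≤ 1 := by
      rw [inv_mul_le_iff₀ hAe0, mul_one]
      exact hAKe K hK
    have i3 : diam e ≤ diam K := Triangulation.diam_mono (T.mem_cellsAt.1 hK).2
    have i4 : diam e * Ae⁻¹ * r K ≤ diam K * (A K)⁻¹ * r K := by
      have := hr K
      have := diam_nonneg K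
      gcongr
    have i5 : 0 ≤ diam e * Ae⁻¹ * r K := by
      have := hr K
      positivity
    have i6 : (Ae⁻¹ * A K) * (En K * (1 + M * diam e)) ≤ En K * (1 + M * D) := by
      have : 0 ≤ En K := hE K
      have i7 : En K * (1 + M * diam e) ≤ En K * (1 + M * D) := by gcongr
      refine le_trans ?_ i7
      exact mul_le_of_le_one_left (by positivity) i2
    have i8 : 0 ≤ M * D * (diam K * (A K)⁻¹ * r K) := mul_nonneg hMD (i5.trans i4)
    calc Ae⁻¹ * (diam e * (r K + En K * A K * M) + En K * A K) = diam e * Ae⁻¹ * r K +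
          (Ae⁻¹ * A K) * (En K * (1 + M * diam e)) := by ring
      _ ≤ _ := by linarith
  have i9 : 0 ≤ √(diam e) * Ae⁻¹ * neumannNorm ΓN k gN e := by positivity
  calc √(diam e) * Ae⁻¹ * l2norm (facetMeasure e) (jump T ΓN k α gN uT e) =
        Ae⁻¹ * (√(diam e) * l2norm (facetMeasure e) (jump T ΓN k α gN uT e)) := by ring
    _ ≤ Ae⁻¹ * (c * (diam e * ∑ K ∈ T.cellsAt e, (r K + En K * A K * M) +
        ∑ K ∈ T.cellsAt e, En K * A K + √(diam e) * neumannNorm ΓN k gN e)) := by gcongr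
    _ = c * (Ae⁻¹ * (diam e * ∑ K ∈ T.cellsAt e, (r K + En K * A K * M) +
        ∑ K ∈ T.cellsAt e, En K * A K) + √(diam e) * Ae⁻¹ * neumannNorm ΓN k gN e) := by ring
    _ ≤ c * ((1 + M * D) * ∑ K ∈ T.cellsAt e, (diam K * (A K)⁻¹ * r K + En K) +
        (1 + M * D) * (√(diam e) * Ae⁻¹ * neumannNorm ΓN k gN e)) := by
      refine mul_le_mul_of_nonneg_left (add_le_add key ?_) (by linarith)
      nlinarith
    _ = _ := by ring

/-! ### From weighted squares to sums of norms. -/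

theorem sq_mul_inv_sqrt_mul {h α x : ℝ} (hα : 0 ≤ α) :
    (h * (√α)⁻¹ * x) ^ 2 = h ^ 2 * α⁻¹ * x ^ 2 := by
  rw [mul_pow, mul_pow, inv_pow, Real.sq_sqrt hα]

theorem sq_sqrt_mul_inv_sqrt_mul {h α x : ℝ} (hh : 0 ≤ h) (hα : 0 ≤ α) :
    (√h * (√α)⁻¹ * x) ^ 2 = h * α⁻¹ * x ^ 2 := by
  rw [mul_pow, mul_pow, inv_pow, Real.sq_sqrt hα, Real.sq_sqrt hh]

/-- The square of a sum of nonnegative numbers dominates the sum of their squares; the factor `1 /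
2` is simply given away. -/
theorem sqrt_sq_add_half_sum_sq_le {ι : Type*} {s : Finset ι} {A : ℝ} {B : ι → ℝ} (hA : 0 ≤ A)
    (hB : ∀ i ∈ s, 0 ≤ B i) :
    √(A ^ 2 + (1 / 2) * ∑ i ∈ s, B i ^ 2) ≤ A + ∑ i ∈ s, B i := by
  have h1 := Finset.sum_nonneg hB
  have h2 := Finset.sum_sq_le_sq_sum_of_nonneg hB
  have h3 : 0 ≤ ∑ i ∈ s, B i ^ 2 := Finset.sum_nonneg fun i _ => sq_nonneg _
  refine Real.sqrt_le_iff.2 ⟨add_nonneg hA h1, ?_⟩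
  nlinarith [mul_nonneg hA h1]

section Osc

variable {Ω : Set (E d)} {T : Triangulation Ω} (ΓN : Set (E d)) (k : ℕ) {α : E d → ℝ}
  (f gN : E d → ℝ) {K : Finset (E d)}

theorem dataNorm_le_osc (hK : 0 ≤ cellValue α K)
    (hα : ∀ e ∈ T.facetsOf K, 0 ≤ alphaFacet T α e) :
    diam K * (√(cellValue α K))⁻¹ * dataNorm k f K ≤ osc T ΓN k α f gN K := by
  classical
  refine (le_abs_self _).trans (Real.abs_le_sqrt ?_)
  rw [sq_mul_inv_sqrt_mul hK]
  refine le_add_of_nonneg_right (Finset.sum_nonneg fun e he => ?_)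
  have h1 := hα e (Finset.mem_filter.1 he).1
  have h2 := diam_nonneg e
  positivity

theorem neumannNorm_le_osc (hK : 0 ≤ cellValue α K)
    (hα : ∀ e ∈ T.facetsOf K, 0 ≤ alphaFacet T α e) {e : Finset (E d)} (he : e ∈ T.facetsOf K) :
    √(diam e) * (√(alphaFacet T α e))⁻¹ * neumannNorm ΓN k gN e ≤ osc T ΓN k α f gN K := by
  classical
  unfold neumannNorm
  split_ifs with heN
  · refine (le_abs_self _).trans (Real.abs_le_sqrt ?_)
    rw [sq_sqrt_mul_inv_sqrt_mul (diam_nonneg e) (hα e he)]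
    refine le_add_of_nonneg_of_le (by positivity) ?_
    refine Finset.single_le_sum (f := fun e => diam e * (alphaFacet T α e)⁻¹ *
      l2norm (facetMeasure e) (fun x => gN x - l2Proj (facetMeasure e) (k - 1) gN x) ^ 2)
      (fun e he => ?_) (Finset.mem_filter.2 ⟨he, heN⟩)
    have h1 := hα e (Finset.mem_filter.1 he).1
    have h2 := diam_nonneg e
    positivity
  · rw [mul_zero]
    exact Real.sqrt_nonneg _

theorem eta_le {a : E d → E d} {b : E d → ℝ} {uT : E d → ℝ} (hK : 0 ≤ cellValue α K)
    (hα : ∀ e ∈ T.facetsOf K, 0 ≤ alphaFacet T α e) :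
    eta T ΓN k α a b f gN uT K ≤
      diam K * (√(cellValue α K))⁻¹ * residualNorm k α a b f uT K +
        ∑ e ∈ T.facetsOf K, √(diam e) * (√(alphaFacet T α e))⁻¹ *
          l2norm (facetMeasure e) (jump T ΓN k α gN uT e) := by
  have h1 : 0 ≤ diam K * (√(cellValue α K))⁻¹ * residualNorm k α a b f uT K :=
    mul_nonneg (mul_nonneg (diam_nonneg K) (inv_nonneg.2 (Real.sqrt_nonneg _)))
      (l2norm_nonneg _ _)
  refine le_trans (le_of_eq ?_) (sqrt_sq_add_half_sum_sq_le h1 fun e (_ : e ∈ T.facetsOf K) =>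
    mul_nonneg (mul_nonneg (Real.sqrt_nonneg _) (inv_nonneg.2 (Real.sqrt_nonneg _)))
      (l2norm_nonneg (facetMeasure e) (jump T ΓN k α gN uT e)))
  rw [sq_mul_inv_sqrt_mul hK, Finset.sum_congr rfl fun e he =>
    sq_sqrt_mul_inv_sqrt_mul (diam_nonneg e) (hα e he)]
  rfl

end Osc

theorem l2norm_mono {F : Type*} [NormedAddCommGroup F] {μ ν : Measure (E d)}
    {g : E d → F} (h : μ ≤ ν) (hg : Integrable (fun x => ‖g x‖ ^ 2) ν) :
    l2norm μ g ≤ l2norm ν g :=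
  Real.sqrt_le_sqrt (integral_mono_measure h (.of_forall fun _ => sq_nonneg _) hg)

/-- Monotonicity of the integral requires integrability over the larger set. Elements overlap in
null sets, so the measure of the patch is a sum over elements, and on each of them square
integrability is known. -/
theorem IsProblem.cellError_le {Ω ΓD ΓN : Set (E d)} {T : Triangulation Ω} {k : ℕ}
    {C₀ Cb cb D : ℝ} {α : E d → ℝ} {a : E d → E d} {b : E d → ℝ} {β : ℝ} (hβ : 0 ≤ β)
    {f gN : E d → ℝ} {u : H1Function Ω} {uT : E d → ℝ}
    (h : IsProblem ΓD ΓN T k C₀ Cb cb D α a b β f gN u uT) {K K' : Finset (E d)}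
    (hK' : K' ∈ T.neighbors K) : cellError α β u uT K' ≤
      energyNorm α β (T.patch K) (fun x => uT x - u.toFun x)
        (fun x => gradient uT x - u.grad x) := by
  have hsub : T.neighbors K ⊆ T.cells := fun K hK => (T.mem_neighbors.1 hK).1
  have hint : ∀ {F : Type _} [NormedAddCommGroup F] {g : E d → F},
      (∀ K ∈ T.cells, MemLp g 2 (cellMeasure K)) →
      l2norm (volume.restrict (body K')) g ≤ l2norm (volume.restrict (T.patch K)) g := by
    intro F _ g hg
    refine l2norm_mono (Measure.restrict_mono
      (subset_biUnion_of_mem (u := body) hK') le_rfl) ?_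
    rw [Triangulation.patch, Triangulation.restrict_biUnion hsub,
      integrable_finsetSum_measure]
    exact fun K'' hK'' => (hg K'' (hsub hK'')).integrable_norm_pow (by simp)
  have h1 : l2norm (volume.restrict (body K')) (fun x => √(α x) • (gradient uT x - u.grad x)) ≤
      l2norm (volume.restrict (T.patch K)) fun x => √(α x) • (gradient uT x - u.grad x) := by
    refine hint fun K'' hK'' => ?_
    have := h.cell K'' hK''
    refine (memLp_congr_ae ?_).2
      ((this.memLp_gradient_uT.sub this.memLp_grad).const_smul √(cellValue α K''))
    filter_upwards [Triangulation.ae_eq_cellValue h.alpha_const hK''] with x hx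
    rw [hx]
    rfl
  have h2 : l2norm (volume.restrict (body K')) (fun x => uT x - u.toFun x) ≤
      l2norm (volume.restrict (T.patch K)) fun x => uT x - u.toFun x :=
    hint fun K'' hK'' => (h.cell K'' hK'').memLp_uT.sub (h.cell K'' hK'').memLp_u
  exact Real.sqrt_le_sqrt (add_le_add (pow_le_pow_left₀ (l2norm_nonneg _ _) h1 2)
    (mul_le_mul_of_nonneg_left (pow_le_pow_left₀ (l2norm_nonneg _ _) h2 2) hβ))

theorem Triangulation.card_cellsAt_le_two {Ω : Set (E d)} {T : Triangulation Ω}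
    {e : Finset (E d)} {δ : ℝ} (hδ : 0 < δ) (hfac : ∀ K ∈ T.cellsAt e, IsFacetAt K e δ) :
    (T.cellsAt e).card ≤ 2 := by
  classical
  by_contra! h
  obtain ⟨K, hK, K', hK', hne⟩ := Finset.one_lt_card.1 (by omega : 1 < (T.cellsAt e).card)
  rw [cellsAt_eq_pair hδ hfac hK hK' hne.symm, Finset.card_pair hne] at h
  omega

/-- Counting all subsets of the vertices is crude, but any bound depending on the dimension alone
suffices. -/
theorem Triangulation.card_facetsOf_le {Ω : Set (E d)} {T : Triangulation Ω}
    {K : Finset (E d)} (hK : K ∈ T.cells) : (T.facetsOf K).card ≤ 2 ^ (d + 1) := by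
  rw [← (T.mem_cells.1 hK).2, ← Finset.card_powerset]
  exact Finset.card_le_card fun e he => Finset.mem_powerset.2 (T.mem_facetsOf.1 he).2

theorem Triangulation.self_mem_neighbors {Ω : Set (E d)} {T : Triangulation Ω} (hd : 0 < d)
    {K : Finset (E d)} (hK : K ∈ T.cells) : K ∈ T.neighbors K := by
  obtain ⟨e, heK, hcard⟩ := Finset.exists_subset_card_eq
    (show d ≤ K.card by rw [(T.mem_cells.1 hK).2]; omega)
  have he : e ∈ T.facets := T.mem_facets.2
    ⟨T.complex.down_closed (T.mem_cells.1 hK).1 heK (Finset.card_pos.1 (by omega)), hcard⟩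
  exact T.mem_neighbors.2 ⟨hK, e, he, heK, heK⟩

/-- Local efficiency of the residual indicator. -/
theorem exists_efficiency_bound {m : ℕ} (hm : 0 < m) (k : ℕ) {C₀ Cb cb D : ℝ} (hC₀ : 1 < C₀)
    (hCb : 0 ≤ Cb) (hcb : 0 ≤ cb) (hD : 0 ≤ D) : ∃ C : ℝ, 0 ≤ C ∧
    ∀ {Ω ΓD ΓN : Set (E (m + 1))} {T : Triangulation Ω} {α : E (m + 1) → ℝ}
      {a : E (m + 1) → E (m + 1)} {b : E (m + 1) → ℝ} {β : ℝ} {f gN : E (m + 1) → ℝ}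
      {u : H1Function Ω} {uT : E (m + 1) → ℝ},
      IsProblem ΓD ΓN T k C₀ Cb cb D α a b β f gN u uT → 0 ≤ β → ∀ K ∈ T.cells,
      eta T ΓN k α a b f gN uT K ≤
        C * (energyNorm α β (T.patch K) (fun x => uT x - u.toFun x)
              (fun x => gradient uT x - u.grad x) +
            ∑ K' ∈ T.neighbors K, osc T ΓN k α f gN K') := by
  obtain ⟨c₁, hc₁, hres⟩ := exists_residual_bound (m + 1) k hC₀ hCb hcb hD
  obtain ⟨c₂, hc₂, hjump⟩ := exists_jump_bound hm k hC₀ hCb hcb hD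
  -- The residual costs `c₁`. Each of at most `2 ^ (m + 2)` facets costs `c₂` times the
  -- contributions of at most two elements, `c₁` for the residual and `1` for data and error
  -- together, plus `1` for the Neumann oscillation.
  refine ⟨c₁ + 2 ^ (m + 2) * (c₂ * (2 * (c₁ + 1) + 1)), by positivity, ?_⟩
  intro Ω ΓD ΓN T α a b β f gN u uT h hβ K hK
  have hfacet : ∀ K ∈ T.cells, ∀ e ∈ T.facetsOf K, e ∈ T.facets ∧ K ∈ T.cellsAt e :=
    fun K hK e he => ⟨(T.mem_facetsOf.1 he).1, T.mem_cellsAt.2 ⟨hK, (T.mem_facetsOf.1 he).2⟩⟩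
  have hα : ∀ K ∈ T.cells, 0 < cellValue α K := fun K hK => (h.cell K hK).alpha_pos
  have hαe : ∀ K ∈ T.cells, ∀ e ∈ T.facetsOf K, 0 ≤ alphaFacet T α e := fun K hK e he =>
    (hα K hK).le.trans (le_alphaFacet α (hfacet K hK e he).2)
  have hnb : ∀ K' ∈ T.neighbors K, K' ∈ T.cells := fun K' hK' => (T.mem_neighbors.1 hK').1
  have hosc : ∀ K', 0 ≤ osc T ΓN k α f gN K' := fun K' => Real.sqrt_nonneg _
  set En := energyNorm α β (T.patch K) (fun x => uT x - u.toFun x)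
    (fun x => gradient uT x - u.grad x) with hEn
  set O := ∑ K' ∈ T.neighbors K, osc T ΓN k α f gN K' with hO
  have hEn0 : 0 ≤ En := energyNorm_nonneg _ _ _ _ _
  have hO0 : 0 ≤ O := Finset.sum_nonneg fun K' _ => hosc K'
  have hosc_le : ∀ K' ∈ T.neighbors K, osc T ΓN k α f gN K' ≤ O := fun K' hK' =>
    Finset.single_le_sum (f := fun K' => osc T ΓN k α f gN K') (fun K' _ => hosc K') hK'
  have hdat : ∀ K' ∈ T.neighbors K, diam K' * (√(cellValue α K'))⁻¹ * dataNorm k f K' ≤ O :=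
    fun K' hK' => (dataNorm_le_osc ΓN k f gN (hα K' (hnb K' hK')).le
      (hαe K' (hnb K' hK'))).trans (hosc_le K' hK')
  have hr : ∀ K' ∈ T.neighbors K,
      diam K' * (√(cellValue α K'))⁻¹ * residualNorm k α a b f uT K' ≤ c₁ * (En + O) := by
    intro K' hK'
    have hc := hnb K' hK'
    refine (hres (h.cell K' hc) ((h.cell K' hc).isSimplex.diam_pos m.succ_pos) (h.diam_cell_le hc)
      (Triangulation.exists_closedBall_subset (by linarith) h.shapeRegular m.succ_pos hc)
      fun V hV hVc hVs => h.cellBilin_eq hc hV hVc hVs).trans ?_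
    have h1 := hdat K' hK'
    have h2 := h.cellError_le hβ hK'
    exact mul_le_mul_of_nonneg_left (by linarith) (by linarith)
  have hKn := Triangulation.self_mem_neighbors m.succ_pos hK
  have hj : ∀ e ∈ T.facetsOf K, √(diam e) * (√(alphaFacet T α e))⁻¹ *
      l2norm (facetMeasure e) (jump T ΓN k α gN uT e) ≤
      c₂ * (2 * (c₁ + 1) + 1) * (En + O) := by
    intro e he
    obtain ⟨hef, hKe⟩ := hfacet K hK e he
    refine (hjump h hef hKe).trans ?_
    have h1 : ∀ K' ∈ T.cellsAt e, diam K' * (√(cellValue α K'))⁻¹ *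
        (residualNorm k α a b f uT K' + dataNorm k f K') + cellError α β u uT K' ≤
        (c₁ + 1) * (En + O) := by
      intro K' hK'
      have hn : K' ∈ T.neighbors K := T.mem_neighbors.2 ⟨(T.mem_cellsAt.1 hK').1, e, hef,
        (T.mem_cellsAt.1 hKe).2, (T.mem_cellsAt.1 hK').2⟩
      have i1 := hr K' hn
      have i2 := hdat K' hn
      have i3 := h.cellError_le hβ hn
      rw [mul_add]
      linarith
    have hh : 0 < diam e := diam_pos_of_one_lt_card (by
      have := (T.mem_facets.1 hef).2
      omega)
    have h2 : ((T.cellsAt e).card : ℝ) ≤ 2 := by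
      exact_mod_cast Triangulation.card_cellsAt_le_two (by positivity) fun K' hK' =>
        Triangulation.isFacetAt (by linarith) h.shapeRegular m.succ_pos hef hK'
    have h3 := (Finset.sum_le_card_nsmul _ _ _ h1)
    rw [nsmul_eq_mul] at h3
    have h4 := (neumannNorm_le_osc ΓN k f gN (hα K hK).le (hαe K hK) he).trans (hosc_le K hKn)
    have h5 : ((T.cellsAt e).card : ℝ) * ((c₁ + 1) * (En + O)) ≤ 2 * ((c₁ + 1) * (En + O)) := by
      gcongr
    rw [mul_assoc c₂]
    refine mul_le_mul_of_nonneg_left ?_ (by linarith)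
    linarith
  refine (eta_le ΓN k f gN (hα K hK).le (hαe K hK)).trans ?_
  have h6 := Finset.sum_le_card_nsmul _ _ _ hj
  rw [nsmul_eq_mul] at h6
  have h7 : ((T.facetsOf K).card : ℝ) ≤ 2 ^ (m + 2) := by
    exact_mod_cast Triangulation.card_facetsOf_le hK
  have h8 : ((T.facetsOf K).card : ℝ) * (c₂ * (2 * (c₁ + 1) + 1) * (En + O)) ≤
      2 ^ (m + 2) * (c₂ * (2 * (c₁ + 1) + 1) * (En + O)) := by
    gcongr
  have h9 := hr K hKn
  linarith

end

end CDR

end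

open CDR in
/-- Local efficiency of the residual indicator in the diffusion-dominated regime. -/
theorem mainTheorem6 (d : ℕ) (hd : d = 2 ∨ d = 3) (k : ℕ) (hk : 1 ≤ k)
    (C₀ Cb cb D : ℝ) (hC₀ : 1 < C₀) (hCb : 0 ≤ Cb) (hcb : 0 ≤ cb) :
    ∃ C : ℝ, 0 ≤ C ∧
      ∀ (Ω ΓD ΓN : Set (E d)), IsDomainWithBoundary Ω ΓD ΓN → Metric.diam Ω ≤ D →
      ∀ T : Triangulation Ω, T.ShapeRegular C₀ → T.Resolves ΓD ΓN →
      ∀ (α : E d → ℝ) (a : E d → E d) (b : E d → ℝ) (β : ℝ) (Da : Fin d → E d → E d),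
        IsAdmissible T ΓD α a b β cb Da → DiffusionDominated Ω α a b Cb →
      ∀ f gN : E d → ℝ, MemLp f 2 (volume.restrict Ω) → MemLp gN 2 ((surf d).restrict ΓN) →
      ∀ u : H1Function Ω, IsWeakSolution Ω ΓD ΓN α a b f gN u →
      ∀ uT : E d → ℝ, IsFESolution T ΓD ΓN k α a b f gN uT →
      ∀ K ∈ T.cells,
        eta T ΓN k α a b f gN uT K ≤
          C * (energyNorm α β (T.patch K) (fun x => uT x - u.toFun x)
                (fun x => gradient uT x - u.grad x) +
              ∑ K' ∈ T.neighbors K, osc T ΓN k α f gN K') := by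
  obtain ⟨m, hm, rfl⟩ : ∃ m, 0 < m ∧ d = m + 1 := ⟨d - 1, by omega, by omega⟩
  -- `D` carries no sign condition, while the local estimates need a nonnegative bound on the
  -- diameter; `max D 0` provides one.
  obtain ⟨C, hC, h⟩ := exists_efficiency_bound hm k hC₀ hCb hcb (le_max_right D 0)
  refine ⟨C, hC, fun Ω ΓD ΓN hdom hdiam T hT _ α a b β Da hadm hdd f gN hf hgN u hu uT huT => ?_⟩
  have hP : IsProblem ΓD ΓN T k C₀ Cb cb (max D 0) α a b β f gN u uT := {
    domain := hdom
    diam_le := hdiam.trans (le_max_left D 0)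
    shapeRegular := hT
    cell := fun K hK => hadm.isCellProblem hdom hdd hf u huT.1 hK
    alpha_const := hadm.alpha_const
    a_const := hadm.a_const
    b_const := hadm.b_const
    memLp_f := hf
    memLp_gN := hgN
    solution := hu }
  exact h hP hadm.beta_nonneg
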